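/- Let $p\ge 2$ be a fixed integer and let $\theta_0\in\mathbb R^p$ be a fixed unit vector. A shape matrix is a symmetric positive definite $p\times p$ matrix with trace $p$. The angular Gaussian distribution with shape matrix $V$ is the distribution on the unit sphere $\mathcal S^{p-1}$ with density $$u\mapsto \frac{\Gamma(p/2)}{2\pi^{p/2}(\det V)^{1/2}}\,(u'V^{-1}u)^{-p/2}$$ with respect to the surface area measure. Call $V$ a null shape matrix if it is a shape matrix with $V=\lambda_1\theta_0\theta_0'+\sum_{j=2}^p\lambda_j\theta_j\theta_j'$, where $\theta_0,\theta_2,\dots,\theta_p$ is an orthonormal basis of $\mathbb R^p$ and $\lambda_1>\lambda_2\ge\dots\ge\lambda_p$. For a sample $U_{n1},\dots,U_{nn}$ in $\mathcal S^{p-1}$ and a symmetric positive definite matrix $V$, put $$S_n(V)=\frac1n\sum_{i=1}^n\frac{V^{-1/2}U_{ni}U_{ni}'V^{-1/2}}{\|V^{-1/2}U_{ni}\|^2},\qquad T_n(V)=np(p+2)\,\big\|(I_p-\theta_0\theta_0')S_n(V)\theta_0\big\|^2 .$$ Let $\hat V_n$ be Tyler's M-estimator, i.e. the shape matrix that satisfies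 $S_n(\hat V_n)=\frac1p I_p$, with spectral decomposition $\hat V_n=\sum_{j=1}^p\hat\lambda_{nj}\hat\theta_{nj}\hat\theta_{nj}'$, $\hat\lambda_{n1}\ge\dots\ge\hat\lambda_{np}$, where the $\hat\theta_{nj}$ form an orthonormal basis. Let $\theta_0,\tilde\theta_{n2},\dots,\tilde\theta_{np}$ be the result of the Gram-Schmidt orthonormalization of $\theta_0,\hat\theta_{n2},\dots,\hat\theta_{np}$, and let $$\tilde V_{0n}=\hat\lambda_{n1}\theta_0\theta_0'+\sum_{j=2}^p\hat\lambda_{nj}\tilde\theta_{nj}\tilde\theta_{nj}' .$$ (Conventions on exceptional samples: where $\hat V_n$ or its spectral decomposition is not unique, any choice may be made; where no $\hat V_n$ exists, arbitrary reals $\hat\lambda_{nj}$ and an arbitrary orthonormal basis $(\hat\theta_{nj})$ are used; a vector that vanishes in the orthonormalization is kept equal to $0$; and, in inverse square roots of singular matrices and in divisions by zero, $x^{-1/2}:=0$ for $x\le 0$ and $1/0:=0$. All versions of $T_n(\tilde V_{0n})$ are allowed.) Theorem. Let $(V_{0n})_n$ be an arbitrary sequence of null shape matrices; in particular the $p-1$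 smallest eigenvalues of $V_{0n}$ are arbitrary and $\lambda_{n1}/\lambda_{n2}$ may tend to one at any rate. For each $n$ let $U_{n1},\dots,U_{nn}$ be independent with the angular Gaussian distribution with shape matrix $V_{0n}$. Then, as $n\to\infty$, $T_n(\tilde V_{0n})$ converges in distribution to the chi-square distribution with $p-1$ degrees of freedom. Consequently, for every $\alpha\in(0,1)$, the test that rejects when $T_n(\tilde V_{0n})>\chi^2_{p-1,1-\alpha}$, the upper $\alpha$-quantile of that distribution, satisfies $P\big[T_n(\tilde V_{0n})>\chi^2_{p-1,1-\alpha}\big]\to\alpha$. -/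

import Mathlib

open MeasureTheory ProbabilityTheory Filter Topology

noncomputable section

namespace SignTest

/-- The unit sphere `S^{p-1}` of `ℝ^p`. -/
abbrev Sph (p : ℕ) : Type := Metric.sphere (0 : EuclideanSpace ℝ (Fin p)) 1

/-- The rank-one matrix `x x'`. -/
def outer {p : ℕ} (x : EuclideanSpace ℝ (Fin p)) : Matrix (Fin p) (Fin p) ℝ :=
  Matrix.vecMulVec x.ofLp x.ofLp

/-- Shape matrices: symmetric positive definite `p × p` matrices with trace `p`. -/
structure IsShape {p : ℕ} (V : Matrix (Fin p) (Fin p) ℝ) : Prop where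
  posDef : V.PosDef
  trace_eq : V.trace = p

/-- `V = ∑ j, l j • b j (b j)'` is a spectral decomposition of `V`, with eigenvalues listed in
non-increasing order (index `0` is the leading one) and an orthonormal basis of eigenvectors. -/
structure IsSpectralDecomposition {p : ℕ} (V : Matrix (Fin p) (Fin p) ℝ) (l : Fin p → ℝ)
    (b : OrthonormalBasis (Fin p) ℝ (EuclideanSpace ℝ (Fin p))) : Prop where
  antitone : Antitone l
  eq_sum : V = ∑ j, l j • outer (b j)

/-- Null shape matrices: shape matrices whose largest eigenvalue is simple, with eigenvector `θ₀`;
the other eigenvalues are arbitrary. -/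
def IsNullShape {p : ℕ} [NeZero p] (θ₀ : EuclideanSpace ℝ (Fin p))
    (V : Matrix (Fin p) (Fin p) ℝ) : Prop :=
  IsShape V ∧
    ∃ (l : Fin p → ℝ) (b : OrthonormalBasis (Fin p) ℝ (EuclideanSpace ℝ (Fin p))),
      IsSpectralDecomposition V l b ∧ b 0 = θ₀ ∧ ∀ j, j ≠ 0 → l j < l 0

/-- The angular Gaussian distribution on the unit sphere with shape matrix `V`, through its
density with respect to the surface area measure. -/
def angularGaussian {p : ℕ} (V : Matrix (Fin p) (Fin p) ℝ) : Measure (Sph p) :=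
  ((volume : Measure (EuclideanSpace ℝ (Fin p))).toSphere).withDensity fun u =>
    ENNReal.ofReal
      (Real.Gamma ((p : ℝ) / 2) / (2 * Real.pi ^ ((p : ℝ) / 2) * V.det ^ ((1 : ℝ) / 2)) *
        (u.1.ofLp ⬝ᵥ (V⁻¹).mulVec u.1.ofLp) ^ (-((p : ℝ) / 2)))

/-- The symmetric inverse square root `V^{-1/2}` of a symmetric positive definite matrix. -/
def invSqrt {p : ℕ} (V : Matrix (Fin p) (Fin p) ℝ) : Matrix (Fin p) (Fin p) ℝ :=
  cfc (fun x : ℝ => (√x)⁻¹) V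

/-- `S_n(V) = n⁻¹ ∑ i, V^{-1/2} u_i u_i' V^{-1/2} / ‖V^{-1/2} u_i‖²`. -/
def signCov {p n : ℕ} (u : Fin n → Sph p) (V : Matrix (Fin p) (Fin p) ℝ) :
    Matrix (Fin p) (Fin p) ℝ :=
  (n : ℝ)⁻¹ • ∑ i, (‖WithLp.toLp 2 ((invSqrt V).mulVec (u i).1.ofLp)‖ ^ 2)⁻¹ •
    (invSqrt V * outer (u i).1 * invSqrt V)

/-- `V` is Tyler's M-estimator of shape for the sample `u`: the shape matrix that satisfies
`S_n(V) = (1/p) I_p`. -/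
def IsTylerEstimator {p n : ℕ} (u : Fin n → Sph p) (V : Matrix (Fin p) (Fin p) ℝ) : Prop :=
  IsShape V ∧ signCov u V = (1 / (p : ℝ)) • (1 : Matrix (Fin p) (Fin p) ℝ)

/-- The Gram-Schmidt orthonormalization of `θ₀, b 1, …, b (p - 1)`, in this order. -/
def nullEigenvectors {p : ℕ} [NeZero p] (θ₀ : EuclideanSpace ℝ (Fin p))
    (b : OrthonormalBasis (Fin p) ℝ (EuclideanSpace ℝ (Fin p))) :
    Fin p → EuclideanSpace ℝ (Fin p) :=
  InnerProductSpace.gramSchmidtNormed ℝ (Function.update (fun j => b j) 0 θ₀)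

/-- The estimator of the null shape matrix: the eigenvalues `l` are kept, and the eigenvectors `b`
are replaced by `θ₀` and the orthonormalized vectors. -/
def nullShapeEstimator {p : ℕ} [NeZero p] (θ₀ : EuclideanSpace ℝ (Fin p)) (l : Fin p → ℝ)
    (b : OrthonormalBasis (Fin p) ℝ (EuclideanSpace ℝ (Fin p))) : Matrix (Fin p) (Fin p) ℝ :=
  ∑ j, l j • outer (nullEigenvectors θ₀ b j)

/-- `T_n(V) = n p (p + 2) ‖(I_p - θ₀ θ₀') S_n(V) θ₀‖²`. -/
def signStatistic {p n : ℕ} (θ₀ : EuclideanSpace ℝ (Fin p)) (u : Fin n → Sph p)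
    (V : Matrix (Fin p) (Fin p) ℝ) : ℝ :=
  n * p * (p + 2) * ‖WithLp.toLp 2 (((1 - outer θ₀) * signCov u V).mulVec θ₀.ofLp)‖ ^ 2

/-- The chi-square distribution with `k` degrees of freedom: the law of the sum of the squares of
`k` independent standard normal variables. -/
def chiSquare (k : ℕ) : Measure ℝ :=
  (Measure.pi fun _ : Fin k => gaussianReal 0 1).map fun z => ∑ i, z i ^ 2

instance isProbabilityMeasure_chiSquare (k : ℕ) : IsProbabilityMeasure (chiSquare k) :=
  Measure.isProbabilityMeasure_map
    (Finset.measurable_sum _ fun i _ => (measurable_pi_apply i).pow_const 2).aemeasurable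

/-- The upper `α`-quantile of the chi-square distribution with `k` degrees of freedom. -/
def chiSquareUpperQuantile (k : ℕ) (α : ℝ) : ℝ :=
  sInf {x : ℝ | 1 - α ≤ cdf (chiSquare k) x}

end SignTest

end

open SignTest

open MeasureTheory ProbabilityTheory Filter Topology
open scoped RealInnerProductSpace
noncomputable section

namespace SignTest
set_option linter.unusedSectionVars false

/-! Whitening removes the unknown shape. Write `V₀ = specMat l b` with `b 0 = θ₀` and let `G =
sqrtMap l b`, the non-symmetric square root that sends the first coordinate axis to the direction of
`θ₀`. Then `U_i` is a positive multiple of `G w_i` with `w_i` uniform on the sphere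
(`map_angularGaussian`), and Tyler's equation is affine equivariant, so `V̂ = G N G'` where `N`
solves Tyler's equation for the `w_i`. The whole difficulty is that `l` is arbitrary and varies with
`n`: every bound has to be relative, that is, between the quadratic forms of `V̂` and `V₀`, with
constants that depend on `p` only.

Off an event of small probability the empirical fourth moments of `w` are within `ε = C/√n` of their
limits. A deterministic argument then shows that `N` exists (`exists_tylerEq`), lies up to scale
between `(1 - Kε) I` and `I`, and equals a multiple of the explicit linear statistic `linTyler` up
to `O(ε²)` (`tyler_approx`).

Gram-Schmidt could destroy this closeness when the leading eigenvalues are nearly equal. It does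
not: `nullEigenvectors_perturbation` bounds the relative error of the corrected matrix by a constant
times `√ε / δ²`, where `δ` is a lower bound for the overlap of the leading empirical eigenvector
with `θ₀`. Eigenvectors with a large overlap must have eigenvalues close to the leading one, and for
those a rotation costs little. So the error is of order `η = n^(-1/4)` as soon as `δ` stays away
from zero.

That rate suffices because the corrected matrix has `θ₀` as an exact eigenvector. In whitened
coordinates its perturbation is block diagonal, so the first two Taylor terms of the sign vector are
sums of monomials that are odd in the first coordinate. These are centred, hence of order `√n`, and
contribute `O(η)`; only the third-order remainder is bounded crudely, by `√n η³ = O(n^(-1/4))`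
(`signStatistic_approx`).

There remains the overlap. If the other eigenvalues of `V₀` are at most half the leading one, it is
immediate (`le_abs_inner_of_gap`). Otherwise a leading eigenvector nearly orthogonal to `θ₀` would
force the cross term of `linTyler`, between `θ₀` and the maximiser on the orthogonal complement, to
be much smaller than `n^(-1/2)`. That maximiser does not change when the signs of the first
coordinates of the `w_i` are flipped, so given everything else the cross term is a Rademacher sum,
and a small ball estimate makes this unlikely (`not_small_angle`, `measure_smallCross_le`).

Hence `T_n` is close in probability to `scoreStat`, the squared norm of a normalized sum of i.i.d.
vectors in dimension `p - 1` with identity covariance, to which the central limit theorem applies.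
The comparison goes through distribution functions, so `T_n` need not be measurable. -/

/-- The quadratic form `x' M x`. -/
def qf {p : ℕ} (M : Matrix (Fin p) (Fin p) ℝ) (x : EuclideanSpace ℝ (Fin p)) : ℝ :=
  x.ofLp ⬝ᵥ M.mulVec x.ofLp

/-- The matrix `∑ j, l j • b j (b j)'`. -/
def specMat {p : ℕ} (l : Fin p → ℝ) (b : OrthonormalBasis (Fin p) ℝ (EuclideanSpace ℝ (Fin p))) :
    Matrix (Fin p) (Fin p) ℝ :=
  ∑ j, l j • outer (b j)

/-! ### Quadratic forms and functional calculus of matrices with a given spectral decomposition. -/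

section
variable {p : ℕ}

lemma inner_eq_dotProduct (x y : EuclideanSpace ℝ (Fin p)) : ⟪x, y⟫ = x.ofLp ⬝ᵥ y.ofLp := by
  simp [PiLp.inner_apply, dotProduct, mul_comm]

lemma outer_mulVec (x : EuclideanSpace ℝ (Fin p)) (y : Fin p → ℝ) :
    (outer x).mulVec y = (x.ofLp ⬝ᵥ y) • x.ofLp := by
  ext i
  simp [outer, Matrix.vecMulVec_mulVec, mul_comm]

lemma outer_mul_outer (x y : EuclideanSpace ℝ (Fin p)) :
    outer x * outer y = ⟪x, y⟫ • Matrix.vecMulVec x.ofLp y.ofLp := by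
  rw [inner_eq_dotProduct, outer, outer, Matrix.vecMulVec_mul_vecMulVec]
  ext i j
  simp [Matrix.vecMulVec]; ring

lemma specMat_mul (l m : Fin p → ℝ) (b : OrthonormalBasis (Fin p) ℝ (EuclideanSpace ℝ (Fin p))) :
    specMat l b * specMat m b = specMat (fun j => l j * m j) b := by
  unfold specMat
  rw [Finset.sum_mul]
  refine Finset.sum_congr rfl fun i _ => ?_
  rw [Finset.mul_sum, Finset.sum_eq_single i]
  · rw [smul_mul_smul_comm, outer_mul_outer, b.inner_eq_ite]
    simp [outer]
  · intro j _ hj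
    rw [smul_mul_smul_comm, outer_mul_outer, b.inner_eq_ite, if_neg (Ne.symm hj)]
    simp
  · simp

lemma qf_outer (x y : EuclideanSpace ℝ (Fin p)) : qf (outer x) y = ⟪x, y⟫ ^ 2 := by
  rw [qf, outer_mulVec, inner_eq_dotProduct, dotProduct_smul, dotProduct_comm y.ofLp x.ofLp]
  simp [sq]

lemma qf_add (M N : Matrix (Fin p) (Fin p) ℝ) (x : EuclideanSpace ℝ (Fin p)) :
    qf (M + N) x = qf M x + qf N x := by
  simp [qf, Matrix.add_mulVec, dotProduct_add]

lemma qf_smul (c : ℝ) (M : Matrix (Fin p) (Fin p) ℝ) (x : EuclideanSpace ℝ (Fin p)) :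
    qf (c • M) x = c * qf M x := by
  simp [qf, Matrix.smul_mulVec, dotProduct_smul]

lemma qf_sum {ι : Type*} (s : Finset ι) (M : ι → Matrix (Fin p) (Fin p) ℝ)
    (x : EuclideanSpace ℝ (Fin p)) : qf (∑ i ∈ s, M i) x = ∑ i ∈ s, qf (M i) x := by
  classical
  induction s using Finset.induction_on with
  | empty => simp [qf]
  | insert a s ha ih => rw [Finset.sum_insert ha, Finset.sum_insert ha, qf_add, ih]

lemma qf_one (x : EuclideanSpace ℝ (Fin p)) : qf 1 x = ‖x‖ ^ 2 := by
  rw [qf, Matrix.one_mulVec, ← inner_eq_dotProduct, real_inner_self_eq_norm_sq]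

lemma qf_specMat (l : Fin p → ℝ) (b : OrthonormalBasis (Fin p) ℝ (EuclideanSpace ℝ (Fin p)))
    (x : EuclideanSpace ℝ (Fin p)) : qf (specMat l b) x = ∑ j, l j * ⟪b j, x⟫ ^ 2 := by
  simp [specMat, qf_sum, qf_smul, qf_outer]

lemma isSymm_outer (x : EuclideanSpace ℝ (Fin p)) : (outer x).IsSymm := by
  ext i j; simp [outer, Matrix.vecMulVec, mul_comm]

lemma isSymm_specMat (l : Fin p → ℝ)
    (b : OrthonormalBasis (Fin p) ℝ (EuclideanSpace ℝ (Fin p))) : (specMat l b).IsSymm := by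
  unfold specMat Matrix.IsSymm
  rw [Matrix.transpose_sum]
  exact Finset.sum_congr rfl fun i _ => by rw [Matrix.transpose_smul, isSymm_outer]

/-- A symmetric matrix is determined by its quadratic form. -/
lemma eq_of_qf_eq {M N : Matrix (Fin p) (Fin p) ℝ} (hM : M.IsSymm) (hN : N.IsSymm)
    (h : ∀ x, qf M x = qf N x) : M = N := by
  have key : ∀ (A : Matrix (Fin p) (Fin p) ℝ) (i j : Fin p), A.IsSymm → 2 * A i j =
      qf A (EuclideanSpace.single i 1 + EuclideanSpace.single j 1)
      - qf A (EuclideanSpace.single i 1) - qf A (EuclideanSpace.single j 1) := by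
    intro A i j hA
    have := hA.apply i j
    simp [qf, Matrix.mulVec_add, add_dotProduct, dotProduct_add]
    rw [this]; ring
  ext i j
  have h1 := key M i j hM
  have h2 := key N i j hN
  simp only [h] at h1
  linarith

lemma specMat_one (b : OrthonormalBasis (Fin p) ℝ (EuclideanSpace ℝ (Fin p))) :
    specMat (fun _ => 1) b = 1 := by
  refine eq_of_qf_eq (isSymm_specMat _ _) Matrix.isSymm_one fun x => ?_
  rw [qf_specMat, qf_one, ← b.sum_sq_norm_inner_right x]
  simp

lemma specMat_inv {l : Fin p → ℝ} (hl : ∀ j, l j ≠ 0)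
    (b : OrthonormalBasis (Fin p) ℝ (EuclideanSpace ℝ (Fin p))) :
    (specMat l b)⁻¹ = specMat (fun j => (l j)⁻¹) b := by
  refine Matrix.inv_eq_right_inv ?_
  rw [specMat_mul, ← specMat_one b]
  congr 1; ext j; exact mul_inv_cancel₀ (hl j)

lemma specMat_mulVec (l : Fin p → ℝ) (b : OrthonormalBasis (Fin p) ℝ (EuclideanSpace ℝ (Fin p)))
    (x : EuclideanSpace ℝ (Fin p)) :
    (specMat l b).mulVec x.ofLp = (∑ j, (l j * ⟪b j, x⟫) • b j).ofLp := by
  rw [specMat, Matrix.sum_mulVec, WithLp.ofLp_sum]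
  refine Finset.sum_congr rfl fun j _ => ?_
  rw [Matrix.smul_mulVec, outer_mulVec, inner_eq_dotProduct, smul_smul]; simp

lemma specMat_mulVec_self (l : Fin p → ℝ)
    (b : OrthonormalBasis (Fin p) ℝ (EuclideanSpace ℝ (Fin p))) (k : Fin p) :
    (specMat l b).mulVec (b k).ofLp = l k • (b k).ofLp := by
  rw [specMat_mulVec, Finset.sum_eq_single k] 
  · simp
  · intro j _ hj; simp [b.inner_eq_ite, hj]
  · simp

lemma posDef_iff_qf {M : Matrix (Fin p) (Fin p) ℝ} :
    M.PosDef ↔ M.IsSymm ∧ ∀ x, x ≠ 0 → 0 < qf M x := by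
  rw [Matrix.posDef_iff_dotProduct_mulVec]
  refine and_congr ?_ ⟨fun h x hx => ?_, fun h x hx => ?_⟩
  · rw [Matrix.IsHermitian, Matrix.conjTranspose_eq_transpose_of_trivial, Matrix.IsSymm]
  · simpa [qf] using h (x := x.ofLp) (by simpa using hx)
  · simpa [qf] using h (WithLp.toLp 2 x) (by simpa using hx)

lemma specMat_posDef {l : Fin p → ℝ} (hl : ∀ j, 0 < l j)
    (b : OrthonormalBasis (Fin p) ℝ (EuclideanSpace ℝ (Fin p))) : (specMat l b).PosDef := by
  rw [posDef_iff_qf]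
  refine ⟨isSymm_specMat _ _, fun x hx => ?_⟩
  rw [qf_specMat]
  have h1 : ∃ j, ⟪b j, x⟫ ≠ 0 := by
    by_contra! h
    apply hx
    rw [← b.sum_repr' x]
    simp [h]
  obtain ⟨j, hj⟩ := h1
  exact Finset.sum_pos' (fun i _ => mul_nonneg (hl i).le (sq_nonneg _))
    ⟨j, Finset.mem_univ _, mul_pos (hl j) (by positivity)⟩

lemma qf_basis (l : Fin p → ℝ)
    (b : OrthonormalBasis (Fin p) ℝ (EuclideanSpace ℝ (Fin p))) (k : Fin p) :
    qf (specMat l b) (b k) = l k := by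
  rw [qf_specMat, Finset.sum_eq_single k]
  · simp
  · intro j _ hj; simp [b.inner_eq_ite, hj]
  · simp

lemma pos_of_specMat_posDef {l : Fin p → ℝ}
    {b : OrthonormalBasis (Fin p) ℝ (EuclideanSpace ℝ (Fin p))} (h : (specMat l b).PosDef)
    (j : Fin p) : 0 < l j := by
  have := (posDef_iff_qf.1 h).2 (b j) (by
    intro h0; have := b.norm_eq_one j; rw [h0] at this; simp at this)
  rwa [qf_basis] at this

/-- Spectral theorem, in the form used here. -/
lemma exists_eq_specMat {M : Matrix (Fin p) (Fin p) ℝ} (hM : M.IsSymm) :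
    ∃ (l : Fin p → ℝ) (b : OrthonormalBasis (Fin p) ℝ (EuclideanSpace ℝ (Fin p))),
      M = specMat l b := by
  have hH : M.IsHermitian := by
    rw [Matrix.IsHermitian, Matrix.conjTranspose_eq_transpose_of_trivial]; exact hM
  refine ⟨hH.eigenvalues, hH.eigenvectorBasis, ?_⟩
  have h2 : ∀ x : EuclideanSpace ℝ (Fin p), M.mulVec x.ofLp =
      (specMat hH.eigenvalues hH.eigenvectorBasis).mulVec x.ofLp := by
    intro x
    conv_lhs => rw [← hH.eigenvectorBasis.sum_repr' x]
    conv_rhs => rw [specMat_mulVec]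
    rw [WithLp.ofLp_sum, WithLp.ofLp_sum, Matrix.mulVec_sum]
    refine Finset.sum_congr rfl fun j _ => ?_
    rw [WithLp.ofLp_smul, Matrix.mulVec_smul, hH.mulVec_eigenvectorBasis, WithLp.ofLp_smul,
      smul_smul, mul_comm]
  refine Matrix.ext_of_mulVec_single fun i => ?_
  exact h2 (EuclideanSpace.single i 1)

lemma exists_eq_specMat_of_posDef {M : Matrix (Fin p) (Fin p) ℝ} (hM : M.PosDef) :
    ∃ (l : Fin p → ℝ) (b : OrthonormalBasis (Fin p) ℝ (EuclideanSpace ℝ (Fin p))),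
      (∀ j, 0 < l j) ∧ M = specMat l b := by
  obtain ⟨l, b, h⟩ := exists_eq_specMat (posDef_iff_qf.1 hM).1
  exact ⟨l, b, pos_of_specMat_posDef (h ▸ hM), h⟩

lemma specMat_aeval (q : Polynomial ℝ) (l : Fin p → ℝ)
    (b : OrthonormalBasis (Fin p) ℝ (EuclideanSpace ℝ (Fin p))) :
    Polynomial.aeval (specMat l b) q = specMat (fun j => q.eval (l j)) b := by
  induction q using Polynomial.induction_on' with
  | add f g hf hg =>
    rw [map_add, hf, hg]
    simp [specMat, add_smul, Finset.sum_add_distrib]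
  | monomial n a =>
    have hpow : ∀ n : ℕ, specMat l b ^ n = specMat (fun j => l j ^ n) b := by
      intro n
      induction n with
      | zero => simp [specMat_one]
      | succ n ih => rw [pow_succ, ih, specMat_mul]; simp [pow_succ]
    rw [Polynomial.aeval_monomial, hpow, Algebra.algebraMap_eq_smul_one, smul_mul_assoc, one_mul]
    simp [specMat, Finset.smul_sum, smul_smul]

/-- The spectrum is contained in the finite set of the `l j`, since the polynomial with these roots
annihilates the matrix. There `f` agrees with its Lagrange interpolant, and for polynomials the
claim is `specMat_aeval`. -/
lemma cfc_specMat (f : ℝ → ℝ) (l : Fin p → ℝ)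
    (b : OrthonormalBasis (Fin p) ℝ (EuclideanSpace ℝ (Fin p))) :
    cfc f (specMat l b) = specMat (fun j => f (l j)) b := by
  have hsa : IsSelfAdjoint (specMat l b) := by
    rw [IsSelfAdjoint, Matrix.star_eq_conjTranspose,
      Matrix.conjTranspose_eq_transpose_of_trivial]; exact isSymm_specMat l b
  classical
  set s : Finset ℝ := Finset.univ.image l
  set q : Polynomial ℝ := Lagrange.interpolate s id f
  have hq : ∀ j, q.eval (l j) = f (l j) := fun j =>
    Lagrange.eval_interpolate_at_node f Function.injective_id.injOn
      (Finset.mem_image_of_mem l (Finset.mem_univ j))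
  have hspec : spectrum ℝ (specMat l b) ⊆ s := by
    set r : Polynomial ℝ := ∏ x ∈ s, (Polynomial.X - Polynomial.C x)
    have hr : Polynomial.aeval (specMat l b) r = 0 := by
      rw [specMat_aeval]
      have : ∀ j, r.eval (l j) = 0 := fun j => by
        rw [Polynomial.eval_prod]
        exact Finset.prod_eq_zero (Finset.mem_image_of_mem l (Finset.mem_univ j)) (by simp)
      simp [this, specMat]
    intro x hx
    have h1 := spectrum.subset_polynomial_aeval (specMat l b) r ⟨x, hx, rfl⟩
    rw [hr] at h1
    have h2 : Polynomial.eval x r = 0 := by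
      by_contra h0
      rw [spectrum.mem_iff, sub_zero] at h1
      exact h1 ((IsUnit.mk0 _ h0).map (algebraMap ℝ _))
    rw [Polynomial.eval_prod, Finset.prod_eq_zero_iff] at h2
    obtain ⟨y, hy, hxy⟩ := h2
    have : x = y := by simpa [sub_eq_zero] using hxy
    exact this ▸ hy
  have h3 : cfc f (specMat l b) = cfc (fun x => q.eval x) (specMat l b) := by
    refine cfc_congr fun x hx => ?_
    have := hspec hx
    simp only [s, Finset.coe_image, Finset.coe_univ, Set.image_univ, Set.mem_range] at this
    obtain ⟨j, rfl⟩ := this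
    exact (hq j).symm
  rw [h3, cfc_polynomial q _ hsa, specMat_aeval]
  simp [hq]

lemma invSqrt_specMat (l : Fin p → ℝ)
    (b : OrthonormalBasis (Fin p) ℝ (EuclideanSpace ℝ (Fin p))) :
    invSqrt (specMat l b) = specMat (fun j => (√(l j))⁻¹) b :=
  cfc_specMat _ l b

end

/-! ### Whitening: angular Gaussian directions and the uniform distribution on the sphere. -/

section
variable {p : ℕ}

/-- The linear map `z ↦ ∑ k, √(l k) z_k • b k`, a square root of `specMat l b`. -/
def sqrtMap (l : Fin p → ℝ) (b : OrthonormalBasis (Fin p) ℝ (EuclideanSpace ℝ (Fin p))) :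
    EuclideanSpace ℝ (Fin p) →ₗ[ℝ] EuclideanSpace ℝ (Fin p) where
  toFun z := ∑ k, (√(l k) * z k) • b k
  map_add' x y := by simp [mul_add, add_smul, Finset.sum_add_distrib]
  map_smul' c x := by simp [Finset.smul_sum, smul_smul, mul_left_comm]

/-- The inverse of `sqrtMap l b`. -/
def sqrtMapInv (l : Fin p → ℝ) (b : OrthonormalBasis (Fin p) ℝ (EuclideanSpace ℝ (Fin p))) :
    EuclideanSpace ℝ (Fin p) →ₗ[ℝ] EuclideanSpace ℝ (Fin p) where
  toFun x := WithLp.toLp 2 fun k => ⟪b k, x⟫ / √(l k)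
  map_add' x y := by ext k; simp [inner_add_right, add_div]
  map_smul' c x := by ext k; simp [inner_smul_right, mul_div_assoc]

lemma inner_basis_sqrtMap (l : Fin p → ℝ)
    (b : OrthonormalBasis (Fin p) ℝ (EuclideanSpace ℝ (Fin p))) (z : EuclideanSpace ℝ (Fin p))
    (k : Fin p) : ⟪b k, sqrtMap l b z⟫ = √(l k) * z k := by
  simp only [sqrtMap, LinearMap.coe_mk, AddHom.coe_mk, inner_sum, inner_smul_right,
    b.inner_eq_ite]
  simp

lemma sqrtMapInv_sqrtMap {l : Fin p → ℝ} (hl : ∀ k, 0 < l k)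
    (b : OrthonormalBasis (Fin p) ℝ (EuclideanSpace ℝ (Fin p))) (z : EuclideanSpace ℝ (Fin p)) :
    sqrtMapInv l b (sqrtMap l b z) = z := by
  ext k
  have h := (Real.sqrt_pos.2 (hl k)).ne'
  change ⟪b k, sqrtMap l b z⟫ / √(l k) = z k
  rw [inner_basis_sqrtMap]; field_simp

lemma sqrtMap_sqrtMapInv {l : Fin p → ℝ} (hl : ∀ k, 0 < l k)
    (b : OrthonormalBasis (Fin p) ℝ (EuclideanSpace ℝ (Fin p))) (x : EuclideanSpace ℝ (Fin p)) :
    sqrtMap l b (sqrtMapInv l b x) = x := by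
  conv_rhs => rw [← b.sum_repr' x]
  change ∑ k : Fin p, (√(l k) * (sqrtMapInv l b x) k) • b k = _
  refine Finset.sum_congr rfl fun k _ => ?_
  have h := (Real.sqrt_pos.2 (hl k)).ne'
  change (√(l k) * (⟪b k, x⟫ / √(l k))) • b k = _
  congr 1; field_simp

lemma det_sqrtMap_ne_zero {l : Fin p → ℝ} (hl : ∀ k, 0 < l k)
    (b : OrthonormalBasis (Fin p) ℝ (EuclideanSpace ℝ (Fin p))) :
    LinearMap.det (sqrtMap l b) ≠ 0 := by
  have h : sqrtMapInv l b ∘ₗ sqrtMap l b = LinearMap.id :=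
    LinearMap.ext fun z => sqrtMapInv_sqrtMap hl b z
  have h2 := congrArg LinearMap.det h
  rw [LinearMap.det_comp, LinearMap.det_id] at h2
  exact right_ne_zero_of_mul (h2 ▸ one_ne_zero)

lemma qf_inv_sqrtMap {l : Fin p → ℝ} (hl : ∀ k, 0 < l k)
    (b : OrthonormalBasis (Fin p) ℝ (EuclideanSpace ℝ (Fin p))) (z : EuclideanSpace ℝ (Fin p)) :
    qf (specMat l b)⁻¹ (sqrtMap l b z) = ‖z‖ ^ 2 := by
  rw [specMat_inv (fun j => (hl j).ne'), qf_specMat, EuclideanSpace.norm_sq_eq]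
  refine Finset.sum_congr rfl fun k _ => ?_
  rw [inner_basis_sqrtMap, mul_pow, Real.sq_sqrt (hl k).le, Real.norm_eq_abs, sq_abs]
  have := (hl k).ne'
  field_simp

variable [NeZero p]

/-- Normalization to the unit sphere (the origin is sent to the first basis vector). -/
def nrm (x : EuclideanSpace ℝ (Fin p)) : Sph p :=
  ⟨if x = 0 then EuclideanSpace.single 0 1 else ‖x‖⁻¹ • x, by
    split_ifs with h
    · simp
    · simp [norm_smul, h]⟩

lemma nrm_coe {x : EuclideanSpace ℝ (Fin p)} (hx : x ≠ 0) :
    (nrm x : EuclideanSpace ℝ (Fin p)) = ‖x‖⁻¹ • x := by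
  simp [nrm, hx]

lemma measurable_nrm : Measurable (nrm : EuclideanSpace ℝ (Fin p) → Sph p) := by
  refine Measurable.subtype_mk (Measurable.ite (measurableSet_singleton 0) measurable_const ?_)
  fun_prop

lemma nrm_smul {c : ℝ} (hc : 0 < c) {x : EuclideanSpace ℝ (Fin p)} (hx : x ≠ 0) :
    nrm (c • x) = nrm x := by
  ext1
  rw [nrm_coe hx, nrm_coe (smul_ne_zero hc.ne' hx), norm_smul, smul_smul, Real.norm_eq_abs,
    abs_of_pos hc]
  congr 1
  field_simp

lemma sqrtMap_ne_zero {l : Fin p → ℝ} (hl : ∀ k, 0 < l k)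
    (b : OrthonormalBasis (Fin p) ℝ (EuclideanSpace ℝ (Fin p))) {z : EuclideanSpace ℝ (Fin p)}
    (hz : z ≠ 0) : sqrtMap l b z ≠ 0 := fun h => hz (by
  rw [← sqrtMapInv_sqrtMap hl b z, h, map_zero])

/-- The punctured unit ball. -/
def pball (p : ℕ) : Set (EuclideanSpace ℝ (Fin p)) := Metric.ball 0 1 \ {0}

lemma measurableSet_pball : MeasurableSet (pball p) :=
  measurableSet_ball.diff (measurableSet_singleton 0)

/-- The uniform distribution on the unit sphere. -/
def unif (p : ℕ) [NeZero p] : Measure (Sph p) :=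
  (volume (pball p))⁻¹ • (volume.restrict (pball p)).map nrm

lemma volume_pball_ne_zero : volume (pball p) ≠ 0 := by
  rw [pball, measure_sdiff_null (measure_singleton _)]
  exact (Metric.measure_ball_pos _ _ one_pos).ne'

lemma volume_pball_ne_top : volume (pball p) ≠ ⊤ :=
  ((measure_mono Set.sdiff_subset).trans_lt measure_ball_lt_top).ne

instance : IsProbabilityMeasure (unif p) := by
  constructor
  rw [unif, Measure.smul_apply, Measure.map_apply measurable_nrm MeasurableSet.univ]
  simp only [Set.preimage_univ, Measure.restrict_apply MeasurableSet.univ, Set.univ_inter,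
    smul_eq_mul]
  exact ENNReal.inv_mul_cancel volume_pball_ne_zero volume_pball_ne_top

/-- Polar coordinates: volume of a truncated cone. -/
lemma volume_cone {V : Matrix (Fin p) (Fin p) ℝ} (hV : V.PosDef) {s : Set (Sph p)}
    (hs : MeasurableSet s) :
    volume {x : EuclideanSpace ℝ (Fin p) | x ≠ 0 ∧ qf V x < 1 ∧ nrm x ∈ s} =
      ∫⁻ u in s, ENNReal.ofReal ((qf V u) ^ (-((p : ℝ) / 2)) / p)
        ∂(volume : Measure (EuclideanSpace ℝ (Fin p))).toSphere := by
  set C := {x : EuclideanSpace ℝ (Fin p) | x ≠ 0 ∧ qf V x < 1 ∧ nrm x ∈ s}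
  set A : Set (Sph p × Set.Ioi (0 : ℝ)) := {a | a.2.1 ^ 2 * qf V a.1 < 1 ∧ a.1 ∈ s}
  have hcont : Continuous (qf V) := by
    unfold qf; fun_prop
  have hA : MeasurableSet A := by
    refine MeasurableSet.inter ?_ (measurable_fst hs)
    have hc : Continuous fun a : Sph p × Set.Ioi (0 : ℝ) => a.2.1 ^ 2 * qf V a.1 :=
      ((continuous_subtype_val.comp continuous_snd).pow 2).mul
        (hcont.comp (continuous_subtype_val.comp continuous_fst))
    exact measurableSet_lt hc.measurable measurable_const
  have hmp := Measure.measurePreserving_homeomorphUnitSphereProd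
    (volume : Measure (EuclideanSpace ℝ (Fin p)))
  have h1 : volume C = ((volume : Measure (EuclideanSpace ℝ (Fin p))).comap
      (Subtype.val : ({0}ᶜ : Set (EuclideanSpace ℝ (Fin p))) → EuclideanSpace ℝ (Fin p)))
      (Subtype.val ⁻¹' C) := by
    rw [comap_subtype_coe_apply (measurableSet_singleton _).compl, Subtype.image_preimage_coe]
    congr 1
    ext x; simp only [C, Set.mem_inter_iff, Set.mem_compl_iff, Set.mem_singleton_iff,
      Set.mem_ofPred_eq]; tauto
  have h2 : ((↑) ⁻¹' C : Set ({0}ᶜ : Set (EuclideanSpace ℝ (Fin p)))) =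
      (homeomorphUnitSphereProd _) ⁻¹' A := by
    ext ⟨x, hx⟩
    have hx0 : x ≠ 0 := hx
    have hn : ‖x‖ ≠ 0 := norm_ne_zero_iff.2 hx0
    have h3 : (homeomorphUnitSphereProd _ ⟨x, hx⟩).1 = nrm x := by
      ext1; rw [nrm_coe hx0]; simp
    have h4 : qf V (nrm x) = ‖x‖⁻¹ ^ 2 * qf V x := by
      rw [nrm_coe hx0]; simp [qf, Matrix.mulVec_smul]; ring
    have h5 : ‖x‖ ^ 2 * qf V (nrm x) = qf V x := by rw [h4]; field_simp
    simp only [Set.mem_preimage, C, A, Set.mem_ofPred_eq, h3, homeomorphUnitSphereProd_apply_snd_coe,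
      h5, hx0, ne_eq, not_false_eq_true, true_and]
  rw [h1, h2, hmp.measure_preimage hA.nullMeasurableSet, Measure.prod_apply hA,
    ← lintegral_indicator hs]
  refine lintegral_congr fun u => ?_
  by_cases hu : u ∈ s
  · rw [Set.indicator_of_mem hu]
    have hu0 : (u : EuclideanSpace ℝ (Fin p)) ≠ 0 := by
      intro h0; have h : ‖(u : EuclideanSpace ℝ (Fin p))‖ = 1 := norm_eq_of_mem_sphere u
      simp [h0] at h
    have hq : 0 < qf V u := (posDef_iff_qf.1 hV).2 _ hu0
    have hq2 : (√(qf V u))⁻¹ ∈ Set.Ioi (0 : ℝ) := Set.mem_Ioi.2 (by positivity)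
    -- On the ray through `u` the cone is cut at radius `(qf V u)^(-1/2)`. The measure `r^(p-1) dr`
    -- of that interval is `(qf V u)^(-p/2) / p`, which has the shape of the angular Gaussian
    -- density.
    have hset : (Prod.mk u ⁻¹' A) = Set.Iio (⟨(√(qf V u))⁻¹, hq2⟩ : Set.Ioi (0 : ℝ)) := by
      ext ⟨r, hr⟩
      have hr' : 0 < r := hr
      simp only [A, Set.mem_preimage, Set.mem_ofPred_eq, hu, and_true, Set.mem_Iio]
      rw [Subtype.mk_lt_mk, lt_inv_comm₀ hr' (Real.sqrt_pos.2 hq), Real.sqrt_lt' (by positivity), inv_pow,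
        lt_inv_comm₀ hq (by positivity), ← one_div, lt_div_iff₀ hq]
    rw [hset, Measure.volumeIoiPow_apply_Iio]
    congr 1
    have hp : (0 : ℕ) < p := Nat.pos_of_ne_zero (NeZero.ne p)
    have hf : Module.finrank ℝ (EuclideanSpace ℝ (Fin p)) - 1 + 1 = p := by
      simp; omega
    rw [hf]
    have hf' : ((Module.finrank ℝ (EuclideanSpace ℝ (Fin p)) - 1 : ℕ) : ℝ) + 1 = p := by
      exact_mod_cast hf
    rw [hf']
    congr 1
    change (√(qf V u))⁻¹ ^ p = _
    rw [Real.sqrt_eq_rpow, ← Real.rpow_neg hq.le, ← Real.rpow_natCast, ← Real.rpow_mul hq.le]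
    congr 1; ring
  · rw [Set.indicator_of_notMem hu]
    have : (Prod.mk u ⁻¹' A) = ∅ := by
      ext r; simp [A, hu]
    rw [this, measure_empty]

/-- Whitening: a normalized angular Gaussian direction is uniform on the sphere. -/
lemma map_angularGaussian {l : Fin p → ℝ} (hl : ∀ k, 0 < l k)
    (b : OrthonormalBasis (Fin p) ℝ (EuclideanSpace ℝ (Fin p)))
    [IsProbabilityMeasure (angularGaussian (specMat l b))] :
    (angularGaussian (specMat l b)).map (fun u : Sph p => nrm (sqrtMapInv l b u)) = unif p := by
  set V := specMat l b
  have hV : V.PosDef := specMat_posDef hl b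
  have hmeas : Measurable fun u : Sph p => nrm (sqrtMapInv l b u) :=
    measurable_nrm.comp
      ((LinearMap.continuous_of_finiteDimensional _).measurable.comp measurable_subtype_coe)
  have hVi : (V⁻¹).PosDef := hV.inv
  have hp0 : (p : ℝ) ≠ 0 := Nat.cast_ne_zero.2 (NeZero.ne p)
  obtain ⟨c, hc⟩ : ∃ c : ENNReal, ∀ s : Set (Sph p), MeasurableSet s →
      (angularGaussian V).map (fun u : Sph p => nrm (sqrtMapInv l b u)) s =
        c * volume {z : EuclideanSpace ℝ (Fin p) | z ∈ pball p ∧ nrm z ∈ s} := by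
    set K := Real.Gamma ((p : ℝ) / 2) / (2 * Real.pi ^ ((p : ℝ) / 2) * V.det ^ ((1 : ℝ) / 2))
    have hK : 0 ≤ K := by
      have h1 : 0 < Real.Gamma ((p : ℝ) / 2) := Real.Gamma_pos_of_pos (by positivity)
      have h2 := hV.det_pos
      positivity
    refine ⟨ENNReal.ofReal (K * p) * ENNReal.ofReal |LinearMap.det (sqrtMap l b)|, fun s hs => ?_⟩
    rw [Measure.map_apply hmeas hs, angularGaussian, withDensity_apply _ (hmeas hs)]
    have h1 : ∀ u : Sph p, ENNReal.ofReal (K * (u.1.ofLp ⬝ᵥ (V⁻¹).mulVec u.1.ofLp) ^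
        (-((p : ℝ) / 2))) = ENNReal.ofReal (K * p) *
          ENNReal.ofReal ((qf V⁻¹ u) ^ (-((p : ℝ) / 2)) / p) := by
      intro u
      rw [← ENNReal.ofReal_mul (by positivity)]
      congr 1
      rw [qf]; field_simp
    refine (lintegral_congr h1).trans ?_
    rw [lintegral_const_mul' _ _ ENNReal.ofReal_ne_top, ← volume_cone hVi (hmeas hs), mul_assoc]
    congr 1
    set C := {x : EuclideanSpace ℝ (Fin p) |
      x ≠ 0 ∧ qf V⁻¹ x < 1 ∧ nrm x ∈ (fun u : Sph p => nrm (sqrtMapInv l b u)) ⁻¹' s}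
    -- The linear substitution `x = sqrtMap l b z` turns the truncated cone into a sector of the
    -- ball, because `qf V⁻¹ x = ‖z‖²` and normalization ignores positive factors.
    have hpre : {z : EuclideanSpace ℝ (Fin p) | z ∈ pball p ∧ nrm z ∈ s} = sqrtMap l b ⁻¹' C := by
      ext z
      by_cases hz : z = 0
      · simp [hz, C, pball]
      · have hG := sqrtMap_ne_zero hl b hz
        have hn : 0 < ‖sqrtMap l b z‖⁻¹ := by positivity
        simp only [Set.mem_ofPred_eq, C, Set.mem_preimage, hG, ne_eq, not_false_eq_true, true_and,
          V, qf_inv_sqrtMap hl, pball, Set.mem_sdiff, Metric.mem_ball, dist_zero_right,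
          Set.mem_singleton_iff, hz, and_true]
        rw [nrm_coe hG, map_smul, sqrtMapInv_sqrtMap hl, nrm_smul hn hz]
        refine and_congr ?_ Iff.rfl
        constructor <;> intro h <;> nlinarith [norm_nonneg z]
    rw [hpre, Measure.addHaar_preimage_linearMap _ (det_sqrtMap_ne_zero hl b), ← mul_assoc,
      ← ENNReal.ofReal_mul (abs_nonneg _), abs_inv,
      mul_inv_cancel₀ (abs_ne_zero.2 (det_sqrtMap_ne_zero hl b))]
    simp
  -- The normalizing constant is never computed: both laws have total mass one, which determines
  -- `c`.
  have huniv : c * volume (pball p) = 1 := by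
    have := hc Set.univ MeasurableSet.univ
    rw [Measure.map_apply hmeas MeasurableSet.univ, Set.preimage_univ, measure_univ] at this
    simpa using this.symm
  have hceq : c = (volume (pball p))⁻¹ := ENNReal.eq_inv_of_mul_eq_one_left huniv
  ext s hs
  rw [hc s hs, unif, Measure.smul_apply, Measure.map_apply measurable_nrm hs,
    Measure.restrict_apply (measurable_nrm hs), smul_eq_mul, hceq]
  congr 2
  ext z; simp [and_comm]

/-! ### Rotation invariance and fourth moments of the uniform distribution. -/

/-- A linear isometry acting on the sphere. -/
def sphMap (L : EuclideanSpace ℝ (Fin p) ≃ₗᵢ[ℝ] EuclideanSpace ℝ (Fin p)) (u : Sph p) : Sph p :=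
  ⟨L u, by simp⟩

omit [NeZero p] in
lemma continuous_sphMap (L : EuclideanSpace ℝ (Fin p) ≃ₗᵢ[ℝ] EuclideanSpace ℝ (Fin p)) :
    Continuous (sphMap L) :=
  Continuous.subtype_mk (L.continuous.comp continuous_subtype_val) _

/-- `unif` is an image of Lebesgue measure on the punctured ball, and a linear isometry preserves
that measure and that ball and commutes with normalization. -/
lemma measurePreserving_sphMap
    (L : EuclideanSpace ℝ (Fin p) ≃ₗᵢ[ℝ] EuclideanSpace ℝ (Fin p)) :
    MeasurePreserving (sphMap L) (unif p) (unif p) := by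
  refine ⟨(continuous_sphMap L).measurable, ?_⟩
  ext s hs
  have hs' := (continuous_sphMap L).measurable hs
  rw [Measure.map_apply (continuous_sphMap L).measurable hs, unif, Measure.smul_apply,
    Measure.smul_apply, Measure.map_apply measurable_nrm hs, Measure.map_apply measurable_nrm hs',
    Measure.restrict_apply (measurable_nrm hs), Measure.restrict_apply (measurable_nrm hs')]
  congr 1
  rw [← L.measurePreserving.measure_preimage
    ((measurable_nrm hs).inter measurableSet_pball).nullMeasurableSet]
  congr 1
  ext z
  by_cases hz : z = 0
  · simp [hz, pball]
  have hLz : L z ≠ 0 := by simpa using hz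
  have : nrm (L z) = sphMap L (nrm z) := by
    ext1
    change _ = L (nrm z)
    rw [nrm_coe hLz, nrm_coe hz]; simp
  simp [pball, this, hz]

lemma integral_sphMap (L : EuclideanSpace ℝ (Fin p) ≃ₗᵢ[ℝ] EuclideanSpace ℝ (Fin p))
    {f : Sph p → ℝ} (hf : Continuous f) :
    ∫ u, f (sphMap L u) ∂(unif p) = ∫ u, f u ∂(unif p) := by
  conv_rhs => rw [← (measurePreserving_sphMap L).map_eq]
  rw [integral_map (continuous_sphMap L).measurable.aemeasurable
    hf.aestronglyMeasurable]

lemma integrable_unif {f : Sph p → ℝ} (hf : Continuous f) : Integrable f (unif p) :=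
  hf.integrable_of_hasCompactSupport (HasCompactSupport.of_compactSpace f)

/-- A reflection carries `x` to `‖x‖ • e`, so by invariance the fourth moment depends on `‖x‖` only.
The constant is left unevaluated here. -/
lemma integral_inner_pow_four (x : EuclideanSpace ℝ (Fin p)) :
    ∫ u : Sph p, ⟪x, (u : EuclideanSpace ℝ (Fin p))⟫ ^ 4 ∂(unif p) =
      (∫ u : Sph p, ⟪(EuclideanSpace.single 0 1 : EuclideanSpace ℝ (Fin p)),
        (u : EuclideanSpace ℝ (Fin p))⟫ ^ 4 ∂(unif p)) * ‖x‖ ^ 4 := by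
  set e : EuclideanSpace ℝ (Fin p) := EuclideanSpace.single 0 1
  have hnorm : ‖x‖ = ‖‖x‖ • e‖ := by simp [norm_smul, e]
  set L := (ℝ ∙ (x - ‖x‖ • e))ᗮ.reflection
  have hL : L x = ‖x‖ • e := Submodule.reflection_sub hnorm
  have hc : Continuous fun u : Sph p => ⟪‖x‖ • e, (u : EuclideanSpace ℝ (Fin p))⟫ ^ 4 := by
    fun_prop
  have h1 := integral_sphMap L hc
  have h2 : ∀ u : Sph p, ⟪‖x‖ • e, (sphMap L u : EuclideanSpace ℝ (Fin p))⟫ =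
      ⟪x, (u : EuclideanSpace ℝ (Fin p))⟫ := by
    intro u
    rw [← hL]; exact L.inner_map_map x u
  simp only [h2] at h1
  rw [h1, ← integral_mul_const]
  refine integral_congr_ae (ae_of_all _ fun u => ?_)
  simp only [inner_smul_left]
  simp; ring

/-- Fourth moments of the uniform distribution on the sphere. -/
lemma integral_inner_sq_mul_inner_sq (x y : EuclideanSpace ℝ (Fin p)) :
    ∫ u : Sph p, ⟪x, (u : EuclideanSpace ℝ (Fin p))⟫ ^ 2 *
        ⟪y, (u : EuclideanSpace ℝ (Fin p))⟫ ^ 2 ∂(unif p) =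
      (2 * ⟪x, y⟫ ^ 2 + ‖x‖ ^ 2 * ‖y‖ ^ 2) / (p * (p + 2)) := by
  set m := ∫ u : Sph p, ⟪(EuclideanSpace.single 0 1 : EuclideanSpace ℝ (Fin p)),
        (u : EuclideanSpace ℝ (Fin p))⟫ ^ 4 ∂(unif p)
  have hint : ∀ z : EuclideanSpace ℝ (Fin p), Integrable
      (fun u : Sph p => ⟪z, (u : EuclideanSpace ℝ (Fin p))⟫ ^ 4) (unif p) :=
    fun z => integrable_unif (by fun_prop)
  -- Polarization: `12 a² b² = (a + b)⁴ + (a - b)⁴ - 2a⁴ - 2b⁴` reduces mixed moments to pure ones.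
  have key : ∀ x y : EuclideanSpace ℝ (Fin p),
      ∫ u : Sph p, ⟪x, (u : EuclideanSpace ℝ (Fin p))⟫ ^ 2 *
        ⟪y, (u : EuclideanSpace ℝ (Fin p))⟫ ^ 2 ∂(unif p) =
      m / 3 * (2 * ⟪x, y⟫ ^ 2 + ‖x‖ ^ 2 * ‖y‖ ^ 2) := by
    intro x y
    have h1 : ∀ u : Sph p, ⟪x, (u : EuclideanSpace ℝ (Fin p))⟫ ^ 2 *
        ⟪y, (u : EuclideanSpace ℝ (Fin p))⟫ ^ 2 =
        (⟪x + y, (u : EuclideanSpace ℝ (Fin p))⟫ ^ 4 + ⟪x - y, (u : EuclideanSpace ℝ (Fin p))⟫ ^ 4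
          - (2 * ⟪x, (u : EuclideanSpace ℝ (Fin p))⟫ ^ 4
          + 2 * ⟪y, (u : EuclideanSpace ℝ (Fin p))⟫ ^ 4)) / 12 := by
      intro u; rw [inner_add_left, inner_sub_left]; ring
    simp_rw [h1]
    have i1 : Integrable (fun u : Sph p => ⟪x + y, (u : EuclideanSpace ℝ (Fin p))⟫ ^ 4 +
        ⟪x - y, (u : EuclideanSpace ℝ (Fin p))⟫ ^ 4) (unif p) := (hint _).add (hint _)
    have i2 : Integrable (fun u : Sph p => 2 * ⟪x, (u : EuclideanSpace ℝ (Fin p))⟫ ^ 4 +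
        2 * ⟪y, (u : EuclideanSpace ℝ (Fin p))⟫ ^ 4) (unif p) :=
      ((hint x).const_mul 2).add ((hint y).const_mul 2)
    rw [integral_div, integral_sub i1 i2, integral_add (hint _) (hint _),
      integral_add ((hint x).const_mul 2) ((hint y).const_mul 2), integral_const_mul,
      integral_const_mul, integral_inner_pow_four (x + y), integral_inner_pow_four (x - y),
      integral_inner_pow_four x, integral_inner_pow_four y]
    have ha := norm_add_sq_real x y
    have hb := norm_sub_sq_real x y
    have ha4 : ‖x + y‖ ^ 4 = (‖x + y‖ ^ 2) ^ 2 := by ring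
    have hb4 : ‖x - y‖ ^ 4 = (‖x - y‖ ^ 2) ^ 2 := by ring
    rw [ha4, hb4, ha, hb]; ring
  have hsum : ∀ z : EuclideanSpace ℝ (Fin p),
      ∑ k, ⟪(EuclideanSpace.basisFun (Fin p) ℝ k), z⟫ ^ 2 = ‖z‖ ^ 2 := fun z => by
    rw [← (EuclideanSpace.basisFun (Fin p) ℝ).sum_sq_norm_inner_right z]
    simp
  have hone : ∀ u : Sph p, ‖(u : EuclideanSpace ℝ (Fin p))‖ = 1 := fun u => norm_eq_of_mem_sphere u
  -- The constant comes from summing over all pairs of basis vectors: the integrand becomes `‖u‖⁴ =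
  -- 1`, and the right-hand sides add up to `m / 3 * (2 p + p²)`.
  have h3 : (1 : ℝ) = m / 3 * (p * (p + 2)) := by
    have h4 : (1 : ℝ) = ∫ u : Sph p, ∑ i, ∑ j,
        ⟪(EuclideanSpace.basisFun (Fin p) ℝ i), (u : EuclideanSpace ℝ (Fin p))⟫ ^ 2 *
        ⟪(EuclideanSpace.basisFun (Fin p) ℝ j), (u : EuclideanSpace ℝ (Fin p))⟫ ^ 2 ∂(unif p) := by
      simp_rw [← Finset.mul_sum, hsum, ← Finset.sum_mul, hsum, hone]
      simp
    refine h4.trans ?_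
    rw [integral_finsetSum _ (fun i _ => integrable_unif (by fun_prop))]
    have h5 : ∀ i : Fin p, ∫ u : Sph p, ∑ j,
        ⟪(EuclideanSpace.basisFun (Fin p) ℝ i), (u : EuclideanSpace ℝ (Fin p))⟫ ^ 2 *
        ⟪(EuclideanSpace.basisFun (Fin p) ℝ j), (u : EuclideanSpace ℝ (Fin p))⟫ ^ 2 ∂(unif p) =
        m / 3 * (p + 2) := by
      intro i
      rw [integral_finsetSum _ (fun j _ => integrable_unif (by fun_prop))]
      simp_rw [key]
      have h6 : ∑ j, ⟪(EuclideanSpace.basisFun (Fin p) ℝ i),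
          (EuclideanSpace.basisFun (Fin p) ℝ j)⟫ ^ 2 = 1 := by
        simp_rw [real_inner_comm _ (EuclideanSpace.basisFun (Fin p) ℝ i), hsum,
          OrthonormalBasis.norm_eq_one]
        norm_num
      rw [← Finset.mul_sum, Finset.sum_add_distrib, ← Finset.mul_sum, h6]
      simp only [OrthonormalBasis.norm_eq_one, one_pow, mul_one, Finset.sum_const,
        Finset.card_univ, Fintype.card_fin, nsmul_eq_mul]
      ring
    refine (Finset.sum_congr rfl fun i _ => h5 i).trans ?_
    simp; ring
  rw [key]
  have hp0 : (0 : ℝ) < p := Nat.cast_pos.2 (Nat.pos_of_ne_zero (NeZero.ne p))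
  have : m / 3 = 1 / (p * (p + 2)) := by
    rw [eq_div_iff (by positivity)]; linarith
  rw [this]; ring

end

/-! ### Deterministic approximation of solutions of Tyler's equation. -/

section
variable {p n : ℕ}

/-- The empirical fourth moments of `w` are within `ε` of those of the uniform distribution on the
sphere. -/
def FourthMomentsClose (w : Fin n → EuclideanSpace ℝ (Fin p)) (ε : ℝ) : Prop :=
  ∀ x y : EuclideanSpace ℝ (Fin p),
    |(n : ℝ)⁻¹ * ∑ i, ⟪x, w i⟫ ^ 2 * ⟪y, w i⟫ ^ 2 -
      (2 * ⟪x, y⟫ ^ 2 + ‖x‖ ^ 2 * ‖y‖ ^ 2) / (p * (p + 2))| ≤ ε * (‖x‖ ^ 2 * ‖y‖ ^ 2)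

/-- Tyler's estimating equation, for a sample of vectors and a scatter matrix. -/
def TylerEq (z : Fin n → EuclideanSpace ℝ (Fin p)) (V : Matrix (Fin p) (Fin p) ℝ) : Prop :=
  V.PosDef ∧ ∀ x : EuclideanSpace ℝ (Fin p),
    p * ((n : ℝ)⁻¹ * ∑ i, ⟪x, z i⟫ ^ 2 / qf V⁻¹ (z i)) = qf V x

lemma sum_inner_sq (b : OrthonormalBasis (Fin p) ℝ (EuclideanSpace ℝ (Fin p)))
    (x : EuclideanSpace ℝ (Fin p)) : ∑ k, ⟪b k, x⟫ ^ 2 = ‖x‖ ^ 2 := by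
  rw [← b.sum_sq_norm_inner_right x]; simp

variable [NeZero p]

/-- Summing the fourth-moment condition over `y` in an orthonormal basis replaces `⟪y, w i⟫ ^ 2` by
`‖w i‖² = 1`; the `p` summands give the factor `p`. -/
lemma FourthMomentsClose.second {w : Fin n → EuclideanSpace ℝ (Fin p)} {ε : ℝ}
    (h : FourthMomentsClose w ε) (hw : ∀ i, ‖w i‖ = 1) (x : EuclideanSpace ℝ (Fin p)) :
    |(n : ℝ)⁻¹ * ∑ i, ⟪x, w i⟫ ^ 2 - ‖x‖ ^ 2 / p| ≤ p * ε * ‖x‖ ^ 2 := by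
  set b := EuclideanSpace.basisFun (Fin p) ℝ
  have hp0 : (0 : ℝ) < p := Nat.cast_pos.2 (Nat.pos_of_ne_zero (NeZero.ne p))
  have h1 : (n : ℝ)⁻¹ * ∑ i, ⟪x, w i⟫ ^ 2 - ‖x‖ ^ 2 / p =
      ∑ k, ((n : ℝ)⁻¹ * ∑ i, ⟪x, w i⟫ ^ 2 * ⟪b k, w i⟫ ^ 2 -
        (2 * ⟪x, b k⟫ ^ 2 + ‖x‖ ^ 2 * ‖b k‖ ^ 2) / (p * (p + 2))) := by
    rw [Finset.sum_sub_distrib, ← Finset.mul_sum, Finset.sum_comm, ← Finset.sum_div,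
      Finset.sum_add_distrib, ← Finset.mul_sum]
    simp_rw [← Finset.mul_sum, sum_inner_sq, hw, real_inner_comm _ x, sum_inner_sq]
    simp only [OrthonormalBasis.norm_eq_one, one_pow, mul_one, Finset.sum_const,
        Finset.card_univ, Fintype.card_fin, nsmul_eq_mul]
    field_simp
    ring
  rw [h1]
  refine (Finset.abs_sum_le_sum_abs _ _).trans ((Finset.sum_le_sum fun k _ => h x (b k)).trans ?_)
  simp; exact le_of_eq (by ring)

/-- Pointwise bound: `a_m / w'Aw ≤ 1 - (1 - a_m / a_M) ⟨g_M, w⟩²` when `a_m` is the smallest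
eigenvalue. -/
lemma div_qf_le {a : Fin p → ℝ} {g : OrthonormalBasis (Fin p) ℝ (EuclideanSpace ℝ (Fin p))}
    {m M : Fin p} (hm : ∀ j, a m ≤ a j) (ha : 0 < a m) {w : EuclideanSpace ℝ (Fin p)}
    (hw : ‖w‖ = 1) :
    a m / qf (specMat a g) w ≤ 1 - (1 - a m / a M) * ⟪g M, w⟫ ^ 2 := by
  set t := ⟪g M, w⟫ ^ 2
  have hM : 0 < a M := ha.trans_le (hm M)
  have ht0 : 0 ≤ t := sq_nonneg _
  have hsum := sum_inner_sq g w
  rw [hw, one_pow] at hsum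
  have ht1 : t ≤ 1 := by
    rw [← hsum]; exact Finset.single_le_sum (f := fun k => ⟪g k, w⟫ ^ 2)
      (fun _ _ => sq_nonneg _) (Finset.mem_univ M)
  have h1 : a m + (a M - a m) * t ≤ qf (specMat a g) w := by
    have h2 : qf (specMat a g) w - a m = ∑ j, (a j - a m) * ⟪g j, w⟫ ^ 2 := by
      simp_rw [sub_mul, Finset.sum_sub_distrib, ← Finset.mul_sum, hsum, mul_one, qf_specMat]
    have h3 : (a M - a m) * t ≤ ∑ j, (a j - a m) * ⟪g j, w⟫ ^ 2 :=
      Finset.single_le_sum (f := fun j => (a j - a m) * ⟪g j, w⟫ ^ 2)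
        (fun j _ => mul_nonneg (sub_nonneg.2 (hm j)) (sq_nonneg _)) (Finset.mem_univ M)
    linarith
  have hpos : 0 < a m + (a M - a m) * t := by
    have := mul_nonneg (sub_nonneg.2 (hm M)) ht0
    linarith
  refine (div_le_div_of_nonneg_left ha.le hpos h1).trans ?_
  rw [div_le_iff₀ hpos]
  -- Convexity of the reciprocal: the right-hand side is the chord, in `t`, between the values `1`
  -- at `t = 0` and `a m / a M` at `t = 1`. The identity gives the gap explicitly.
  have h5 : (1 - (1 - a m / a M) * t) * (a m + (a M - a m) * t) - a m =
      t * (1 - t) * ((a M - a m) ^ 2 / a M) := by field_simp; ring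
  have : 0 ≤ t * (1 - t) * ((a M - a m) ^ 2 / a M) := by
    have := sub_nonneg.2 ht1
    positivity
  linarith

/-- The key estimate behind consistency and existence of Tyler's estimator. -/
lemma one_sub_div_le {w : Fin n → EuclideanSpace ℝ (Fin p)} {ε : ℝ}
    (h : FourthMomentsClose w ε) (hw : ∀ i, ‖w i‖ = 1) (hε : 2 * (p + 2) * p * ε ≤ 1)
    (hε0 : 0 ≤ ε)
    {a : Fin p → ℝ} {g : OrthonormalBasis (Fin p) ℝ (EuclideanSpace ℝ (Fin p))}
    {m : Fin p} (hm : ∀ j, a m ≤ a j) (ha : 0 < a m)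
    (h1 : 1 ≤ a m * (p * ((n : ℝ)⁻¹ * ∑ i, ⟪g m, w i⟫ ^ 2 / qf (specMat a g) (w i))))
    (M : Fin p) : 1 - a m / a M ≤ 2 * (p + 2) * p ^ 2 * ε := by
  have hp0 : (0 : ℝ) < p := Nat.cast_pos.2 (Nat.pos_of_ne_zero (NeZero.ne p))
  by_cases hmM : m = M
  · subst hmM; rw [div_self ha.ne']; simp; positivity
  set lam := a m / a M
  have hlam : lam ≤ 1 := div_le_one_of_le₀ (hm M) (ha.le.trans (hm M))
  -- The second moment contributes `p · (1/p) = 1` up to `O(ε)`, which uses up the lower bound `1`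
  -- in `h1`. So `1 - lam`, multiplied by a fourth moment that stays near `1 / (p (p + 2))`, must be
  -- `O(ε)`; the condition on `ε` preserves half of that coefficient. Only an inequality is required
  -- of the matrix, so the estimate applies to exact solutions and also to minimisers on the
  -- boundary of a constraint set.
  have h2 : a m * (p * ((n : ℝ)⁻¹ * ∑ i, ⟪g m, w i⟫ ^ 2 / qf (specMat a g) (w i))) ≤
      p * ((n : ℝ)⁻¹ * ∑ i, ⟪g m, w i⟫ ^ 2 -
        (1 - lam) * ((n : ℝ)⁻¹ * ∑ i, ⟪g m, w i⟫ ^ 2 * ⟪g M, w i⟫ ^ 2)) := by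
    rw [mul_left_comm]
    refine mul_le_mul_of_nonneg_left ?_ hp0.le
    rw [mul_left_comm, mul_left_comm (1 - lam), ← mul_sub]
    refine mul_le_mul_of_nonneg_left ?_ (by positivity)
    rw [Finset.mul_sum, Finset.mul_sum, ← Finset.sum_sub_distrib]
    refine Finset.sum_le_sum fun i _ => ?_
    have h3 := mul_le_mul_of_nonneg_left (div_qf_le (g := g) (M := M) hm ha (hw i))
      (sq_nonneg ⟪g m, w i⟫)
    calc _ = ⟪g m, w i⟫ ^ 2 * (a m / qf (specMat a g) (w i)) := by ring
      _ ≤ _ := h3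
      _ = _ := by ring
  have h3 := (abs_le.1 (h.second hw (g m))).2
  have h4 := (abs_le.1 (h (g m) (g M))).1
  rw [g.inner_eq_ite, if_neg hmM] at h4
  simp only [OrthonormalBasis.norm_eq_one, one_pow, mul_one, mul_zero, zero_add, ne_eq,
    OfNat.ofNat_ne_zero, not_false_eq_true, zero_pow] at h3 h4
  set S2 := (n : ℝ)⁻¹ * ∑ i, ⟪g m, w i⟫ ^ 2
  set S4 := (n : ℝ)⁻¹ * ∑ i, ⟪g m, w i⟫ ^ 2 * ⟪g M, w i⟫ ^ 2
  have h5 : 1 ≤ p * (S2 - (1 - lam) * S4) := h1.trans h2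
  have h6 : (1 - lam) * (1 / (p * (p + 2)) - ε) ≤ (1 - lam) * S4 :=
    mul_le_mul_of_nonneg_left (by linarith) (by linarith)
  have h7 : p * (S2 - (1 - lam) * S4) ≤ p * (1 / p + p * ε - (1 - lam) * (1 / (p * (p + 2)) - ε)) :=
    mul_le_mul_of_nonneg_left (by linarith) hp0.le
  have h8 : p * (1 / p + p * ε - (1 - lam) * (1 / (p * (p + 2)) - ε)) =
      1 + p ^ 2 * ε - (1 - lam) * (1 / (p + 2) - p * ε) := by
    field_simp
  have h9 : (1 - lam) * (1 / (2 * (p + 2))) ≤ (1 - lam) * (1 / (p + 2) - p * ε) := by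
    refine mul_le_mul_of_nonneg_left ?_ (by linarith)
    have : p * ε ≤ 1 / (2 * (p + 2)) := by
      rw [le_div_iff₀ (by positivity)]; linarith
    have h10 : (1 : ℝ) / (p + 2) = 2 * (1 / (2 * (p + 2))) := by field_simp
    linarith
  have h11 : (1 - lam) * (1 / (2 * (p + 2))) ≤ p ^ 2 * ε := by linarith
  rw [mul_one_div, div_le_iff₀ (by positivity)] at h11
  linarith

lemma TylerEq.smul {w : Fin n → EuclideanSpace ℝ (Fin p)} {N : Matrix (Fin p) (Fin p) ℝ}
    (h : TylerEq w N) {c : ℝ} (hc : 0 < c) : TylerEq w (c • N) := by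
  obtain ⟨l, b, hl, rfl⟩ := exists_eq_specMat_of_posDef h.1
  have h1 : c • specMat l b = specMat (fun j => c * l j) b := by
    simp [specMat, Finset.smul_sum, smul_smul]
  have h2 : ∀ x, qf (c • specMat l b)⁻¹ x = c⁻¹ * qf (specMat l b)⁻¹ x := by
    intro x
    rw [h1, specMat_inv (fun j => (mul_pos hc (hl j)).ne'), specMat_inv (fun j => (hl j).ne'),
      qf_specMat, qf_specMat, Finset.mul_sum]
    refine Finset.sum_congr rfl fun j _ => ?_
    rw [mul_inv, mul_assoc]
  refine ⟨h1 ▸ specMat_posDef (fun j => mul_pos hc (hl j)) b, fun x => ?_⟩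
  rw [qf_smul, ← h.2 x]
  simp_rw [h2, ← div_div, div_inv_eq_mul, mul_comm _ c, mul_div_assoc, ← Finset.mul_sum]
  ring

/-- The linear approximation `(p + 2) S - (2 / p) I` of Tyler's estimator, as a quadratic form. -/
def linTyler (w : Fin n → EuclideanSpace ℝ (Fin p)) (x : EuclideanSpace ℝ (Fin p)) : ℝ :=
  (p + 2) * ((n : ℝ)⁻¹ * ∑ i, ⟪x, w i⟫ ^ 2) - 2 / p * ‖x‖ ^ 2

/-- Write the inverse of the solution as `I + H`. The solution itself is `I - H` up to `O(η²)`,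
while expanding the estimating equation with the limiting fourth moments gives `p S - (2 H + tr H ·
I) / (p + 2)`. Eliminating `H` between the two leaves `(p + 2) S - (2 / p) I - (tr H / p) I`. Since
`linTyler` is itself within `O(ε)` of the identity, the last term can be absorbed as the factor `1 -
t` with `t = tr H / p`; a scalar factor does not affect the eigenvectors. -/
lemma tyler_approx_aux {w : Fin n → EuclideanSpace ℝ (Fin p)} {ε η : ℝ}
    (h : FourthMomentsClose w ε) (hw : ∀ i, ‖w i‖ = 1) (hε0 : 0 ≤ ε)
    {nu : Fin p → ℝ} {g : OrthonormalBasis (Fin p) ℝ (EuclideanSpace ℝ (Fin p))}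
    (hT : TylerEq w (specMat nu g)) (hnu0 : ∀ j, 0 < nu j) (hnu1 : ∀ j, nu j ≤ 1)
    (hnu : ∀ j, (nu j)⁻¹ ≤ 1 + η) (hη0 : 0 ≤ η) (hη1 : η ≤ 1 / 2) :
    ∃ t : ℝ, |t| ≤ 1 / 2 ∧ ∀ x, |qf (specMat nu g) x - (1 - t) * linTyler w x| ≤
      ((p + 2) * (η ^ 2 + p * ε * η) + 2 * η ^ 2 + η * ((p + 2) * p * ε)) * ‖x‖ ^ 2 := by
  have hp0 : (0 : ℝ) < p := Nat.cast_pos.2 (Nat.pos_of_ne_zero (NeZero.ne p))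
  have hp1 : (1 : ℝ) ≤ p := Nat.one_le_cast.2 (Nat.pos_of_ne_zero (NeZero.ne p))
  set H : Fin p → ℝ := fun j => (nu j)⁻¹ - 1
  have hH0 : ∀ j, 0 ≤ H j := fun j => sub_nonneg.2 ((one_le_inv₀ (hnu0 j)).2 (hnu1 j))
  have hH1 : ∀ j, H j ≤ η := fun j => by simp only [H]; linarith [hnu j]
  set tau := ∑ j, H j
  have htau0 : 0 ≤ tau := Finset.sum_nonneg fun j _ => hH0 j
  have htau1 : tau ≤ p * η := by
    refine (Finset.sum_le_sum fun j _ => hH1 j).trans ?_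
    simp
  have ht : tau / p ≤ η := by rw [div_le_iff₀ hp0]; linarith
  have ht0 : 0 ≤ tau / p := by positivity
  refine ⟨tau / p, by rw [abs_of_nonneg ht0]; linarith, fun x => ?_⟩
  set Y := ‖x‖ ^ 2
  set Q := qf (specMat nu g) x
  set X := ∑ j, H j * ⟪g j, x⟫ ^ 2
  set S2 := (n : ℝ)⁻¹ * ∑ i, ⟪x, w i⟫ ^ 2
  have hY0 : 0 ≤ Y := sq_nonneg _
  have hn0 : (0 : ℝ) ≤ (n : ℝ)⁻¹ := by positivity
  -- the second-moment deviation
  have hS2 : |S2 - Y / p| ≤ p * ε * Y := h.second hw x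
  have hS2' : S2 ≤ Y := by
    have h1 : ∑ i, ⟪x, w i⟫ ^ 2 ≤ n * Y := by
      refine (Finset.sum_le_sum fun i _ => ?_).trans (by simp : ∑ i : Fin n, Y ≤ n * Y)
      have := abs_real_inner_le_norm x (w i)
      rw [hw, mul_one] at this
      calc _ = |⟪x, w i⟫| ^ 2 := (sq_abs _).symm
        _ ≤ _ := pow_le_pow_left₀ (abs_nonneg _) this 2
    rcases Nat.eq_zero_or_pos n with hn | hn
    · subst hn; simp [S2, hY0]
    · have : (0 : ℝ) < n := Nat.cast_pos.2 hn
      simp only [S2]; rw [inv_mul_le_iff₀ this]; exact h1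
  have hS20 : 0 ≤ S2 := mul_nonneg hn0 (Finset.sum_nonneg fun _ _ => sq_nonneg _)
  -- (2): expansion of the eigenvalues
  have e2 : |Q - Y + X| ≤ η ^ 2 * Y := by
    have h1 : Q - Y + X = ∑ j, (nu j - 1 + H j) * ⟪g j, x⟫ ^ 2 := by
      simp only [Q, Y, X, qf_specMat, ← sum_inner_sq g x, ← Finset.sum_sub_distrib,
        ← Finset.sum_add_distrib]
      exact Finset.sum_congr rfl fun j _ => by ring
    simp only [Y]
    rw [h1, ← sum_inner_sq g x, Finset.mul_sum]
    refine (Finset.abs_sum_le_sum_abs _ _).trans (Finset.sum_le_sum fun j _ => ?_)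
    rw [abs_mul, abs_of_nonneg (sq_nonneg ⟪g j, x⟫)]
    refine mul_le_mul_of_nonneg_right ?_ (sq_nonneg _)
    have h2 : nu j - 1 + H j = nu j * H j ^ 2 := by
      have := (hnu0 j).ne'
      simp only [H]; field_simp; ring
    rw [h2, abs_of_nonneg (mul_nonneg (hnu0 j).le (sq_nonneg _))]
    calc nu j * H j ^ 2 ≤ 1 * η ^ 2 :=
          mul_le_mul (hnu1 j) (pow_le_pow_left₀ (hH0 j) (hH1 j) 2) (sq_nonneg _) zero_le_one
      _ = η ^ 2 := one_mul _
  -- (1): expansion of the estimating equation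
  set hh : Fin n → ℝ := fun i => ∑ j, H j * ⟪g j, w i⟫ ^ 2
  have hhq : ∀ i, qf (specMat nu g)⁻¹ (w i) = 1 + hh i := by
    intro i
    have h1 := sum_inner_sq g (w i)
    rw [hw, one_pow] at h1
    rw [specMat_inv (fun j => (hnu0 j).ne'), qf_specMat]
    simp only [hh, H]
    simp_rw [sub_mul, Finset.sum_sub_distrib, one_mul, h1]; ring
  have hh0 : ∀ i, 0 ≤ hh i := fun i =>
    Finset.sum_nonneg fun j _ => mul_nonneg (hH0 j) (sq_nonneg _)
  have hh1 : ∀ i, hh i ≤ η := fun i => by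
    have h1 := sum_inner_sq g (w i)
    rw [hw, one_pow] at h1
    calc hh i ≤ ∑ j, η * ⟪g j, w i⟫ ^ 2 :=
          Finset.sum_le_sum fun j _ => mul_le_mul_of_nonneg_right (hH1 j) (sq_nonneg _)
      _ = η := by rw [← Finset.mul_sum, h1, mul_one]
  have e1a : |Q - p * S2 + p * ((n : ℝ)⁻¹ * ∑ i, ⟪x, w i⟫ ^ 2 * hh i)| ≤ p * (η ^ 2 * Y) := by
    have h1 : Q - p * S2 + p * ((n : ℝ)⁻¹ * ∑ i, ⟪x, w i⟫ ^ 2 * hh i) =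
        p * ((n : ℝ)⁻¹ * ∑ i, ⟪x, w i⟫ ^ 2 * (hh i ^ 2 / (1 + hh i))) := by
      simp only [Q]
      rw [← hT.2 x]
      simp only [S2]
      rw [← mul_sub, ← mul_add, ← mul_sub, ← mul_add, ← Finset.sum_sub_distrib,
        ← Finset.sum_add_distrib]
      congr 2
      refine Finset.sum_congr rfl fun i _ => ?_
      rw [hhq]
      have : 1 + hh i ≠ 0 := by linarith [hh0 i]
      field_simp; ring
    have h2 : ∀ i, 0 ≤ hh i ^ 2 / (1 + hh i) ∧ hh i ^ 2 / (1 + hh i) ≤ η ^ 2 := fun i => by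
      have h3 := hh0 i
      refine ⟨by positivity, (div_le_self (sq_nonneg _) (by linarith)).trans
        (pow_le_pow_left₀ h3 (hh1 i) 2)⟩
    rw [h1, abs_of_nonneg (mul_nonneg hp0.le (mul_nonneg hn0
      (Finset.sum_nonneg fun i _ => mul_nonneg (sq_nonneg _) (h2 i).1)))]
    refine mul_le_mul_of_nonneg_left ?_ hp0.le
    calc _ ≤ (n : ℝ)⁻¹ * ∑ i, ⟪x, w i⟫ ^ 2 * η ^ 2 := mul_le_mul_of_nonneg_left
            (Finset.sum_le_sum fun i _ => mul_le_mul_of_nonneg_left (h2 i).2 (sq_nonneg _)) hn0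
      _ = η ^ 2 * S2 := by simp only [S2]; rw [← Finset.sum_mul]; ring
      _ ≤ _ := mul_le_mul_of_nonneg_left hS2' (sq_nonneg _)
  have e1b : |(n : ℝ)⁻¹ * ∑ i, ⟪x, w i⟫ ^ 2 * hh i - (2 * X + tau * Y) / (p * (p + 2))| ≤
      ε * (p * η) * Y := by
    have h1 : (n : ℝ)⁻¹ * ∑ i, ⟪x, w i⟫ ^ 2 * hh i - (2 * X + tau * Y) / (p * (p + 2)) =
        ∑ j, H j * ((n : ℝ)⁻¹ * ∑ i, ⟪x, w i⟫ ^ 2 * ⟪g j, w i⟫ ^ 2 -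
          (2 * ⟪x, g j⟫ ^ 2 + ‖x‖ ^ 2 * ‖g j‖ ^ 2) / (p * (p + 2))) := by
      simp_rw [mul_sub, Finset.sum_sub_distrib, hh, Finset.mul_sum]
      rw [Finset.sum_comm]
      congr 1
      · exact Finset.sum_congr rfl fun j _ => Finset.sum_congr rfl fun i _ => by ring
      · simp only [X, tau, Y, OrthonormalBasis.norm_eq_one, Finset.mul_sum, Finset.sum_mul,
          ← Finset.sum_add_distrib, Finset.sum_div]
        refine Finset.sum_congr rfl fun j _ => ?_
        rw [real_inner_comm x (g j)]; ring
    rw [h1]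
    refine (Finset.abs_sum_le_sum_abs _ _).trans ?_
    calc _ ≤ ∑ j, H j * (ε * Y) := Finset.sum_le_sum fun j _ => by
          rw [abs_mul, abs_of_nonneg (hH0 j)]
          refine mul_le_mul_of_nonneg_left ?_ (hH0 j)
          simpa [Y] using h x (g j)
      _ = tau * (ε * Y) := by rw [← Finset.sum_mul]
      _ ≤ p * η * (ε * Y) := mul_le_mul_of_nonneg_right htau1 (by positivity)
      _ = _ := by ring
  -- combine
  set Z := (n : ℝ)⁻¹ * ∑ i, ⟪x, w i⟫ ^ 2 * hh i
  have hlin : linTyler w x = (p + 2) * S2 - 2 / p * Y := rfl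
  have hfY : |Y - linTyler w x| ≤ (p + 2) * (p * ε * Y) := by
    have : Y - linTyler w x = -((p + 2) * (S2 - Y / p)) := by
      rw [hlin]; field_simp; ring
    rw [this, abs_neg, abs_mul, abs_of_pos (by positivity : (0 : ℝ) < p + 2)]
    exact mul_le_mul_of_nonneg_left hS2 (by positivity)
  -- The weights `(p + 2) / p` and `-2 / p` sum to one and cancel `X`, the form of `H`. Every
  -- remaining bracket is of second order.
  have hid : Q - (1 - tau / p) * linTyler w x =
      (p + 2) / p * ((Q - p * S2 + p * Z) - p * (Z - (2 * X + tau * Y) / (p * (p + 2))))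
      - 2 / p * (Q - Y + X) - tau / p * (Y - linTyler w x) := by
    rw [hlin]; field_simp; ring
  rw [hid]
  have hp2 : (0 : ℝ) < (p + 2) / p := by positivity
  calc _ ≤ (p + 2) / p * (|Q - p * S2 + p * Z| + p * |Z - (2 * X + tau * Y) / (p * (p + 2))|)
        + 2 / p * |Q - Y + X| + tau / p * |Y - linTyler w x| := by
        refine (abs_sub _ _).trans (add_le_add ((abs_sub _ _).trans (add_le_add ?_ ?_)) ?_)
        · rw [abs_mul, abs_of_pos hp2]
          refine mul_le_mul_of_nonneg_left ((abs_sub _ _).trans ?_) hp2.le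
          rw [abs_mul (p : ℝ), abs_of_pos hp0]
        · rw [abs_mul, abs_of_nonneg (by positivity)]
        · rw [abs_mul, abs_of_nonneg ht0]
    _ ≤ (p + 2) / p * (p * (η ^ 2 * Y) + p * (ε * (p * η) * Y))
        + 2 * (η ^ 2 * Y) + η * ((p + 2) * (p * ε * Y)) := by
        gcongr
        exact div_le_self (by norm_num) hp1
    _ = _ := by field_simp

/-- Any solution of Tyler's equation is, up to scale, close to the identity, and is approximated
to second order by `linTyler`. -/
theorem tyler_approx (p : ℕ) [NeZero p] : ∃ K : ℝ, 1 ≤ K ∧ ∀ (n : ℕ)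
    (w : Fin n → EuclideanSpace ℝ (Fin p)) (ε : ℝ) (N : Matrix (Fin p) (Fin p) ℝ),
    0 ≤ ε → K * ε ≤ 1 → (∀ i, ‖w i‖ = 1) → FourthMomentsClose w ε → TylerEq w N →
    ∃ s : ℝ, 0 < s ∧ ∃ t : ℝ, |t| ≤ 1 / 2 ∧ ∀ x, (1 - K * ε) * ‖x‖ ^ 2 ≤ s * qf N x ∧
      s * qf N x ≤ ‖x‖ ^ 2 ∧ |s * qf N x - (1 - t) * linTyler w x| ≤ K * ε ^ 2 * ‖x‖ ^ 2 := by
  have hp0 : (0 : ℝ) < p := Nat.cast_pos.2 (Nat.pos_of_ne_zero (NeZero.ne p))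
  have hp1 : (1 : ℝ) ≤ p := Nat.one_le_cast.2 (Nat.pos_of_ne_zero (NeZero.ne p))
  -- `C` is the constant of `one_sub_div_le`. The inverse eigenvalues deviate by at most `2 C ε`,
  -- because `1 / (1 - C ε) ≤ 1 + 2 C ε` for `C ε ≤ 1/4`, and `D` collects the quadratic error of
  -- `tyler_approx_aux` at `η = 2 C ε`. The summand `4 C` in `K` makes `K ε ≤ 1` imply `C ε ≤ 1/4`.
  set C : ℝ := 2 * (p + 2) * p ^ 2
  have hC : 1 ≤ C := by simp only [C]; nlinarith [mul_pos hp0 hp0]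
  set D : ℝ := (p + 2) * ((2 * C) ^ 2 + p * (2 * C)) + 2 * (2 * C) ^ 2 + (2 * C) * ((p + 2) * p)
  have hD0 : 0 ≤ D := by positivity
  refine ⟨4 * C + D, by linarith, fun n w ε N hε hKε hw h4 hT => ?_⟩
  have hCε : 4 * (C * ε) ≤ 1 := by nlinarith [mul_nonneg hD0 hε]
  obtain ⟨nu, g, hnu, rfl⟩ := exists_eq_specMat_of_posDef hT.1
  -- The scale is fixed by making the largest eigenvalue equal to one. Its eigenvector belongs to
  -- the smallest eigenvalue of the inverse, where Tyler's equation gives the hypothesis of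
  -- `one_sub_div_le` with equality.
  obtain ⟨e, he⟩ := Finite.exists_max nu
  set s := (nu e)⁻¹
  have hs : 0 < s := inv_pos.2 (hnu e)
  have hsm : s • specMat nu g = specMat (fun j => s * nu j) g := by
    simp [specMat, Finset.smul_sum, smul_smul]
  have hT' := hT.smul hs
  rw [hsm] at hT'
  have hm : ∀ j, (nu e)⁻¹ ≤ (nu j)⁻¹ := fun j => inv_anti₀ (hnu j) (he j)
  have hone : 1 ≤ (nu e)⁻¹ * (p * ((n : ℝ)⁻¹ * ∑ i, ⟪g e, w i⟫ ^ 2 /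
      qf (specMat (fun j => (nu j)⁻¹) g) (w i))) := by
    have := hT.2 (g e)
    rw [specMat_inv (fun j => (hnu j).ne'), qf_basis] at this
    rw [this, inv_mul_cancel₀ (hnu e).ne']
  have hε2 : 2 * (p + 2) * p * ε ≤ 1 := by
    have h1 : 2 * ((p : ℝ) + 2) * p * ε ≤ C * ε := by
      simp only [C]
      have : 2 * ((p : ℝ) + 2) * p * ε * 1 ≤ 2 * ((p : ℝ) + 2) * p * ε * p :=
        mul_le_mul_of_nonneg_left hp1 (by positivity)
      calc _ = 2 * ((p : ℝ) + 2) * p * ε * 1 := by ring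
        _ ≤ _ := this
        _ = _ := by ring
    nlinarith [mul_nonneg (by linarith : (0 : ℝ) ≤ C) hε]
  have hlow : ∀ j, 1 - C * ε ≤ s * nu j := fun j => by
    have := one_sub_div_le (g := g) (a := fun j => (nu j)⁻¹) h4 hw hε2 hε hm (inv_pos.2 (hnu e)) hone j
    simp only [div_inv_eq_mul] at this
    simp only [C, s]; linarith
  have hs0 : ∀ j, 0 < s * nu j := fun j => mul_pos hs (hnu j)
  have hs1 : ∀ j, s * nu j ≤ 1 := fun j => by
    simp only [s]; rw [inv_mul_le_iff₀ (hnu e), mul_one]; exact he j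
  obtain ⟨t, ht, hlin⟩ := tyler_approx_aux (η := 2 * C * ε) h4 hw hε hT' hs0 hs1 (fun j => by
    rw [inv_le_iff_one_le_mul₀ (hs0 j)]
    have h1 := hlow j
    nlinarith [mul_nonneg (by linarith : (0 : ℝ) ≤ C) hε]) (by positivity) (by linarith)
  refine ⟨s, hs, t, ht, fun x => ?_⟩
  have hq : s * qf (specMat nu g) x = qf (specMat (fun j => s * nu j) g) x := by
    rw [← hsm, qf_smul]
  rw [hq]
  refine ⟨?_, ?_, (hlin x).trans ?_⟩
  · rw [qf_specMat, ← sum_inner_sq g x, Finset.mul_sum]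
    refine Finset.sum_le_sum fun j _ => mul_le_mul_of_nonneg_right ?_ (sq_nonneg _)
    have := hlow j
    nlinarith [mul_nonneg (by linarith : (0 : ℝ) ≤ C) hε, mul_nonneg hD0 hε]
  · rw [qf_specMat, ← sum_inner_sq g x]
    exact Finset.sum_le_sum fun j _ => mul_le_of_le_one_left (sq_nonneg _) (hs1 j)
  · refine mul_le_mul_of_nonneg_right ?_ (sq_nonneg _)
    have : (p + 2) * ((2 * C * ε) ^ 2 + p * ε * (2 * C * ε)) + 2 * (2 * C * ε) ^ 2
        + 2 * C * ε * ((p + 2) * p * ε) = D * ε ^ 2 := by simp only [D]; ring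
    rw [this]
    nlinarith [sq_nonneg ε]

end

/-! ### Existence of Tyler's estimator by constrained minimization of the loss. -/

section
variable {p n : ℕ}

lemma det_add_smul_outer {A : Matrix (Fin p) (Fin p) ℝ} (hA : A.PosDef) (t : ℝ)
    (x : EuclideanSpace ℝ (Fin p)) :
    (A + t • outer x).det = A.det * (1 + t * qf A⁻¹ x) := by
  have h := Matrix.det_add_replicateCol_mul_replicateRow (ι := Unit)
    ((Matrix.isUnit_iff_isUnit_det A).1 hA.isUnit) (t • x.ofLp) x.ofLp
  have h1 : t • outer x = Matrix.replicateCol Unit (t • x.ofLp) * Matrix.replicateRow Unit x.ofLp := by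
    rw [← Matrix.vecMulVec_eq, outer, Matrix.smul_vecMulVec]
  rw [h1, h, Matrix.det_unique (n := Unit), Matrix.add_apply, Matrix.one_apply_eq, Matrix.mul_assoc,
    ← Matrix.replicateCol_mulVec, Matrix.replicateRow_mul_replicateCol_apply, Matrix.mulVec_smul,
    dotProduct_smul, smul_eq_mul, qf]

lemma continuous_qf (x : EuclideanSpace ℝ (Fin p)) :
    Continuous fun A : Matrix (Fin p) (Fin p) ℝ => qf A x := by
  unfold qf; fun_prop

lemma qf_smul_vec (A : Matrix (Fin p) (Fin p) ℝ) (c : ℝ) (x : EuclideanSpace ℝ (Fin p)) :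
    qf A (c • x) = c ^ 2 * qf A x := by
  simp [qf, Matrix.mulVec_smul]; ring

/-- Minus twice the log-likelihood (per observation) of the angular Gaussian model, up to
constants, in terms of the inverse shape `A`. -/
def tylerLoss (w : Fin n → EuclideanSpace ℝ (Fin p)) (A : Matrix (Fin p) (Fin p) ℝ) : ℝ :=
  p * ((n : ℝ)⁻¹ * ∑ i, Real.log (qf A (w i))) - Real.log A.det

/-- Matrices with condition number at most `2`. -/
def WellConditioned (A : Matrix (Fin p) (Fin p) ℝ) : Prop :=
  ∀ x y : EuclideanSpace ℝ (Fin p), ‖x‖ = 1 → ‖y‖ = 1 → qf A y ≤ 2 * qf A x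

variable [NeZero p]

lemma trace_eq_sum_qf (A : Matrix (Fin p) (Fin p) ℝ) :
    A.trace = ∑ i, qf A (EuclideanSpace.single i 1) := by
  simp [Matrix.trace, qf]

lemma qf_mem_of_wellConditioned {A : Matrix (Fin p) (Fin p) ℝ} (hA : WellConditioned A)
    (htr : A.trace = p) {x : EuclideanSpace ℝ (Fin p)} (hx : ‖x‖ = 1) :
    1 / 2 ≤ qf A x ∧ qf A x ≤ 2 := by
  have hp0 : (0 : ℝ) < p := Nat.cast_pos.2 (Nat.pos_of_ne_zero (NeZero.ne p))
  rw [trace_eq_sum_qf] at htr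
  have h1 : ∑ i : Fin p, qf A (EuclideanSpace.single i 1) ≤ ∑ i : Fin p, 2 * qf A x :=
    Finset.sum_le_sum fun i _ => hA x _ hx (by simp)
  have h2 : ∑ i : Fin p, qf A x ≤ ∑ i : Fin p, 2 * qf A (EuclideanSpace.single i 1) :=
    Finset.sum_le_sum fun i _ => hA _ x (by simp) hx
  rw [htr] at h1
  rw [← Finset.mul_sum, htr] at h2
  simp at h1 h2
  constructor <;> nlinarith

lemma posDef_of_wellConditioned {A : Matrix (Fin p) (Fin p) ℝ} (hs : A.IsSymm)
    (hA : WellConditioned A) (htr : 0 < A.trace) : A.PosDef := by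
  rw [posDef_iff_qf]
  refine ⟨hs, fun x hx => ?_⟩
  have hn : 0 < ‖x‖ := norm_pos_iff.2 hx
  have h0 : x = ‖x‖ • (‖x‖⁻¹ • x) := by rw [smul_smul, mul_inv_cancel₀ hn.ne', one_smul]
  have hu : ‖‖x‖⁻¹ • x‖ = 1 := by simp [norm_smul, hn.ne']
  rw [h0, qf_smul_vec]
  refine mul_pos (by positivity) ?_
  by_contra hneg
  push Not at hneg
  rw [trace_eq_sum_qf] at htr
  have : ∑ i : Fin p, qf A (EuclideanSpace.single i 1) ≤ 0 :=
    Finset.sum_nonpos fun i _ => (hA _ _ hu (by simp)).trans (by linarith)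
  linarith

/-- Polarization together with the bound `qf A x ≤ 2 ‖x‖²`. The constant is crude: only boundedness
matters, for compactness. -/
lemma entry_mem_of_wellConditioned {A : Matrix (Fin p) (Fin p) ℝ} (hs : A.IsSymm)
    (htr : A.trace = p) (hw : WellConditioned A) (i j : Fin p) :
    A i j ∈ Set.Icc (-6 : ℝ) 6 := by
  have hq : ∀ x : EuclideanSpace ℝ (Fin p), 0 ≤ qf A x ∧ qf A x ≤ 2 * ‖x‖ ^ 2 := by
    intro x
    by_cases hx : x = 0
    · subst hx; simp [qf]
    have hn : 0 < ‖x‖ := norm_pos_iff.2 hx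
    have h0 : qf A x = ‖x‖ ^ 2 * qf A (‖x‖⁻¹ • x) := by
      rw [← qf_smul_vec, smul_smul, mul_inv_cancel₀ hn.ne', one_smul]
    have hu : ‖‖x‖⁻¹ • x‖ = 1 := by simp [norm_smul, hn.ne']
    have := qf_mem_of_wellConditioned hw htr hu
    have h2 : 0 < ‖x‖ ^ 2 := by positivity
    rw [h0]
    constructor <;> nlinarith
  have hsym := hs.apply i j
  have key : 2 * A i j =
      qf A (EuclideanSpace.single i 1 + EuclideanSpace.single j 1)
      - qf A (EuclideanSpace.single i 1) - qf A (EuclideanSpace.single j 1) := by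
    simp [qf, Matrix.mulVec_add, add_dotProduct, dotProduct_add]
    rw [hsym]; ring
  have h1 := hq (EuclideanSpace.single i 1)
  have h2 := hq (EuclideanSpace.single j 1)
  have h3 := hq (EuclideanSpace.single i 1 + EuclideanSpace.single j 1)
  have h4 : ‖(EuclideanSpace.single i 1 + EuclideanSpace.single j 1 : EuclideanSpace ℝ (Fin p))‖ ≤
      2 := (norm_add_le _ _).trans (by simp; norm_num)
  simp at h1 h2
  have h5 := pow_le_pow_left₀ (norm_nonneg _) h4 2
  rw [Set.mem_Icc]
  constructor <;> nlinarith

lemma isCompact_wellConditioned : IsCompact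
    {A : Matrix (Fin p) (Fin p) ℝ | A.IsSymm ∧ A.trace = p ∧ WellConditioned A} := by
  have hcl : IsClosed
      {A : Matrix (Fin p) (Fin p) ℝ | A.IsSymm ∧ A.trace = p ∧ WellConditioned A} := by
    refine IsClosed.inter (isClosed_eq (by fun_prop) continuous_id) (IsClosed.inter
      (isClosed_eq (by fun_prop) continuous_const) ?_)
    have : {A : Matrix (Fin p) (Fin p) ℝ | WellConditioned A} =
        ⋂ (x : EuclideanSpace ℝ (Fin p)), ⋂ (y : EuclideanSpace ℝ (Fin p)), ⋂ (_ : ‖x‖ = 1),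
        ⋂ (_ : ‖y‖ = 1), {A | qf A y ≤ 2 * qf A x} := by
      ext A; simp [WellConditioned]
    change IsClosed {A : Matrix (Fin p) (Fin p) ℝ | WellConditioned A}
    rw [this]
    exact isClosed_iInter fun x => isClosed_iInter fun y => isClosed_iInter fun _ =>
      isClosed_iInter fun _ => isClosed_le (continuous_qf y) ((continuous_qf x).const_mul 2)
  have hbox : IsCompact (Set.univ.pi fun _ : Fin p => Set.univ.pi fun _ : Fin p =>
      Set.Icc (-6 : ℝ) 6) :=
    isCompact_univ_pi fun _ => isCompact_univ_pi fun _ => isCompact_Icc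
  refine hbox.of_isClosed_subset hcl fun A hA i _ j _ =>
    entry_mem_of_wellConditioned hA.1 hA.2.1 hA.2.2 i j

lemma tylerLoss_smul {w : Fin n → EuclideanSpace ℝ (Fin p)} (hn : n ≠ 0)
    (hw : ∀ i, w i ≠ 0) {A : Matrix (Fin p) (Fin p) ℝ} (hA : A.PosDef) {c : ℝ} (hc : 0 < c) :
    tylerLoss w (c • A) = tylerLoss w A := by
  have h1 : ∀ i, Real.log (qf (c • A) (w i)) = Real.log c + Real.log (qf A (w i)) := fun i => by
    rw [qf_smul, Real.log_mul hc.ne' ((posDef_iff_qf.1 hA).2 _ (hw i)).ne']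
  have hn' : (n : ℝ) ≠ 0 := Nat.cast_ne_zero.2 hn
  rw [tylerLoss, Matrix.det_smul, Real.log_mul (by positivity) hA.det_pos.ne', Real.log_pow]
  simp_rw [h1, Finset.sum_add_distrib]
  simp [tylerLoss]
  field_simp
  ring

/-- Comparison of the loss at `A` and at a rank-one perturbation. -/
lemma log_le_of_tylerLoss_le {w : Fin n → EuclideanSpace ℝ (Fin p)}
    (hw : ∀ i, w i ≠ 0) {A : Matrix (Fin p) (Fin p) ℝ} (hA : A.PosDef) {t : ℝ}
    {x : EuclideanSpace ℝ (Fin p)} (hB : (A + t • outer x).PosDef)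
    (h : tylerLoss w A ≤ tylerLoss w (A + t • outer x)) :
    1 - (1 + t * qf A⁻¹ x)⁻¹ ≤ t * (p * ((n : ℝ)⁻¹ * ∑ i, ⟪x, w i⟫ ^ 2 / qf A (w i))) := by
  have hpos : ∀ i, 0 < qf A (w i) := fun i => (posDef_iff_qf.1 hA).2 _ (hw i)
  have hposB : ∀ i, 0 < qf (A + t • outer x) (w i) := fun i => (posDef_iff_qf.1 hB).2 _ (hw i)
  have hq : ∀ i, qf (A + t • outer x) (w i) = qf A (w i) * (1 + t * (⟪x, w i⟫ ^ 2 / qf A (w i))) :=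
    fun i => by
      rw [qf_add, qf_smul, qf_outer]
      have := (hpos i).ne'
      field_simp
  have hd : 0 < 1 + t * qf A⁻¹ x := by
    have h1 := hB.det_pos
    rw [det_add_smul_outer hA] at h1
    exact (mul_pos_iff_of_pos_left hA.det_pos).1 h1
  -- The determinant side uses `1 - 1/d ≤ log d` and the data side `log (1 + y) ≤ y`. Both are sharp
  -- to first order in `t`, so no derivative is lost as `t → 0`.
  refine (Real.one_sub_inv_le_log_of_pos hd).trans ?_
  rw [tylerLoss, tylerLoss, det_add_smul_outer hA, Real.log_mul hA.det_pos.ne' hd.ne'] at h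
  have h2 : (p : ℝ) * ((n : ℝ)⁻¹ * ∑ i, Real.log (qf (A + t • outer x) (w i))) ≤
      p * ((n : ℝ)⁻¹ * ∑ i, (Real.log (qf A (w i)) + t * (⟪x, w i⟫ ^ 2 / qf A (w i)))) := by
    refine mul_le_mul_of_nonneg_left (mul_le_mul_of_nonneg_left (Finset.sum_le_sum fun i _ => ?_)
      (by positivity)) (by positivity)
    have h3 : 0 < 1 + t * (⟪x, w i⟫ ^ 2 / qf A (w i)) := by
      have h4 := hposB i
      rw [hq] at h4
      exact (mul_pos_iff_of_pos_left (hpos i)).1 h4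
    rw [hq, Real.log_mul (hpos i).ne' h3.ne']
    have := Real.log_le_sub_one_of_pos h3
    linarith
  rw [Finset.sum_add_distrib, ← Finset.mul_sum] at h2
  linarith

/-- The first-order condition without derivatives: divide by `t` and let `t` decrease to `0`. -/
lemma le_of_forall_small_pos {q m t0 : ℝ} (ht0 : 0 < t0) (hq : 0 ≤ q)
    (h : ∀ t, 0 < t → t < t0 → 1 - (1 + t * q)⁻¹ ≤ t * m) : q ≤ m := by
  have h1 : Tendsto (fun t : ℝ => m * (1 + t * q)) (𝓝[>] 0) (𝓝 (m * (1 + 0 * q))) := by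
    refine Tendsto.mono_left ?_ nhdsWithin_le_nhds
    exact Continuous.tendsto (by fun_prop) 0
  rw [zero_mul, add_zero, mul_one] at h1
  refine ge_of_tendsto h1 ?_
  filter_upwards [Ioo_mem_nhdsGT ht0] with t ht
  have h2 := h t ht.1 ht.2
  have h3 : 0 < 1 + t * q := by have := mul_nonneg ht.1.le hq; linarith
  have h4 : 1 - (1 + t * q)⁻¹ = t * (q / (1 + t * q)) := by field_simp; ring
  rw [h4] at h2
  have h5 := le_of_mul_le_mul_left h2 ht.1
  rwa [div_le_iff₀ h3] at h5

lemma le_of_forall_small_neg {q m t0 : ℝ} (ht0 : 0 < t0)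
    (hpos : ∀ t, 0 < t → t < t0 → 0 < 1 + -t * q)
    (h : ∀ t, 0 < t → t < t0 → 1 - (1 + -t * q)⁻¹ ≤ -t * m) : m ≤ q := by
  have h1 : Tendsto (fun t : ℝ => m * (1 + -t * q)) (𝓝[>] 0) (𝓝 (m * (1 + -0 * q))) := by
    refine Tendsto.mono_left ?_ nhdsWithin_le_nhds
    exact Continuous.tendsto (by fun_prop) 0
  rw [neg_zero, zero_mul, add_zero, mul_one] at h1
  refine le_of_tendsto h1 ?_
  filter_upwards [Ioo_mem_nhdsGT ht0] with t ht
  have h2 := h t ht.1 ht.2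
  have h3 := hpos t ht.1 ht.2
  have h4 : 1 - (1 + -t * q)⁻¹ = -(t * (q / (1 + -t * q))) := by
    have h5 := h3.ne'
    generalize hd : 1 + -t * q = d at *
    rw [mul_div_assoc', eq_comm, ← neg_div, div_eq_iff h5, sub_mul, inv_mul_cancel₀ h5]
    linarith
  rw [h4] at h2
  have h5 : m ≤ q / (1 + -t * q) := by
    refine le_of_mul_le_mul_left ?_ ht.1
    linarith
  rwa [le_div_iff₀ h3] at h5

/-- Existence of a solution of Tyler's equation for a well-spread sample. -/
theorem exists_tylerEq {w : Fin n → EuclideanSpace ℝ (Fin p)} {ε : ℝ} (hn : n ≠ 0)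
    (h : FourthMomentsClose w ε) (hw : ∀ i, ‖w i‖ = 1) (hε0 : 0 ≤ ε)
    (hε : 8 * (p + 2) * p ^ 2 * ε ≤ 1) : ∃ N, TylerEq w N := by
  have hp0 : (0 : ℝ) < p := Nat.cast_pos.2 (Nat.pos_of_ne_zero (NeZero.ne p))
  have hp1 : (1 : ℝ) ≤ p := Nat.one_le_cast.2 (Nat.pos_of_ne_zero (NeZero.ne p))
  have hw0 : ∀ i, w i ≠ 0 := fun i h0 => by have := hw i; simp [h0] at this
  -- Coercivity of the loss is bypassed. Condition number at most `2` and trace `p` define a compact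
  -- set, on which a minimiser exists; scale invariance extends its minimality to the whole cone of
  -- well-conditioned matrices. At the minimiser the constraint turns out to be slack, so
  -- stationarity holds in all rank-one directions, and this is Tyler's equation for `A⁻¹`.
  set K := {A : Matrix (Fin p) (Fin p) ℝ | A.IsSymm ∧ A.trace = p ∧ WellConditioned A}
  have hKpd : ∀ A ∈ K, A.PosDef := fun A hA =>
    posDef_of_wellConditioned hA.1 hA.2.2 (hA.2.1 ▸ hp0)
  have hcont : ContinuousOn (tylerLoss w) K := by
    unfold tylerLoss
    refine ContinuousOn.sub (ContinuousOn.mul continuousOn_const (continuousOn_const.mul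
      (continuousOn_finsetSum _ fun i _ => ContinuousOn.log (continuous_qf _).continuousOn
      fun A hA => ((posDef_iff_qf.1 (hKpd A hA)).2 _ (hw0 i)).ne'))) (ContinuousOn.log
      (Continuous.continuousOn (by fun_prop)) fun A hA => (hKpd A hA).det_pos.ne')
  have hne : K.Nonempty := by
    refine ⟨1, Matrix.isSymm_one, by simp, fun x y hx hy => ?_⟩
    rw [qf_one, qf_one, hx, hy]; norm_num
  obtain ⟨A, hAK, hmin⟩ := isCompact_wellConditioned.exists_isMinOn hne hcont
  have hA := hKpd A hAK
  -- the minimum extends to the cone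
  have hcone : ∀ B : Matrix (Fin p) (Fin p) ℝ, B.PosDef → WellConditioned B →
      tylerLoss w A ≤ tylerLoss w B := by
    intro B hB hBw
    have htr : 0 < B.trace := hB.trace_pos
    have hc : 0 < p / B.trace := div_pos hp0 htr
    rw [← tylerLoss_smul hn hw0 hB hc]
    refine hmin ⟨(posDef_iff_qf.1 hB).1.smul _, ?_, fun x y hx hy => ?_⟩
    · rw [Matrix.trace_smul, smul_eq_mul, div_mul_cancel₀ _ htr.ne']
    · rw [qf_smul, qf_smul]
      have := mul_le_mul_of_nonneg_left (hBw x y hx hy) hc.le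
      linarith
  obtain ⟨a, g, ha, hAg⟩ := exists_eq_specMat_of_posDef hA
  obtain ⟨m, hm⟩ := Finite.exists_min a
  obtain ⟨M, hM⟩ := Finite.exists_max a
  have hAinv : ∀ x, qf A⁻¹ x = ∑ j, (a j)⁻¹ * ⟪g j, x⟫ ^ 2 := fun x => by
    rw [hAg, specMat_inv (fun j => (ha j).ne'), qf_specMat]
  have hqpos : ∀ x, 0 ≤ qf A⁻¹ x := fun x => by
    rw [hAinv]; exact Finset.sum_nonneg fun j _ => mul_nonneg (inv_pos.2 (ha j)).le (sq_nonneg _)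
  have hMm : a M ≤ 2 * a m := by
    have := hAK.2.2 (g m) (g M) (g.norm_eq_one m) (g.norm_eq_one M)
    rwa [hAg, qf_basis, qf_basis] at this
  have hlow : ∀ y : EuclideanSpace ℝ (Fin p), a m * ‖y‖ ^ 2 ≤ qf A y := fun y => by
    rw [hAg, qf_specMat, ← sum_inner_sq g y, Finset.mul_sum]
    exact Finset.sum_le_sum fun j _ => mul_le_mul_of_nonneg_right (hm j) (sq_nonneg _)
  have hup : ∀ y : EuclideanSpace ℝ (Fin p), qf A y ≤ a M * ‖y‖ ^ 2 := fun y => by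
    rw [hAg, qf_specMat, ← sum_inner_sq g y, Finset.mul_sum]
    exact Finset.sum_le_sum fun j _ => mul_le_mul_of_nonneg_right (hM j) (sq_nonneg _)
  have hsymB : ∀ (t : ℝ) x, (A + t • outer x).IsSymm := fun t x =>
    (posDef_iff_qf.1 hA).1.add ((isSymm_outer x).smul t)
  have hpd : ∀ (t : ℝ) x, (∀ y, 0 < ‖y‖ → 0 < qf (A + t • outer x) y) →
      (A + t • outer x).PosDef := fun t x hq =>
    posDef_iff_qf.2 ⟨hsymB t x, fun y hy => hq y (norm_pos_iff.2 hy)⟩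
  -- the constraint is not active
  have hstrict : a M < 2 * a m := by
    by_contra hcon
    have hMeq : a M = 2 * a m := le_antisymm hMm (not_lt.1 hcon)
    -- If the condition number were exactly `2`, adding `t • outer (g m)` with `0 < t < a m` would
    -- raise the smallest eigenvalue without leaving the constraint set. The resulting one-sided
    -- condition feeds `one_sub_div_le`, which gives `1/2 ≤ 2 (p + 2) p² ε ≤ 1/4`.
    have hq : (a m)⁻¹ ≤ p * ((n : ℝ)⁻¹ * ∑ i, ⟪g m, w i⟫ ^ 2 / qf A (w i)) := by
      have hqm : qf A⁻¹ (g m) = (a m)⁻¹ := by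
        rw [hAg, specMat_inv (fun j => (ha j).ne'), qf_basis]
      rw [← hqm]
      refine le_of_forall_small_pos (ha m) (hqpos _) fun t ht0 ht1 => ?_
      have hqB : ∀ y, qf (A + t • outer (g m)) y = qf A y + t * ⟪g m, y⟫ ^ 2 := fun y => by
        rw [qf_add, qf_smul, qf_outer]
      have hB := hpd t (g m) fun y hy => by
        rw [hqB]
        have h1 := hlow y
        have h2 : 0 < a m * ‖y‖ ^ 2 := mul_pos (ha m) (by positivity)
        have h3 : 0 ≤ t * ⟪g m, y⟫ ^ 2 := mul_nonneg ht0.le (sq_nonneg _)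
        linarith
      refine log_le_of_tylerLoss_le hw0 hA hB (hcone _ hB fun x y hx hy => ?_)
      have h1 : qf (A + t • outer (g m)) y ≤ 2 * a m := by
        rw [hqB, hAg, qf_specMat]
        have h2 : t * ⟪g m, y⟫ ^ 2 = ∑ j, (if j = m then t else 0) * ⟪g j, y⟫ ^ 2 := by simp
        rw [h2, ← Finset.sum_add_distrib]
        calc _ ≤ ∑ j, 2 * a m * ⟪g j, y⟫ ^ 2 := Finset.sum_le_sum fun j _ => by
              rw [← add_mul]
              refine mul_le_mul_of_nonneg_right ?_ (sq_nonneg _)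
              split_ifs with hj
              · subst hj; linarith
              · linarith [hM j]
          _ = 2 * a m := by rw [← Finset.mul_sum, sum_inner_sq, hy]; ring
      have h3 : a m ≤ qf (A + t • outer (g m)) x := by
        rw [hqB]
        have h4 := hlow x
        rw [hx] at h4
        have h5 : 0 ≤ t * ⟪g m, x⟫ ^ 2 := mul_nonneg ht0.le (sq_nonneg _)
        linarith
      linarith
    have h1 := one_sub_div_le (g := g) (a := a) h hw (by nlinarith [mul_nonneg hp0.le hε0]) hε0 hm (ha m) (by
      rw [← hAg]
      have := mul_le_mul_of_nonneg_left hq (ha m).le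
      rwa [mul_inv_cancel₀ (ha m).ne'] at this) M
    rw [hMeq, ← div_div, mul_comm, div_right_comm, div_self (ha m).ne'] at h1
    linarith
  have hnear : ∀ x : EuclideanSpace ℝ (Fin p), ∃ t0 > 0, ∀ t : ℝ, |t| < t0 →
      (A + t • outer x).PosDef ∧ tylerLoss w A ≤ tylerLoss w (A + t • outer x) := by
    intro x
    have hx1 : 0 < 3 * (‖x‖ ^ 2 + 1) := by positivity
    -- With `σ = |t| ‖x‖²`, the perturbed eigenvalues lie between `a m - σ` and `a M + σ`; condition
    -- number at most `2` amounts to `3 σ ≤ 2 a m - a M`. The `+ 1` covers `x = 0`.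
    refine ⟨(2 * a m - a M) / (3 * (‖x‖ ^ 2 + 1)), div_pos (by linarith) hx1, fun t ht => ?_⟩
    rw [lt_div_iff₀ hx1] at ht
    have hbd : ∀ y : EuclideanSpace ℝ (Fin p), |t * ⟪x, y⟫ ^ 2| ≤ |t| * ‖x‖ ^ 2 * ‖y‖ ^ 2 := by
      intro y
      rw [abs_mul, abs_of_nonneg (sq_nonneg ⟪x, y⟫), mul_assoc]
      refine mul_le_mul_of_nonneg_left ?_ (abs_nonneg _)
      rw [← sq_abs, ← mul_pow]
      exact pow_le_pow_left₀ (abs_nonneg _) (abs_real_inner_le_norm x y) 2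
    have hs : 3 * (|t| * ‖x‖ ^ 2) ≤ 2 * a m - a M := by
      nlinarith [abs_nonneg t]
    have hqB : ∀ y, qf (A + t • outer x) y = qf A y + t * ⟪x, y⟫ ^ 2 := fun y => by
      rw [qf_add, qf_smul, qf_outer]
    have hlo : ∀ y, (a m - |t| * ‖x‖ ^ 2) * ‖y‖ ^ 2 ≤ qf (A + t • outer x) y := fun y => by
      rw [hqB]; have := (abs_le.1 (hbd y)).1; have := hlow y; linarith
    have hhi : ∀ y, qf (A + t • outer x) y ≤ (a M + |t| * ‖x‖ ^ 2) * ‖y‖ ^ 2 := fun y => by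
      rw [hqB]; have := (abs_le.1 (hbd y)).2; have := hup y; linarith
    have hB := hpd t x fun y hy => by
      refine lt_of_lt_of_le (mul_pos ?_ (by positivity)) (hlo y)
      have := ha M
      nlinarith [mul_nonneg (abs_nonneg t) (sq_nonneg ‖x‖), hm M]
    refine ⟨hB, hcone _ hB fun y z hy hz => ?_⟩
    have h1 := hlo y
    have h2 := hhi z
    rw [hy] at h1; rw [hz] at h2
    linarith
  refine ⟨A⁻¹, hA.inv, fun x => ?_⟩
  rw [Matrix.nonsing_inv_nonsing_inv _ (Matrix.isUnit_iff_isUnit_det A |>.1 hA.isUnit)]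
  obtain ⟨t0, ht0, hx⟩ := hnear x
  refine le_antisymm (le_of_forall_small_neg ht0 (fun t h1 h2 => ?_) fun t h1 h2 => ?_)
    (le_of_forall_small_pos ht0 (hqpos x) fun t h1 h2 => ?_)
  · have h3 := (hx (-t) (by rwa [abs_neg, abs_of_pos h1])).1.det_pos
    rw [det_add_smul_outer hA] at h3
    exact (mul_pos_iff_of_pos_left hA.det_pos).1 h3
  · have h3 := hx (-t) (by rwa [abs_neg, abs_of_pos h1])
    exact log_le_of_tylerLoss_le hw0 hA h3.1 h3.2
  · have h3 := hx t (by rwa [abs_of_pos h1])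
    exact log_le_of_tylerLoss_le hw0 hA h3.1 h3.2

end

/-! ### Affine equivariance and passage between the sample and the whitened sample. -/

section
variable {p n : ℕ}

lemma qf_conj (G N : Matrix (Fin p) (Fin p) ℝ) (x : EuclideanSpace ℝ (Fin p)) :
    qf (G * N * G.transpose) x = qf N (WithLp.toLp 2 (G.transpose.mulVec x.ofLp)) := by
  simp only [qf]
  rw [← Matrix.mulVec_mulVec, ← Matrix.mulVec_mulVec, Matrix.dotProduct_mulVec,
    ← Matrix.mulVec_transpose]

lemma inner_mulVec (G : Matrix (Fin p) (Fin p) ℝ) (x z : EuclideanSpace ℝ (Fin p)) :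
    ⟪x, WithLp.toLp 2 (G.mulVec z.ofLp)⟫ = ⟪WithLp.toLp 2 (G.transpose.mulVec x.ofLp), z⟫ := by
  rw [inner_eq_dotProduct, inner_eq_dotProduct, Matrix.dotProduct_mulVec, ← Matrix.mulVec_transpose]

/-- Affine equivariance of Tyler's equation. -/
lemma TylerEq.mulVec {z : Fin n → EuclideanSpace ℝ (Fin p)} {N G : Matrix (Fin p) (Fin p) ℝ}
    (h : TylerEq z N) (hG : IsUnit G.det) :
    TylerEq (fun i => WithLp.toLp 2 (G.mulVec (z i).ofLp)) (G * N * G.transpose) := by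
  have hGt : IsUnit G.transpose.det := by rwa [Matrix.det_transpose]
  have hsym := (posDef_iff_qf.1 h.1).1
  refine ⟨posDef_iff_qf.2 ⟨?_, fun x hx => ?_⟩, fun x => ?_⟩
  · rw [Matrix.IsSymm, Matrix.transpose_mul, Matrix.transpose_mul, Matrix.transpose_transpose,
      hsym.eq, Matrix.mul_assoc]
  · rw [qf_conj]
    refine (posDef_iff_qf.1 h.1).2 _ fun h0 => hx ?_
    have h1 : G.transpose.mulVec x.ofLp = 0 := by simpa using congrArg WithLp.ofLp h0
    have h2 := Matrix.eq_zero_of_mulVec_eq_zero hGt.ne_zero h1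
    simpa using h2
  · rw [qf_conj, ← h.2]
    congr 2
    refine Finset.sum_congr rfl fun i _ => ?_
    rw [inner_mulVec]
    congr 1
    have h3 : (G * N * G.transpose)⁻¹ = G⁻¹.transpose * N⁻¹ * G⁻¹.transpose.transpose := by
      rw [Matrix.mul_inv_rev, Matrix.mul_inv_rev, Matrix.transpose_transpose,
        Matrix.transpose_nonsing_inv, Matrix.mul_assoc]
    rw [h3, qf_conj]
    congr 1
    simp only [Matrix.transpose_transpose, Matrix.mulVec_mulVec, Matrix.nonsing_inv_mul _ hG,
      Matrix.one_mulVec]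

/-- Each summand is homogeneous of degree zero in its observation, so only directions matter. This
is what makes normalization after a linear map harmless. -/
lemma TylerEq.smul_sample {z z' : Fin n → EuclideanSpace ℝ (Fin p)}
    {N : Matrix (Fin p) (Fin p) ℝ} (h : TylerEq z N) {c : Fin n → ℝ} (hc : ∀ i, c i ≠ 0)
    (hz : ∀ i, z' i = c i • z i) : TylerEq z' N := by
  refine ⟨h.1, fun x => ?_⟩
  rw [← h.2]
  congr 2
  refine Finset.sum_congr rfl fun i _ => ?_
  rw [hz, inner_smul_right, qf_smul_vec, mul_pow]
  exact mul_div_mul_left _ _ (pow_ne_zero 2 (hc i))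

lemma norm_sq_invSqrt_mulVec {l : Fin p → ℝ} (hl : ∀ j, 0 < l j)
    (b : OrthonormalBasis (Fin p) ℝ (EuclideanSpace ℝ (Fin p))) (x : EuclideanSpace ℝ (Fin p)) :
    ‖WithLp.toLp 2 ((invSqrt (specMat l b)).mulVec x.ofLp)‖ ^ 2 = qf (specMat l b)⁻¹ x := by
  rw [invSqrt_specMat, ← real_inner_self_eq_norm_sq, inner_mulVec, isSymm_specMat,
    Matrix.mulVec_mulVec, specMat_mul, specMat_inv fun j => (hl j).ne', real_inner_comm,
    inner_eq_dotProduct, qf]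
  have h1 : (fun j => (√(l j))⁻¹ * (√(l j))⁻¹) = fun j => (l j)⁻¹ := by
    ext j; rw [← mul_inv, Real.mul_self_sqrt (hl j).le]
  rw [h1]

/-- Both conditions are equalities of quadratic forms. Evaluating `S_n(V) = I / p` at `V^{1/2} x`
cancels the inverse square roots, and evaluating Tyler's equation at `V^{-1/2} x` restores them. -/
lemma isTylerEstimator_iff [NeZero p] {u : Fin n → Sph p} {V : Matrix (Fin p) (Fin p) ℝ} :
    IsTylerEstimator u V ↔
      IsShape V ∧ TylerEq (fun i => (u i : EuclideanSpace ℝ (Fin p))) V := by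
  refine and_congr_right fun hV => ?_
  obtain ⟨l, b, hl, rfl⟩ := exists_eq_specMat_of_posDef hV.posDef
  have hp0 : (p : ℝ) ≠ 0 := Nat.cast_ne_zero.2 (NeZero.ne p)
  set V := specMat l b
  set B := invSqrt V
  have hB : B = specMat (fun j => (√(l j))⁻¹) b := invSqrt_specMat l b
  have hBs : B.transpose = B := by rw [hB]; exact isSymm_specMat _ _
  set R := specMat (fun j => √(l j)) b
  have hRs : R.transpose = R := isSymm_specMat _ _
  have hBR : B * R = 1 := by
    rw [hB, specMat_mul, ← specMat_one b]
    congr 1; ext j; exact inv_mul_cancel₀ (Real.sqrt_pos.2 (hl j)).ne'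
  have hRB : R * B = 1 := mul_eq_one_comm.1 hBR
  have hqS : ∀ x, qf (signCov u V) x = (n : ℝ)⁻¹ * ∑ i,
      ⟪WithLp.toLp 2 (B.mulVec x.ofLp), (u i : EuclideanSpace ℝ (Fin p))⟫ ^ 2 / qf V⁻¹ (u i) := by
    intro x
    rw [signCov, qf_smul, qf_sum]
    congr 1
    refine Finset.sum_congr rfl fun i _ => ?_
    rw [qf_smul, norm_sq_invSqrt_mulVec hl]
    have h1 := qf_conj B (outer (u i).1) x
    rw [hBs] at h1
    rw [h1, qf_outer, real_inner_comm, inv_mul_eq_div]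
  have hqR : ∀ x : EuclideanSpace ℝ (Fin p),
      ‖WithLp.toLp 2 (R.mulVec x.ofLp)‖ ^ 2 = qf V x := by
    intro x
    rw [← real_inner_self_eq_norm_sq, inner_mulVec, hRs, Matrix.mulVec_mulVec, specMat_mul,
      real_inner_comm, inner_eq_dotProduct, qf]
    have h1 : (fun j => √(l j) * √(l j)) = l := by
      ext j; exact Real.mul_self_sqrt (hl j).le
    rw [h1]
  have hSs : (signCov u V).IsSymm := by
    unfold signCov Matrix.IsSymm
    rw [Matrix.transpose_smul, Matrix.transpose_sum]
    congr 1
    refine Finset.sum_congr rfl fun i _ => ?_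
    rw [Matrix.transpose_smul, Matrix.transpose_mul, Matrix.transpose_mul, isSymm_outer,
      Matrix.mul_assoc]
    change _ • (B.transpose * (_ * B.transpose)) = _ • (B * (_ * B))
    rw [hBs]
  constructor
  · intro h
    refine ⟨hV.posDef, fun x => ?_⟩
    have h1 := hqS (WithLp.toLp 2 (R.mulVec x.ofLp))
    rw [h, qf_smul, qf_one, hqR] at h1
    simp only [Matrix.mulVec_mulVec, hBR, Matrix.one_mulVec] at h1
    rw [← h1]; field_simp
  · rintro ⟨-, h⟩
    refine eq_of_qf_eq hSs (Matrix.isSymm_one.smul _) fun x => ?_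
    rw [hqS, qf_smul, qf_one]
    have h1 := h (WithLp.toLp 2 (B.mulVec x.ofLp))
    rw [← hqR] at h1
    simp only [Matrix.mulVec_mulVec, hRB, Matrix.one_mulVec] at h1
    change p * _ = ‖x‖ ^ 2 at h1
    rw [← h1]; field_simp

/-- The matrix of `sqrtMap l b`. -/
def sqrtMat (l : Fin p → ℝ) (b : OrthonormalBasis (Fin p) ℝ (EuclideanSpace ℝ (Fin p))) :
    Matrix (Fin p) (Fin p) ℝ :=
  Matrix.of fun i k => √(l k) * b k i

lemma sqrtMat_mulVec (l : Fin p → ℝ)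
    (b : OrthonormalBasis (Fin p) ℝ (EuclideanSpace ℝ (Fin p))) (z : EuclideanSpace ℝ (Fin p)) :
    WithLp.toLp 2 ((sqrtMat l b).mulVec z.ofLp) = sqrtMap l b z := by
  ext i
  simp [sqrtMat, sqrtMap, Matrix.mulVec, dotProduct]
  exact Finset.sum_congr rfl fun k _ => by ring

lemma sqrtMat_transpose_mulVec (l : Fin p → ℝ)
    (b : OrthonormalBasis (Fin p) ℝ (EuclideanSpace ℝ (Fin p))) (x : EuclideanSpace ℝ (Fin p)) :
    (sqrtMat l b).transpose.mulVec x.ofLp = fun k => √(l k) * ⟪b k, x⟫ := by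
  ext k
  simp only [sqrtMat, Matrix.mulVec, dotProduct, Matrix.transpose_apply, Matrix.of_apply,
    inner_eq_dotProduct, Finset.mul_sum]
  exact Finset.sum_congr rfl fun k _ => by ring

lemma isUnit_det_sqrtMat {l : Fin p → ℝ} (hl : ∀ k, 0 < l k)
    (b : OrthonormalBasis (Fin p) ℝ (EuclideanSpace ℝ (Fin p))) : IsUnit (sqrtMat l b).det := by
  rw [isUnit_iff_ne_zero]
  intro h0
  obtain ⟨v, hv, hv0⟩ := Matrix.exists_mulVec_eq_zero_iff.2 h0
  have h1 := sqrtMat_mulVec l b (WithLp.toLp 2 v)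
  rw [hv0] at h1
  have h2 := sqrtMapInv_sqrtMap hl b (WithLp.toLp 2 v)
  rw [← h1] at h2
  apply hv
  have h3 := congrArg WithLp.ofLp h2
  simpa using h3.symm

lemma sqrtMat_inv_mulVec {l : Fin p → ℝ} (hl : ∀ k, 0 < l k)
    (b : OrthonormalBasis (Fin p) ℝ (EuclideanSpace ℝ (Fin p))) (x : EuclideanSpace ℝ (Fin p)) :
    WithLp.toLp 2 ((sqrtMat l b)⁻¹.mulVec x.ofLp) = sqrtMapInv l b x := by
  conv_lhs => rw [← sqrtMap_sqrtMapInv hl b x, ← sqrtMat_mulVec]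
  simp only [Matrix.mulVec_mulVec, Matrix.nonsing_inv_mul _ (isUnit_det_sqrtMat hl b),
    Matrix.one_mulVec]

variable [NeZero p]

lemma sqrtMapInv_ne_zero {l : Fin p → ℝ} (hl : ∀ k, 0 < l k)
    (b : OrthonormalBasis (Fin p) ℝ (EuclideanSpace ℝ (Fin p))) (u : Sph p) :
    sqrtMapInv l b u ≠ 0 := by
  intro h0
  have h1 := sqrtMap_sqrtMapInv hl b u
  rw [h0, map_zero] at h1
  have h : ‖(u : EuclideanSpace ℝ (Fin p))‖ = 1 := norm_eq_of_mem_sphere u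
  rw [← h1] at h; simp at h

/-- The whitened sample. -/
def whiten (l : Fin p → ℝ) (b : OrthonormalBasis (Fin p) ℝ (EuclideanSpace ℝ (Fin p)))
    (u : Sph p) : Sph p :=
  nrm (sqrtMapInv l b u)

lemma exists_eq_smul_sqrtMap_whiten {l : Fin p → ℝ} (hl : ∀ k, 0 < l k)
    (b : OrthonormalBasis (Fin p) ℝ (EuclideanSpace ℝ (Fin p))) (u : Sph p) :
    ∃ c : ℝ, 0 < c ∧ (u : EuclideanSpace ℝ (Fin p)) = c • sqrtMap l b (whiten l b u) := by
  have h := sqrtMapInv_ne_zero hl b u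
  have hn : 0 < ‖sqrtMapInv l b u‖ := norm_pos_iff.2 h
  refine ⟨‖sqrtMapInv l b u‖, hn, ?_⟩
  rw [whiten, nrm_coe h, map_smul, sqrtMap_sqrtMapInv hl, smul_smul, mul_inv_cancel₀ hn.ne',
    one_smul]

lemma exists_isTylerEstimator_of_whiten {l : Fin p → ℝ} (hl : ∀ k, 0 < l k)
    (b : OrthonormalBasis (Fin p) ℝ (EuclideanSpace ℝ (Fin p))) {u : Fin n → Sph p}
    {N : Matrix (Fin p) (Fin p) ℝ}
    (h : TylerEq (fun i => (whiten l b (u i) : EuclideanSpace ℝ (Fin p))) N) :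
    ∃ V, IsTylerEstimator u V := by
  have hp0 : (0 : ℝ) < p := Nat.cast_pos.2 (Nat.pos_of_ne_zero (NeZero.ne p))
  choose c hc hu using fun i => exists_eq_smul_sqrtMap_whiten hl b (u i)
  have h1 := (h.mulVec (isUnit_det_sqrtMat hl b)).smul_sample
    (z' := fun i => (u i : EuclideanSpace ℝ (Fin p))) (fun i => (hc i).ne')
    (fun i => by rw [sqrtMat_mulVec]; exact hu i)
  have htr := h1.1.trace_pos
  have h2 := h1.smul (div_pos hp0 htr)
  exact ⟨_, isTylerEstimator_iff.2 ⟨⟨h2.1, by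
    rw [Matrix.trace_smul, smul_eq_mul, div_mul_cancel₀ _ htr.ne']⟩, h2⟩⟩

/-- With `G = sqrtMat l b` the matrix is `N = G⁻¹ V (G⁻¹)'`, so `qf V x = qf N (G' x)`. Because `‖G'
x‖²` is the form of the true shape, a comparison of `N` with the identity becomes a relative
comparison of `V` with the true shape, at no cost in conditioning. -/
lemma exists_tylerEq_of_isTylerEstimator {l : Fin p → ℝ} (hl : ∀ k, 0 < l k)
    (b : OrthonormalBasis (Fin p) ℝ (EuclideanSpace ℝ (Fin p))) {u : Fin n → Sph p}
    {V : Matrix (Fin p) (Fin p) ℝ} (h : IsTylerEstimator u V) :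
    ∃ N, TylerEq (fun i => (whiten l b (u i) : EuclideanSpace ℝ (Fin p))) N ∧
      ∀ x, qf V x = qf N (WithLp.toLp 2 fun k => √(l k) * ⟪b k, x⟫) := by
  have hG := isUnit_det_sqrtMat hl b
  have hGi : IsUnit (sqrtMat l b)⁻¹.det := (Matrix.isUnit_nonsing_inv_det_iff).2 hG
  refine ⟨(sqrtMat l b)⁻¹ * V * (sqrtMat l b)⁻¹.transpose,
    ((isTylerEstimator_iff.1 h).2.mulVec hGi).smul_sample
      (c := fun i => ‖sqrtMapInv l b (u i)‖⁻¹)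
      (fun i => inv_ne_zero (norm_ne_zero_iff.2 (sqrtMapInv_ne_zero hl b (u i)))) fun i => ?_,
    fun x => ?_⟩
  · rw [sqrtMat_inv_mulVec hl, whiten, nrm_coe (sqrtMapInv_ne_zero hl b _)]
  · rw [← sqrtMat_transpose_mulVec, qf_conj]
    simp only [Matrix.mulVec_mulVec, ← Matrix.transpose_mul, Matrix.mul_nonsing_inv _ hG,
      Matrix.transpose_one, Matrix.one_mulVec]

end

/-! ### Relative perturbation bound for the Gram-Schmidt correction. -/

section
variable {p : ℕ} [NeZero p]

/-- Decrements of a sequence, with the convention that it vanishes beyond the last index. -/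
def decr (m : Fin p → ℝ) (j : Fin p) : ℝ :=
  m j - if h : (j : ℕ) + 1 < p then m ⟨j + 1, h⟩ else 0

lemma sum_Ici_decr (m : Fin p → ℝ) (k : Fin p) : ∑ j ∈ Finset.Ici k, decr m j = m k := by
  set M : ℕ → ℝ := fun i => if h : i < p then m ⟨i, h⟩ else 0
  have h1 : ∀ j : Fin p, decr m j = M j - M (j + 1) := fun j => by
    simp [decr, M, j.2]
  have h2 : ∀ d : ℕ, ∀ k : Fin p, (k : ℕ) + d + 1 = p → ∑ j ∈ Finset.Ici k, decr m j = m k := by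
    intro d
    induction d with
    | zero =>
      intro k hk
      have : Finset.Ici k = {k} := by
        ext j; simp only [Finset.mem_Ici, Finset.mem_singleton, Fin.le_def, Fin.ext_iff]; omega
      rw [this, Finset.sum_singleton, decr, dif_neg (by omega), sub_zero]
    | succ d ih =>
      intro k hk
      have hk1 : (k : ℕ) + 1 < p := by omega
      have : Finset.Ici k = insert k (Finset.Ici ⟨k + 1, hk1⟩) := by
        ext j
        simp only [Finset.mem_Ici, Finset.mem_insert, Fin.le_def, Fin.ext_iff]; omega
      rw [this, Finset.sum_insert (by simp [Fin.le_def]), ih ⟨k + 1, hk1⟩ (by simp; omega), decr,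
        dif_pos hk1]
      ring
  exact h2 (p - 1 - k) k (by have := k.2; omega)

/-- Summation by parts. -/
lemma sum_mul_eq_sum_decr (m a : Fin p → ℝ) :
    ∑ k, m k * a k = ∑ j, decr m j * ∑ k ∈ Finset.Iic j, a k := by
  simp_rw [← sum_Ici_decr m, Finset.sum_mul, Finset.mul_sum]
  refine Finset.sum_comm' fun x y => ?_
  simp

lemma decr_nonneg {m : Fin p → ℝ} (hm : Antitone m) (h0 : ∀ j, 0 ≤ m j) (j : Fin p) :
    0 ≤ decr m j := by
  rw [decr]
  split_ifs with h
  · exact sub_nonneg.2 (hm (by simp [Fin.le_def]))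
  · simpa using h0 j

lemma decr_le {m : Fin p → ℝ} (hm : Antitone m) (h0 : ∀ j, 0 ≤ m j) (j : Fin p) :
    decr m j ≤ m 0 := by
  rw [decr]
  have h1 : m j ≤ m 0 := hm (Fin.zero_le j)
  split_ifs with h
  · linarith [h0 ⟨j + 1, h⟩]
  · linarith

/-- In the summation by parts, the decrement at `j` multiplies overlaps with later indices `k`; this
bound replaces it by the gap between the leading eigenvalue and the one at `k`. -/
lemma decr_le_sub {m : Fin p → ℝ} (hm : Antitone m) {j k : Fin p} (hjk : j < k) :
    decr m j ≤ m 0 - m k := by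
  have h : (j : ℕ) + 1 < p := by have := k.2; have := Fin.lt_def.1 hjk; omega
  rw [decr, dif_pos h]
  have h1 : m j ≤ m 0 := hm (Fin.zero_le j)
  have h2 : m k ≤ m ⟨j + 1, h⟩ := hm (by rw [Fin.le_def]; exact hjk)
  linarith

variable {θ₀ : EuclideanSpace ℝ (Fin p)}
  {bh : OrthonormalBasis (Fin p) ℝ (EuclideanSpace ℝ (Fin p))}

/-- Pairing a relation with `bh 0` isolates the coefficient of `θ₀`; pairing with `bh i` then gives
the others. A nonzero overlap is thus what prevents vectors from vanishing in the
orthonormalization. -/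
lemma linearIndependent_update (hc : ⟪bh 0, θ₀⟫ ≠ 0) :
    LinearIndependent ℝ (Function.update (fun j => bh j) 0 θ₀) := by
  rw [Fintype.linearIndependent_iff]
  intro a ha
  have hsplit : a 0 • θ₀ + ∑ j ∈ Finset.univ.erase 0, a j • bh j = 0 := by
    have h := Finset.add_sum_erase Finset.univ
      (fun i => a i • Function.update (fun j => bh j) 0 θ₀ i) (Finset.mem_univ 0)
    rw [← ha, ← h, Function.update_self]
    congr 1
    exact Finset.sum_congr rfl fun j hj => by
      rw [Function.update_of_ne (Finset.ne_of_mem_erase hj)]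
  have h0 : a 0 = 0 := by
    have := congrArg (fun v => ⟪bh 0, v⟫) hsplit
    simp only [inner_add_right, inner_smul_right, inner_sum, inner_zero_right] at this
    rw [Finset.sum_eq_zero, add_zero] at this
    · exact (mul_eq_zero.1 this).resolve_right hc
    · intro j hj
      rw [bh.inner_eq_ite, if_neg (Finset.ne_of_mem_erase hj).symm, mul_zero]
  intro i
  by_cases hi : i = 0
  · rw [hi, h0]
  have := congrArg (fun v => ⟪bh i, v⟫) hsplit
  simp only [h0, zero_smul, zero_add, inner_smul_right, inner_sum, inner_zero_right,
    bh.inner_eq_ite] at this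
  rw [Finset.sum_eq_single i] at this
  · simpa using this
  · intro j _ hj; simp [Ne.symm hj]
  · intro h; exact absurd (Finset.mem_erase.2 ⟨hi, Finset.mem_univ _⟩) h

lemma exists_basis_nullEigenvectors (hθ : ‖θ₀‖ = 1) (hc : ⟪bh 0, θ₀⟫ ≠ 0) :
    ∃ t : OrthonormalBasis (Fin p) ℝ (EuclideanSpace ℝ (Fin p)),
      (∀ j, t j = nullEigenvectors θ₀ bh j) ∧ t 0 = θ₀ := by
  have hli := linearIndependent_update hc
  set f := Function.update (fun j => bh j) 0 θ₀
  have hcard : Module.finrank ℝ (EuclideanSpace ℝ (Fin p)) = Fintype.card (Fin p) := by simp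
  have h1 : ∀ j, InnerProductSpace.gramSchmidtOrthonormalBasis hcard f j =
      nullEigenvectors θ₀ bh j := fun j =>
    InnerProductSpace.gramSchmidtOrthonormalBasis_apply hcard (by
      intro h0
      have := InnerProductSpace.gramSchmidtNormed_unit_length (𝕜 := ℝ) j hli
      rw [h0] at this; simp at this)
  refine ⟨_, h1, ?_⟩
  rw [h1, nullEigenvectors, InnerProductSpace.gramSchmidtNormed]
  have : InnerProductSpace.gramSchmidt ℝ f 0 = θ₀ := by
    rw [InnerProductSpace.gramSchmidt_def, Finset.sum_eq_zero]
    · simp [f]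
    · intro i hi; exact absurd (Finset.mem_Iio.1 hi) (not_lt.2 (Fin.zero_le i))
  rw [this, hθ]; simp

/-- Squared norm of the projection on the first vectors of the Gram-Schmidt basis. -/
lemma sum_Iic_inner_nullEigenvectors
    {t : OrthonormalBasis (Fin p) ℝ (EuclideanSpace ℝ (Fin p))}
    (ht : ∀ j, t j = nullEigenvectors θ₀ bh j) (hθ : ‖θ₀‖ = 1)
    {y : EuclideanSpace ℝ (Fin p)} (hy : ⟪θ₀, y⟫ = 0) (j : Fin p)
    (hs : ∑ k ∈ Finset.Ioc 0 j, ⟪bh k, θ₀⟫ ^ 2 ≠ 1) :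
    ∑ k ∈ Finset.Iic j, ⟪t k, y⟫ ^ 2 = ∑ k ∈ Finset.Ioc 0 j, ⟪bh k, y⟫ ^ 2 +
      (∑ k ∈ Finset.Ioc 0 j, ⟪bh k, θ₀⟫ * ⟪bh k, y⟫) ^ 2 /
        (1 - ∑ k ∈ Finset.Ioc 0 j, ⟪bh k, θ₀⟫ ^ 2) := by
  set f := Function.update (fun j => bh j) 0 θ₀
  set s := ∑ k ∈ Finset.Ioc 0 j, ⟪bh k, θ₀⟫ ^ 2
  set G := ∑ k ∈ Finset.Ioc 0 j, ⟪bh k, θ₀⟫ * ⟪bh k, y⟫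
  have hs' : 1 - s ≠ 0 := sub_ne_zero.2 (Ne.symm hs)
  -- The Gram-Schmidt vectors are complicated, but the spans of their initial segments are not: `W`
  -- is spanned by `θ₀` and `bh 1, …, bh j`. The projection of `y` on `W` is written in both systems
  -- and the two squared norms are equated.
  set W := Submodule.span ℝ (f '' Set.Iic j)
  have hW : W = Submodule.span ℝ ((fun k => t k) '' Set.Iic j) := by
    have : (fun k => t k) = InnerProductSpace.gramSchmidtNormed ℝ f := funext ht
    rw [this, InnerProductSpace.span_gramSchmidtNormed, InnerProductSpace.span_gramSchmidt_Iic]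
  set γ := θ₀ - ∑ k ∈ Finset.Ioc 0 j, ⟪bh k, θ₀⟫ • bh k
  -- `γ` is the part of `θ₀` orthogonal to `bh 1, …, bh j`, with `‖γ‖² = 1 - s`. Since `y` is
  -- orthogonal to `θ₀`, `⟪γ, y⟫ = -G`, so the second summand is the projection of `y` on `γ`.
  set v := ∑ k ∈ Finset.Ioc 0 j, ⟪bh k, y⟫ • bh k + (-G / (1 - s)) • γ
  set v' := ∑ k ∈ Finset.Iic j, ⟪t k, y⟫ • t k
  have hbf : ∀ k ∈ Finset.Ioc 0 j, bh k ∈ W := fun k hk => by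
    rw [Finset.mem_Ioc] at hk
    refine Submodule.subset_span ⟨k, hk.2, ?_⟩
    simp only [f]; rw [Function.update_of_ne hk.1.ne']
  have hθW : θ₀ ∈ W := Submodule.subset_span ⟨0, Set.mem_Iic.2 (Fin.zero_le j), by simp [f]⟩
  have hγW : γ ∈ W := W.sub_mem hθW (W.sum_mem fun k hk => W.smul_mem _ (hbf k hk))
  have hvW : v ∈ W := W.add_mem (W.sum_mem fun k hk => W.smul_mem _ (hbf k hk)) (W.smul_mem _ hγW)
  have hv'W : v' ∈ W := by
    rw [hW]
    exact Submodule.sum_mem _ fun k hk => Submodule.smul_mem _ _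
      (Submodule.subset_span ⟨k, Finset.mem_Iic.1 hk, rfl⟩)
  have hsumb : ∀ (a : Fin p → ℝ) (k : Fin p), k ∈ Finset.Ioc 0 j →
      ⟪bh k, ∑ i ∈ Finset.Ioc 0 j, a i • bh i⟫ = a k := by
    intro a k hk
    rw [inner_sum, Finset.sum_eq_single k]
    · simp [inner_smul_right]
    · intro i _ hi; rw [inner_smul_right, bh.inner_eq_ite, if_neg (Ne.symm hi), mul_zero]
    · intro h; exact absurd hk h
  have hθγ : ⟪θ₀, γ⟫ = 1 - s := by
    simp only [γ, inner_sub_right, inner_sum, inner_smul_right]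
    rw [real_inner_self_eq_norm_sq, hθ, one_pow]
    congr 1
    refine Finset.sum_congr rfl fun k _ => ?_
    rw [real_inner_comm (bh k) θ₀, sq]
  have horth : ∀ z ∈ W, ⟪z, y - v⟫ = 0 := by
    intro z hz
    induction hz using Submodule.span_induction with
    | mem z hz =>
      obtain ⟨k, hk, rfl⟩ := hz
      by_cases hk0 : k = 0
      · subst hk0
        simp only [f, Function.update_self, v, inner_sub_right, inner_add_right, inner_smul_right,
          hθγ, hy, inner_sum]
        rw [div_mul_cancel₀ _ hs']
        have : ∑ k ∈ Finset.Ioc 0 j, ⟪bh k, y⟫ * ⟪θ₀, bh k⟫ = G :=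
          Finset.sum_congr rfl fun k _ => by rw [real_inner_comm (bh k) θ₀, mul_comm]
        rw [this]; ring
      · have hk' : k ∈ Finset.Ioc 0 j := Finset.mem_Ioc.2 ⟨Fin.pos_iff_ne_zero.2 hk0, hk⟩
        simp only [f]
        rw [Function.update_of_ne hk0]
        simp only [v, γ, inner_sub_right, inner_add_right, inner_smul_right]
        rw [hsumb _ k hk', hsumb _ k hk']
        ring
    | zero => simp
    | add a b _ _ ha hb => rw [inner_add_left, ha, hb, add_zero]
    | smul c a _ ha => rw [inner_smul_left, ha, mul_zero]
  have horth' : ∀ z ∈ W, ⟪z, y - v'⟫ = 0 := by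
    intro z hz
    rw [hW] at hz
    induction hz using Submodule.span_induction with
    | mem z hz =>
      obtain ⟨k, hk, rfl⟩ := hz
      simp only [v', inner_sub_right, inner_sum, inner_smul_right, t.inner_eq_ite]
      rw [Finset.sum_eq_single k]
      · simp
      · intro i _ hi; rw [if_neg (Ne.symm hi), mul_zero]
      · intro h; exact absurd (Finset.mem_Iic.2 hk) h
    | zero => simp
    | add a b _ _ ha hb => rw [inner_add_left, ha, hb, add_zero]
    | smul c a _ ha => rw [inner_smul_left, ha, mul_zero]
  have heq : v' = v := by
    have hd : v' - v ∈ W := W.sub_mem hv'W hvW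
    have h1 : ⟪v' - v, v' - v⟫ = 0 := by
      have : v' - v = (y - v) - (y - v') := by abel
      nth_rewrite 2 [this]
      rw [inner_sub_right, horth _ hd, horth' _ hd, sub_zero]
    exact sub_eq_zero.1 (inner_self_eq_zero.1 h1)
  have h1 : ⟪v', y⟫ = ∑ k ∈ Finset.Iic j, ⟪t k, y⟫ ^ 2 := by
    simp only [v', sum_inner, inner_smul_left]
    exact Finset.sum_congr rfl fun k _ => by simp [sq]
  have hγy : ⟪γ, y⟫ = -G := by
    simp only [γ, inner_sub_left, hy, sum_inner, inner_smul_left]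
    simp [G]
  rw [← h1, heq]
  simp only [v, inner_add_left, sum_inner, inner_smul_left, hγy]
  congr 1
  · exact Finset.sum_congr rfl fun k _ => by simp [sq]
  · simp; ring

/-- Here `D` is the gap `m 0 - m k`, `m` stands for `m k` and `c` is the overlap. If `D ≤ m`, the
hypothesis and `c² ≤ 1` give `(D c²)² ≤ 8 ε² m²`. If `D > m`, then `D + m ≤ 2 D`, and dividing by
`D` gives `D c² ≤ 8 ε² m ≤ 4 ε m`. The bound is relative to the smaller eigenvalue. -/
lemma gap_mul_sq_le {D c m ε : ℝ} (hm : 0 ≤ m) (hc : c ^ 2 ≤ 1) (hε0 : 0 ≤ ε)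
    (hε : ε ≤ 1 / 2) (h : D ^ 2 * c ^ 2 ≤ 4 * ε ^ 2 * m * (D + m)) : D * c ^ 2 ≤ 4 * ε * m := by
  have hεm : 0 ≤ ε * m := mul_nonneg hε0 hm
  rcases le_or_gt D m with hDm | hDm
  · have h1 : (D * c ^ 2) ^ 2 ≤ (4 * ε * m) ^ 2 := by
      have h2 : (D * c ^ 2) ^ 2 ≤ D ^ 2 * c ^ 2 := by
        have : (D * c ^ 2) ^ 2 = D ^ 2 * c ^ 2 * c ^ 2 := by ring
        rw [this]; exact mul_le_of_le_one_right (by positivity) hc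
      have h3 : 4 * ε ^ 2 * m * (D + m) ≤ 4 * ε ^ 2 * m * (m + m) :=
        mul_le_mul_of_nonneg_left (by linarith) (by positivity)
      nlinarith [sq_nonneg (ε * m)]
    exact (le_abs_self _).trans (abs_le_of_sq_le_sq h1 (by linarith))
  · have hD' : 0 < D := hm.trans_lt hDm
    have h1 : D * (D * c ^ 2) ≤ D * (8 * ε ^ 2 * m) := by
      have h3 : 4 * ε ^ 2 * m * (D + m) ≤ 4 * ε ^ 2 * m * (D + D) :=
        mul_le_mul_of_nonneg_left (by linarith) (by positivity)
      nlinarith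
    have h2 := le_of_mul_le_mul_left h1 hD'
    nlinarith

set_option maxHeartbeats 1000000 in
/-- Relative perturbation bound for the Gram-Schmidt-corrected spectral decomposition. -/
theorem nullEigenvectors_perturbation
    {b : OrthonormalBasis (Fin p) ℝ (EuclideanSpace ℝ (Fin p))} {l m : Fin p → ℝ} {ε δ : ℝ}
    (hl : ∀ k, 0 < l k) (hl0 : ∀ k, l k ≤ l 0) (hm : Antitone m) (hε0 : 0 ≤ ε) (hε : ε ≤ 1 / 2)
    (hlow : ∀ x, (1 - ε) * ∑ k, l k * ⟪b k, x⟫ ^ 2 ≤ ∑ k, m k * ⟪bh k, x⟫ ^ 2)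
    (hup : ∀ x, ∑ k, m k * ⟪bh k, x⟫ ^ 2 ≤ ∑ k, l k * ⟪b k, x⟫ ^ 2)
    (hδ0 : 0 < δ) (hδ : δ ≤ |⟪bh 0, b 0⟫|) :
    ∃ t : OrthonormalBasis (Fin p) ℝ (EuclideanSpace ℝ (Fin p)),
      (∀ j, t j = nullEigenvectors (b 0) bh j) ∧ t 0 = b 0 ∧ (∀ j, 0 < m j) ∧
      ∀ y, |∑ k, m k * ⟪t k, y⟫ ^ 2 - ∑ k, l k * ⟪b k, y⟫ ^ 2| ≤
        13 * p ^ 2 * √ε / δ ^ 2 * ∑ k, l k * ⟪b k, y⟫ ^ 2 := by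
  have hp0 : (0 : ℝ) < p := Nat.cast_pos.2 (Nat.pos_of_ne_zero (NeZero.ne p))
  have hp1 : (1 : ℝ) ≤ p := Nat.one_le_cast.2 (Nat.pos_of_ne_zero (NeZero.ne p))
  have hθ : ‖b 0‖ = 1 := b.norm_eq_one 0
  have hc0 : ⟪bh 0, b 0⟫ ≠ 0 := by
    intro h0; rw [h0, abs_zero] at hδ; linarith
  obtain ⟨t, ht, ht0⟩ := exists_basis_nullEigenvectors hθ hc0
  set c : Fin p → ℝ := fun k => ⟪bh k, b 0⟫
  have hcsum : ∑ k, c k ^ 2 = 1 := by rw [sum_inner_sq bh (b 0), hθ, one_pow]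
  have hc1 : ∀ k, c k ^ 2 ≤ 1 := fun k => by
    rw [← hcsum]; exact Finset.single_le_sum (f := fun k => c k ^ 2) (fun _ _ => sq_nonneg _)
      (Finset.mem_univ k)
  set q0 : EuclideanSpace ℝ (Fin p) → ℝ := fun x => ∑ k, l k * ⟪b k, x⟫ ^ 2
  set qh : EuclideanSpace ℝ (Fin p) → ℝ := fun x => ∑ k, m k * ⟪bh k, x⟫ ^ 2
  have hq0nn : ∀ x, 0 ≤ q0 x := fun x =>
    Finset.sum_nonneg fun k _ => mul_nonneg (hl k).le (sq_nonneg _)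
  have hqhb : ∀ k, qh (bh k) = m k := fun k => by
    have := qf_basis m bh k; rwa [qf_specMat] at this
  have hq0b : ∀ k, q0 (b k) = l k := fun k => by
    have := qf_basis l b k; rwa [qf_specMat] at this
  have hq0pos : ∀ k, 0 < q0 (bh k) := fun k => by
    have := (posDef_iff_qf.1 (specMat_posDef hl b)).2 (bh k) (by
      intro h0; have := bh.norm_eq_one k; rw [h0] at this; simp at this)
    rwa [qf_specMat] at this
  have hmpos : ∀ k, 0 < m k := fun k => by
    have := hlow (bh k)
    rw [← hqhb k]
    refine lt_of_lt_of_le (mul_pos (by linarith) (hq0pos k)) this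
  have hm0 : ∀ k, 0 ≤ m k := fun k => (hmpos k).le
  have hml0 : m 0 ≤ l 0 := by
    rw [← hqhb 0]
    refine (hup _).trans ?_
    calc _ ≤ ∑ k, l 0 * ⟪b k, bh 0⟫ ^ 2 :=
          Finset.sum_le_sum fun k _ => mul_le_mul_of_nonneg_right (hl0 k) (sq_nonneg _)
      _ = l 0 := by rw [← Finset.mul_sum, sum_inner_sq, bh.norm_eq_one]; ring
  have hlm0 : l 0 ≤ 2 * m 0 := by
    have h1 := hlow (b 0)
    have h2 : ∑ k, m k * ⟪bh k, b 0⟫ ^ 2 ≤ m 0 := by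
      calc _ ≤ ∑ k, m 0 * ⟪bh k, b 0⟫ ^ 2 :=
            Finset.sum_le_sum fun k _ =>
              mul_le_mul_of_nonneg_right (hm (Fin.zero_le k)) (sq_nonneg _)
        _ = m 0 := by rw [← Finset.mul_sum, sum_inner_sq, b.norm_eq_one]; ring
    have h3 : (1 - ε) * l 0 ≤ m 0 := by
      have := h1.trans h2
      rwa [show ∑ k, l k * ⟪b k, b 0⟫ ^ 2 = l 0 from hq0b 0] at this
    nlinarith [hl 0]
  -- the eigenvectors of the small eigenvalues are nearly orthogonal to `b 0`
  have hkey : ∀ k, (m 0 - m k) * c k ^ 2 ≤ 4 * ε * m k := by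
    intro k
    refine gap_mul_sq_le (hm0 k) (hc1 k) hε0 hε ?_
    -- The difference of the two forms is nonnegative, so Cauchy-Schwarz holds for it, here as a
    -- discriminant along `τ • bh k + b 0`. Each vector is an eigenvector of one of the forms, hence
    -- the cross coefficient is `(l 0 - m k) * c k`. The diagonal terms are at most `2 ε m k` and `2
    -- ε m 0`.
    have hdisc := discrim_le_zero (a := q0 (bh k) - qh (bh k)) (b := 2 * ((l 0 - m k) * c k))
      (c := q0 (b 0) - qh (b 0)) (fun τ => by
        have h1 := hup (τ • bh k + b 0)
        have h2 : ∑ i, l i * ⟪b i, τ • bh k + b 0⟫ ^ 2 =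
            q0 (bh k) * (τ * τ) + 2 * (l 0 * c k) * τ + q0 (b 0) := by
          have h3 : ∀ i, l i * ⟪b i, τ • bh k + b 0⟫ ^ 2 = l i * ⟪b i, bh k⟫ ^ 2 * (τ * τ) +
              (l i * ⟪b i, bh k⟫ * ⟪b i, b 0⟫) * (2 * τ) + l i * ⟪b i, b 0⟫ ^ 2 := fun i => by
            rw [inner_add_right, inner_smul_right]; ring
          simp_rw [h3, Finset.sum_add_distrib, ← Finset.sum_mul]
          have h4 : ∑ i, l i * ⟪b i, bh k⟫ * ⟪b i, b 0⟫ = l 0 * c k := by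
            rw [Finset.sum_eq_single 0]
            · rw [real_inner_comm]; simp [c]
            · intro i _ hi; rw [b.inner_eq_ite, if_neg hi, mul_zero]
            · simp
          rw [h4]; simp only [q0]; ring
        have h5 : ∑ i, m i * ⟪bh i, τ • bh k + b 0⟫ ^ 2 =
            qh (bh k) * (τ * τ) + 2 * (m k * c k) * τ + qh (b 0) := by
          have h3 : ∀ i, m i * ⟪bh i, τ • bh k + b 0⟫ ^ 2 = m i * ⟪bh i, bh k⟫ ^ 2 * (τ * τ) +
              (m i * ⟪bh i, bh k⟫ * ⟪bh i, b 0⟫) * (2 * τ) + m i * ⟪bh i, b 0⟫ ^ 2 := fun i => by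
            rw [inner_add_right, inner_smul_right]; ring
          simp_rw [h3, Finset.sum_add_distrib, ← Finset.sum_mul]
          have h4 : ∑ i, m i * ⟪bh i, bh k⟫ * ⟪bh i, b 0⟫ = m k * c k := by
            rw [Finset.sum_eq_single k]
            · simp [c]
            · intro i _ hi; rw [bh.inner_eq_ite, if_neg hi]; ring
            · simp
          rw [h4]; simp only [qh]; ring
        rw [h2, h5] at h1
        linarith)
    rw [discrim] at hdisc
    have hA : q0 (bh k) - qh (bh k) ≤ 2 * ε * m k := by
      have h1 : (1 - ε) * q0 (bh k) ≤ m k := (hlow (bh k)).trans_eq (hqhb k)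
      have h2 : q0 (bh k) ≤ 2 * m k := by nlinarith [hq0nn (bh k)]
      rw [hqhb]
      nlinarith
    have hA0 : 0 ≤ q0 (bh k) - qh (bh k) := sub_nonneg.2 (hup _)
    have hB : q0 (b 0) - qh (b 0) ≤ ε * (2 * m 0) := by
      have h1 : (1 - ε) * q0 (b 0) ≤ qh (b 0) := hlow (b 0)
      rw [hq0b] at h1 ⊢
      nlinarith
    have hAB := mul_le_mul hA hB (sub_nonneg.2 (hup _)) (by have := hm0 k; positivity)
    have hgap : (m 0 - m k) ^ 2 ≤ (l 0 - m k) ^ 2 :=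
      pow_le_pow_left₀ (sub_nonneg.2 (hm (Fin.zero_le k))) (by linarith) 2
    have h7 := mul_le_mul_of_nonneg_right hgap (sq_nonneg (c k))
    have h8 : (m 0 - m k) ^ 2 * c k ^ 2 ≤ 2 * ε * m k * (ε * (2 * m 0)) := by linarith
    exact h8.trans (le_of_eq (by ring))
  -- comparison with the empirical quadratic form, on the orthogonal complement of `b 0`
  have hperp : ∀ y, ⟪b 0, y⟫ = 0 →
      |∑ k, m k * ⟪t k, y⟫ ^ 2 - qh y| ≤ 12 * p ^ 2 * √ε / δ ^ 2 * qh y := by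
    intro y hy
    set yy : Fin p → ℝ := fun k => ⟪bh k, y⟫
    set B := qh y
    have hB0 : 0 ≤ B := Finset.sum_nonneg fun k _ => mul_nonneg (hm0 k) (sq_nonneg _)
    have hBk : ∀ k, m k * yy k ^ 2 ≤ B := fun k =>
      Finset.single_le_sum (f := fun k => m k * yy k ^ 2)
        (fun k _ => mul_nonneg (hm0 k) (sq_nonneg _)) (Finset.mem_univ k)
    have hcy : ∑ k, c k * yy k = 0 := by
      rw [← hy, ← bh.sum_inner_mul_inner (b 0) y]
      exact Finset.sum_congr rfl fun k _ => by simp only [c, yy]; rw [real_inner_comm]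
    have hsplit : ∀ (a : Fin p → ℝ) (j : Fin p),
        ∑ k, a k = a 0 + ∑ k ∈ Finset.Ioc 0 j, a k + ∑ k ∈ Finset.Ioi j, a k := by
      intro a j
      have hun : (Finset.univ : Finset (Fin p)) = insert 0 (Finset.Ioc 0 j) ∪ Finset.Ioi j := by
        ext k
        simp only [Finset.mem_univ, Finset.mem_union, Finset.mem_insert, Finset.mem_Ioc,
          Finset.mem_Ioi, true_iff]
        by_cases hk : k = 0
        · exact Or.inl (Or.inl hk)
        · rcases le_or_gt k j with h | h
          · exact Or.inl (Or.inr ⟨Fin.pos_iff_ne_zero.2 hk, h⟩)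
          · exact Or.inr h
      rw [hun, Finset.sum_union, Finset.sum_insert (by simp)]
      rw [Finset.disjoint_left]
      intro k hk hk'
      simp only [Finset.mem_insert, Finset.mem_Ioc, Finset.mem_Ioi] at hk hk'
      rcases hk with rfl | hk
      · exact absurd hk' (not_lt.2 (Fin.zero_le _))
      · exact absurd hk' (not_lt.2 hk.2)
    have hIic : ∀ (a : Fin p → ℝ) (j : Fin p),
        ∑ k ∈ Finset.Iic j, a k = a 0 + ∑ k ∈ Finset.Ioc 0 j, a k := by
      intro a j
      have : Finset.Iic j = insert 0 (Finset.Ioc 0 j) := by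
        ext k
        simp only [Finset.mem_Iic, Finset.mem_insert, Finset.mem_Ioc]
        constructor
        · intro h
          by_cases hk : k = 0
          · exact Or.inl hk
          · exact Or.inr ⟨Fin.pos_iff_ne_zero.2 hk, h⟩
        · rintro (rfl | h)
          · exact Fin.zero_le _
          · exact h.2
      rw [this, Finset.sum_insert (by simp)]
    have hδ2 : δ ^ 2 ≤ c 0 ^ 2 := by
      rw [← sq_abs (c 0)]; exact pow_le_pow_left₀ hδ0.le hδ 2
    have hterm : ∀ j, |decr m j * (∑ k ∈ Finset.Iic j, ⟪t k, y⟫ ^ 2 -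
        ∑ k ∈ Finset.Iic j, yy k ^ 2)| ≤ 12 * p * √ε / δ ^ 2 * B := by
      intro j
      set r := ∑ k ∈ Finset.Ioi j, c k * yy k
      set q := ∑ k ∈ Finset.Ioi j, c k ^ 2
      set d := decr m j
      have hd0 : 0 ≤ d := decr_nonneg hm hm0 j
      have hq : 0 ≤ q := Finset.sum_nonneg fun _ _ => sq_nonneg _
      have hs1 : 1 - ∑ k ∈ Finset.Ioc 0 j, c k ^ 2 = c 0 ^ 2 + q := by
        have := hsplit (fun k => c k ^ 2) j
        rw [hcsum] at this
        linarith
      have hden : 0 < c 0 ^ 2 + q := by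
        have : 0 < δ ^ 2 := by positivity
        linarith
      have hg : ∑ k ∈ Finset.Ioc 0 j, c k * yy k = -(c 0 * yy 0 + r) := by
        have := hsplit (fun k => c k * yy k) j
        rw [hcy] at this
        linarith
      have hF := sum_Iic_inner_nullEigenvectors ht hθ hy j (by
        intro h1
        have : 1 - ∑ k ∈ Finset.Ioc 0 j, c k ^ 2 = 0 := sub_eq_zero.2 h1.symm
        linarith)
      rw [hF, hIic (fun k => yy k ^ 2) j]
      -- Because `y ⟂ b 0` and the `c k²` sum to one, the sums over `1, …, j` can be traded for the
      -- index `0` and the indices beyond `j`. Only overlaps `c k` with `k > j` then appear in the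
      -- error, and the decrement times `c k²` is small for those.
      have hdiff : (∑ k ∈ Finset.Ioc 0 j, ⟪bh k, y⟫ ^ 2 +
          (∑ k ∈ Finset.Ioc 0 j, ⟪bh k, b 0⟫ * ⟪bh k, y⟫) ^ 2 /
          (1 - ∑ k ∈ Finset.Ioc 0 j, ⟪bh k, b 0⟫ ^ 2)) -
          (yy 0 ^ 2 + ∑ k ∈ Finset.Ioc 0 j, yy k ^ 2) =
          (2 * c 0 * yy 0 * r + r ^ 2 - q * yy 0 ^ 2) / (c 0 ^ 2 + q) := by
        rw [show ∑ k ∈ Finset.Ioc 0 j, ⟪bh k, b 0⟫ * ⟪bh k, y⟫ = -(c 0 * yy 0 + r) from hg,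
          show 1 - ∑ k ∈ Finset.Ioc 0 j, ⟪bh k, b 0⟫ ^ 2 = c 0 ^ 2 + q from hs1]
        simp only [yy]
        field_simp; ring
      rw [hdiff]
      -- the three error terms
      have hdk : ∀ k ∈ Finset.Ioi j, d * c k ^ 2 ≤ 4 * ε * m k := fun k hk =>
        (mul_le_mul_of_nonneg_right (decr_le_sub hm (Finset.mem_Ioi.1 hk)) (sq_nonneg _)).trans
          (hkey k)
      have hcard : ((Finset.Ioi j).card : ℝ) ≤ p := by
        have := Finset.card_le_univ (Finset.Ioi j)
        rw [Fintype.card_fin] at this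
        exact_mod_cast this
      have e1 : d * r ^ 2 ≤ 4 * p * ε * B := by
        have h1 : r ^ 2 ≤ p * ∑ k ∈ Finset.Ioi j, (c k * yy k) ^ 2 :=
          sq_sum_le_card_mul_sum_sq.trans (mul_le_mul_of_nonneg_right hcard
            (Finset.sum_nonneg fun _ _ => sq_nonneg _))
        have h2 : d * ∑ k ∈ Finset.Ioi j, (c k * yy k) ^ 2 ≤ 4 * ε * B := by
          calc _ = ∑ k ∈ Finset.Ioi j, d * c k ^ 2 * yy k ^ 2 := by
                rw [Finset.mul_sum]; exact Finset.sum_congr rfl fun k _ => by ring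
            _ ≤ ∑ k ∈ Finset.Ioi j, 4 * ε * m k * yy k ^ 2 := Finset.sum_le_sum fun k hk =>
                mul_le_mul_of_nonneg_right (hdk k hk) (sq_nonneg _)
            _ ≤ ∑ k, 4 * ε * m k * yy k ^ 2 := Finset.sum_le_sum_of_subset_of_nonneg
                (Finset.subset_univ _) fun k _ _ => by have := hm0 k; positivity
            _ = 4 * ε * B := by
                simp only [B, qh, Finset.mul_sum]
                exact Finset.sum_congr rfl fun k _ => by simp only [yy]; ring
        calc d * r ^ 2 ≤ d * (p * ∑ k ∈ Finset.Ioi j, (c k * yy k) ^ 2) :=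
              mul_le_mul_of_nonneg_left h1 hd0
          _ = p * (d * ∑ k ∈ Finset.Ioi j, (c k * yy k) ^ 2) := by ring
          _ ≤ p * (4 * ε * B) := mul_le_mul_of_nonneg_left h2 hp0.le
          _ = _ := by ring
      have e2 : d * (q * yy 0 ^ 2) ≤ 4 * p * ε * B := by
        have h2 : d * q ≤ 4 * p * ε * m 0 := by
          calc _ = ∑ k ∈ Finset.Ioi j, d * c k ^ 2 := by rw [Finset.mul_sum]
            _ ≤ ∑ k ∈ Finset.Ioi j, 4 * ε * m 0 := Finset.sum_le_sum fun k hk =>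
                (hdk k hk).trans (mul_le_mul_of_nonneg_left (hm (Fin.zero_le k)) (by positivity))
            _ = (Finset.Ioi j).card * (4 * ε * m 0) := by simp
            _ ≤ p * (4 * ε * m 0) := mul_le_mul_of_nonneg_right hcard
                (by have := hm0 0; positivity)
            _ = _ := by ring
        calc d * (q * yy 0 ^ 2) = d * q * yy 0 ^ 2 := by ring
          _ ≤ 4 * p * ε * m 0 * yy 0 ^ 2 := mul_le_mul_of_nonneg_right h2 (sq_nonneg _)
          _ = 4 * p * ε * (m 0 * yy 0 ^ 2) := by ring
          _ ≤ _ := mul_le_mul_of_nonneg_left (hBk 0) (by positivity)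
      have hd1 : d ≤ m 0 := decr_le hm hm0 j
      clear hF hdiff hg hs1 hdk
      clear_value d r q B yy c qh q0
      have hsq : √ε ^ 2 = ε := Real.sq_sqrt hε0
      have hsq1 : √ε ≤ 1 := Real.sqrt_le_one.2 (by linarith)
      have hsq0 : 0 ≤ √ε := Real.sqrt_nonneg _
      have hεle : ε ≤ √ε := by nlinarith
      -- The cross term is the geometric mean of `d * yy 0 ^ 2 ≤ B` and `d * r ^ 2 = O(ε B)`. It is
      -- the only term of order `√ε`, and it sets the rate of the whole bound.
      have e3 : d * |yy 0 * r| ≤ 2 * p * √ε * B := by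
        have h1 : (d * |yy 0 * r|) ^ 2 ≤ (2 * p * √ε * B) ^ 2 := by
          have h2 : d * yy 0 ^ 2 ≤ B :=
            (mul_le_mul_of_nonneg_right hd1 (sq_nonneg _)).trans (hBk 0)
          calc (d * |yy 0 * r|) ^ 2 = (d * yy 0 ^ 2) * (d * r ^ 2) := by
                rw [mul_pow, sq_abs]; ring
            _ ≤ B * (4 * p * ε * B) := mul_le_mul h2 e1 (by positivity) hB0
            _ = 4 * ε * B ^ 2 * p := by ring
            _ ≤ 4 * ε * B ^ 2 * (p * p) :=
                mul_le_mul_of_nonneg_left (by nlinarith) (by positivity)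
            _ = (2 * p * √ε * B) ^ 2 := by rw [mul_pow, mul_pow, hsq]; ring
        exact (le_abs_self _).trans (abs_le_of_sq_le_sq h1 (by positivity))
      rw [mul_div_assoc', abs_div, abs_of_pos hden, div_mul_eq_mul_div]
      have hc0' : |c 0| ≤ 1 := by
        have := hc1 0; rw [← sq_abs] at this
        nlinarith [abs_nonneg (c 0)]
      refine div_le_div₀ (by positivity) ?_ (by positivity) (by linarith)
      have hexp : d * (2 * c 0 * yy 0 * r + r ^ 2 - q * yy 0 ^ 2) =
          2 * c 0 * (d * (yy 0 * r)) + d * r ^ 2 - d * (q * yy 0 ^ 2) := by ring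
      rw [hexp]
      have h3a : |2 * c 0 * (d * (yy 0 * r))| ≤ 2 * (2 * p * √ε * B) := by
        rw [abs_mul, abs_mul, abs_mul, abs_of_nonneg hd0, abs_of_pos (by norm_num : (0 : ℝ) < 2)]
        calc 2 * |c 0| * (d * |yy 0 * r|) ≤ 2 * 1 * (2 * p * √ε * B) :=
              mul_le_mul (by linarith) e3 (by positivity) (by norm_num)
          _ = _ := by ring
      have hdr : 0 ≤ d * r ^ 2 := by positivity
      have hdq : 0 ≤ d * (q * yy 0 ^ 2) := by positivity
      have hεB : 4 * p * ε * B ≤ 4 * p * √ε * B :=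
        mul_le_mul_of_nonneg_right (mul_le_mul_of_nonneg_left hεle (by positivity)) hB0
      have hpB : 0 ≤ p * √ε * B := by positivity
      rw [abs_le] at h3a ⊢
      constructor <;> linarith
    -- Summation by parts expresses both forms through squared projections on initial segments,
    -- which are explicit after Gram-Schmidt, whereas the individual vectors are not.
    have hAbel : ∑ k, m k * ⟪t k, y⟫ ^ 2 - qh y =
        ∑ j, decr m j * (∑ k ∈ Finset.Iic j, ⟪t k, y⟫ ^ 2 - ∑ k ∈ Finset.Iic j, yy k ^ 2) := by
      simp only [qh]
      rw [sum_mul_eq_sum_decr m fun k => ⟪t k, y⟫ ^ 2, sum_mul_eq_sum_decr m fun k => ⟪bh k, y⟫ ^ 2,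
        ← Finset.sum_sub_distrib]
      exact Finset.sum_congr rfl fun j _ => by rw [mul_sub]
    rw [hAbel]
    refine (Finset.abs_sum_le_sum_abs _ _).trans ((Finset.sum_le_sum fun j _ => hterm j).trans ?_)
    simp
    exact le_of_eq (by ring)
  have hδ1 : δ ≤ 1 := by
    have := hc1 0
    rw [← sq_abs] at this
    nlinarith [abs_nonneg (c 0)]
  have hεη : ε ≤ √ε / δ ^ 2 := by
    have hsq : √ε ^ 2 = ε := Real.sq_sqrt hε0
    have hsq1 : √ε ≤ 1 := Real.sqrt_le_one.2 (by linarith)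
    have hsq0 : 0 ≤ √ε := Real.sqrt_nonneg _
    rw [le_div_iff₀ (by positivity)]
    have : δ ^ 2 ≤ 1 := pow_le_one₀ hδ0.le hδ1
    nlinarith
  refine ⟨t, ht, ht0, hmpos, fun y => ?_⟩
  -- Both the corrected and the true form split along `b 0`, since `t 0 = b 0`. On the complement
  -- `hperp` costs `12`, and passing from the empirical form to the true one accounts for the
  -- thirteenth unit; along `b 0` only `|m 0 - l 0|` enters.
  set a := ⟪b 0, y⟫
  set z := y - a • b 0
  have hz : ⟪b 0, z⟫ = 0 := by
    simp only [z, inner_sub_right, inner_smul_right]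
    rw [real_inner_self_eq_norm_sq, hθ]; simp [a]
  have hyz : y = z + a • b 0 := by simp [z]
  have hblock : ∀ (g : OrthonormalBasis (Fin p) ℝ (EuclideanSpace ℝ (Fin p))) (v : Fin p → ℝ),
      g 0 = b 0 → ∑ k, v k * ⟪g k, y⟫ ^ 2 = ∑ k, v k * ⟪g k, z⟫ ^ 2 + v 0 * a ^ 2 := by
    intro g v hg
    have h1 : ∀ k, v k * ⟪g k, y⟫ ^ 2 =
        v k * ⟪g k, z⟫ ^ 2 + if k = 0 then v 0 * a ^ 2 else 0 := by
      intro k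
      rw [hyz, inner_add_right, inner_smul_right, ← hg, g.inner_eq_ite]
      split_ifs with hk
      · subst hk; rw [hg, hz]; ring
      · ring
    simp_rw [h1, Finset.sum_add_distrib]
    simp
  rw [hblock t m ht0, hblock b l rfl]
  have h1 := hperp z hz
  have h2 : |qh z - q0 z| ≤ √ε / δ ^ 2 * q0 z := by
    have h3 := hlow z
    have h4 := hup z
    change (1 - ε) * q0 z ≤ qh z at h3
    change qh z ≤ q0 z at h4
    have h5 := mul_le_mul_of_nonneg_right hεη (hq0nn z)
    rw [abs_le]; constructor <;> linarith
  have h3 : |m 0 - l 0| ≤ √ε / δ ^ 2 * l 0 := by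
    have h6 := hlow (b 0)
    change (1 - ε) * q0 (b 0) ≤ qh (b 0) at h6
    rw [hq0b] at h6
    have h2 : qh (b 0) ≤ m 0 := by
      calc _ ≤ ∑ k, m 0 * ⟪bh k, b 0⟫ ^ 2 :=
            Finset.sum_le_sum fun k _ =>
              mul_le_mul_of_nonneg_right (hm (Fin.zero_le k)) (sq_nonneg _)
        _ = m 0 := by rw [← Finset.mul_sum, sum_inner_sq, b.norm_eq_one]; ring
    have h5 := mul_le_mul_of_nonneg_right hεη (hl 0).le
    rw [abs_le]; constructor <;> linarith
  have hqle : qh z ≤ q0 z := hup z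
  set η := √ε / δ ^ 2
  have hη0 : 0 ≤ η := by positivity
  have e12 : 12 * p ^ 2 * √ε / δ ^ 2 = 12 * p ^ 2 * η := by simp only [η]; ring
  have e13 : 13 * p ^ 2 * √ε / δ ^ 2 = 13 * p ^ 2 * η := by simp only [η]; ring
  rw [e12] at h1
  rw [e13]
  have h4 : 12 * p ^ 2 * η * qh z ≤ 12 * p ^ 2 * η * q0 z :=
    mul_le_mul_of_nonneg_left hqle (by positivity)
  have hηp : η ≤ p ^ 2 * η := le_mul_of_one_le_left hη0 (one_le_pow₀ hp1)
  have h5 : η * q0 z ≤ p ^ 2 * η * q0 z := mul_le_mul_of_nonneg_right hηp (hq0nn z)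
  have hη2 : η * (l 0 * a ^ 2) ≤ 13 * p ^ 2 * η * (l 0 * a ^ 2) :=
    mul_le_mul_of_nonneg_right (by linarith) (by have := hl 0; positivity)
  have h6 : |m 0 * a ^ 2 - l 0 * a ^ 2| ≤ η * (l 0 * a ^ 2) := by
    rw [← sub_mul, abs_mul, abs_of_nonneg (sq_nonneg a), ← mul_assoc]
    exact mul_le_mul_of_nonneg_right h3 (sq_nonneg a)
  change |∑ k, m k * ⟪t k, z⟫ ^ 2 + m 0 * a ^ 2 - (q0 z + l 0 * a ^ 2)| ≤
    13 * p ^ 2 * η * (q0 z + l 0 * a ^ 2)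
  rw [abs_le] at h1 h2 h6 ⊢
  constructor <;> linarith

end

/-! ### A small ball estimate for Rademacher sums. -/

/-- The sign attached to a Boolean. -/
def bsign (s : Bool) : ℝ := if s then 1 else -1

lemma sum_bool_prod {n : ℕ} (f : Bool → Fin n → ℂ) :
    ∑ s : Fin n → Bool, ∏ i, f (s i) i = ∏ i, (f true i + f false i) := by
  have := Finset.prod_univ_sum (fun _ : Fin n => (Finset.univ : Finset Bool)) (fun i s => f s i)
  rw [Fintype.piFinset_univ] at this
  rw [← this]
  exact Finset.prod_congr rfl fun i _ => by simp

/-- The characteristic function of a Rademacher sum factorizes into cosines; the sign vectors are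
summed, not averaged, whence the factors `2`. -/
lemma sum_cexp_sign {n : ℕ} (x : Fin n → ℝ) (g : ℝ) :
    ∑ s : Fin n → Bool, Complex.exp (((∑ i, bsign (s i) * x i : ℝ) : ℂ) * g * Complex.I) =
      ((∏ i, (2 * Real.cos (g * x i)) : ℝ) : ℂ) := by
  have h : ∀ s : Fin n → Bool,
      Complex.exp (((∑ i, bsign (s i) * x i : ℝ) : ℂ) * g * Complex.I) =
        ∏ i, Complex.exp (((bsign (s i) * x i : ℝ) : ℂ) * g * Complex.I) := fun s => by
    rw [← Complex.exp_sum]; push_cast; rw [Finset.sum_mul, Finset.sum_mul]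
  simp_rw [h]
  rw [sum_bool_prod (fun s i => Complex.exp (((bsign s * x i : ℝ) : ℂ) * g * Complex.I))]
  push_cast
  refine Finset.prod_congr rfl fun i _ => ?_
  rw [Complex.two_cos]
  simp only [bsign, if_true, Bool.false_eq_true, if_false]
  push_cast
  congr 2 <;> ring

/-- Bounding the exponential factor of the Gaussian density by one leaves an explicit integral. -/
lemma integral_exp_neg_mul_sq_gaussianReal_le {a : ℝ} (ha : 0 < a) :
    ∫ g, Real.exp (-a * g ^ 2) ∂(gaussianReal 0 1) ≤ 1 / √(2 * a) := by
  rw [integral_gaussianReal_eq_integral_smul one_ne_zero]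
  have h2 : ∫ g : ℝ, (√(2 * Real.pi))⁻¹ * Real.exp (-a * g ^ 2) = 1 / √(2 * a) := by
    rw [integral_const_mul, integral_gaussian, ← Real.sqrt_inv, ← Real.sqrt_mul (by positivity),
      one_div, ← Real.sqrt_inv]
    congr 1
    have := Real.pi_pos
    field_simp
  rw [← h2]
  refine integral_mono_of_nonneg (ae_of_all _ fun g => ?_)
    ((integrable_exp_neg_mul_sq ha).const_mul _) (ae_of_all _ fun g => ?_)
  · exact smul_nonneg (gaussianPDFReal_nonneg _ _ _) (Real.exp_pos _).le
  · simp only [smul_eq_mul, gaussianPDFReal]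
    refine mul_le_mul_of_nonneg_right ?_ (Real.exp_pos _).le
    simp only [NNReal.coe_one, mul_one]
    refine mul_le_of_le_one_right (by positivity) (Real.exp_le_one_iff.2 ?_)
    have := sq_nonneg (g - 0)
    linarith

lemma abs_cos_le_exp {x : ℝ} (hx : |x| ≤ Real.pi / 2) :
    |Real.cos x| ≤ Real.exp (-(2 / Real.pi ^ 2) * x ^ 2) := by
  have h1 := abs_le.1 hx
  rw [abs_of_nonneg (Real.cos_nonneg_of_mem_Icc ⟨by linarith, h1.2⟩)]
  have h2 := Real.cos_le_one_sub_mul_cos_sq (x := x) (by linarith [Real.pi_pos])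
  have h3 := Real.add_one_le_exp (-(2 / Real.pi ^ 2) * x ^ 2)
  linarith

/-- If all angles are at most `π / 2`, each cosine is below a Gaussian. Otherwise some `(g x i)²`
exceeds one, and then `r g²` already dominates the trivial bound `1`. -/
lemma prod_abs_cos_le {n : ℕ} (x : Fin n → ℝ) {r : ℝ} (hr : ∀ i, x i ^ 2 ≤ r) (hr0 : 0 ≤ r)
    (g : ℝ) :
    ∏ i, |Real.cos (g * x i)| ≤
      Real.exp (-(2 / Real.pi ^ 2 * ∑ i, x i ^ 2) * g ^ 2) + r * g ^ 2 := by
  by_cases h : ∀ i, |g * x i| ≤ Real.pi / 2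
  · have h1 : ∏ i, |Real.cos (g * x i)| ≤
        ∏ i, Real.exp (-(2 / Real.pi ^ 2) * (g * x i) ^ 2) :=
      Finset.prod_le_prod (fun i _ => abs_nonneg _) fun i _ => abs_cos_le_exp (h i)
    rw [← Real.exp_sum] at h1
    have h2 : ∑ i, -(2 / Real.pi ^ 2) * (g * x i) ^ 2 =
        -(2 / Real.pi ^ 2 * ∑ i, x i ^ 2) * g ^ 2 := by
      rw [Finset.mul_sum, ← Finset.sum_neg_distrib, Finset.sum_mul]
      exact Finset.sum_congr rfl fun i _ => by ring
    rw [h2] at h1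
    have := mul_nonneg hr0 (sq_nonneg g)
    linarith
  · push Not at h
    obtain ⟨i, hi⟩ := h
    have h1 : ∏ i, |Real.cos (g * x i)| ≤ 1 :=
      Finset.prod_le_one (fun i _ => abs_nonneg _) fun i _ => Real.abs_cos_le_one _
    have h2 : 1 ≤ (g * x i) ^ 2 := by
      rw [← sq_abs]
      exact one_le_pow₀ (by linarith [Real.pi_gt_three])
    have h3 : (g * x i) ^ 2 ≤ r * g ^ 2 := by
      rw [mul_pow, mul_comm]; exact mul_le_mul_of_nonneg_right (hr i) (sq_nonneg _)
    have := Real.exp_pos (-(2 / Real.pi ^ 2 * ∑ i, x i ^ 2) * g ^ 2)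
    linarith

/-- Small ball estimate for Rademacher sums. -/
lemma card_sign_sum_lt_le {n : ℕ} (x : Fin n → ℝ) {r c : ℝ} (hr : ∀ i, x i ^ 2 ≤ r) (hr0 : 0 ≤ r)
    (hc : 0 < c) (hcx : c ≤ ∑ i, x i ^ 2) :
    (((Finset.univ : Finset (Fin n → Bool)).filter
      fun s => |∑ i, bsign (s i) * x i| < 1).card : ℝ) ≤ 2 ^ n * (4 / √c + 2 * r) := by
  set X : (Fin n → Bool) → ℝ := fun s => ∑ i, bsign (s i) * x i
  -- On `|X| < 1` the value `exp (-X² / 2)` is at least `1/2`.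
  have h1 : (((Finset.univ : Finset (Fin n → Bool)).filter fun s => |X s| < 1).card : ℝ) ≤
      2 * ∑ s, Real.exp (-(X s) ^ 2 / 2) := by
    rw [Finset.card_filter, Finset.mul_sum]
    push_cast
    refine Finset.sum_le_sum fun s _ => ?_
    split_ifs with h
    · have h2 : (X s) ^ 2 ≤ 1 := by
        rw [← sq_abs]; exact pow_le_one₀ (abs_nonneg _) h.le
      have h3 := Real.add_one_le_exp (-(X s) ^ 2 / 2)
      linarith
    · positivity
  -- Esseen's device: `exp (-X² / 2)` is the average of `exp (i g X)` over a standard Gaussian `g`,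
  -- so the smoothed count becomes a Gaussian integral of the product of cosines.
  have h2 : ((∑ s, Real.exp (-(X s) ^ 2 / 2) : ℝ) : ℂ) =
      ∫ g, ((∏ i, (2 * Real.cos (g * x i)) : ℝ) : ℂ) ∂(gaussianReal 0 1) := by
    simp_rw [← sum_cexp_sign]
    rw [integral_finsetSum]
    · push_cast
      refine Finset.sum_congr rfl fun s _ => ?_
      have := charFun_gaussianReal (μ := 0) (v := 1) (X s)
      rw [charFun_apply_real] at this
      simp only [X] at this ⊢
      push_cast at this ⊢
      rw [this]
      congr 1; simp; ring
    · intro s _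
      refine Integrable.mono' (integrable_const (1 : ℝ)) (by fun_prop) (ae_of_all _ fun g => ?_)
      have : (((∑ i, bsign (s i) * x i : ℝ) : ℂ) * g * Complex.I) =
          (((∑ i, bsign (s i) * x i) * g : ℝ) : ℂ) * Complex.I := by push_cast; ring
      rw [this, Complex.norm_exp_ofReal_mul_I]
  have h3 : ∑ s, Real.exp (-(X s) ^ 2 / 2) =
      ∫ g, ∏ i, (2 * Real.cos (g * x i)) ∂(gaussianReal 0 1) := by
    rw [integral_complex_ofReal] at h2
    exact_mod_cast h2
  set a := 2 / Real.pi ^ 2 * ∑ i, x i ^ 2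
  have hpi := Real.pi_pos
  have ha : 2 / Real.pi ^ 2 * c ≤ a := mul_le_mul_of_nonneg_left hcx (by positivity)
  have ha0 : 0 < a := lt_of_lt_of_le (by positivity) ha
  have hint1 : Integrable (fun g : ℝ => Real.exp (-a * g ^ 2)) (gaussianReal 0 1) := by
    refine Integrable.mono' (integrable_const (1 : ℝ)) (by fun_prop) (ae_of_all _ fun g => ?_)
    rw [Real.norm_eq_abs, abs_of_pos (Real.exp_pos _), Real.exp_le_one_iff]
    have := mul_nonneg ha0.le (sq_nonneg g)
    linarith
  have hint2 : Integrable (fun g : ℝ => g ^ 2) (gaussianReal 0 1) :=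
    (memLp_id_gaussianReal 2).integrable_sq
  have hvar : ∫ g, g ^ 2 ∂(gaussianReal 0 1) = 1 := by
    have h := variance_eq_integral (μ := gaussianReal 0 1) (X := id) aemeasurable_id
    rw [variance_id_gaussianReal] at h
    simp only [id, integral_id_gaussianReal, sub_zero] at h
    rw [← h]; simp
  have h4 : ∫ g, ∏ i, (2 * Real.cos (g * x i)) ∂(gaussianReal 0 1) ≤
      2 ^ n * (1 / √(2 * a) + r) := by
    calc _ ≤ ∫ g, 2 ^ n * (Real.exp (-a * g ^ 2) + r * g ^ 2) ∂(gaussianReal 0 1) := by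
          refine integral_mono ?_ ((hint1.add (hint2.const_mul r)).const_mul _) fun g => ?_
          · refine Integrable.mono' (integrable_const ((2 : ℝ) ^ n)) (by fun_prop)
              (ae_of_all _ fun g => ?_)
            rw [Real.norm_eq_abs, Finset.abs_prod]
            calc ∏ i, |2 * Real.cos (g * x i)| ≤ ∏ i : Fin n, 2 :=
                  Finset.prod_le_prod (fun _ _ => abs_nonneg _) fun i _ => by
                    rw [abs_mul, abs_two]
                    linarith [Real.abs_cos_le_one (g * x i)]
              _ = 2 ^ n := by simp
          · refine (le_abs_self _).trans ?_
            rw [Finset.abs_prod]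
            simp_rw [abs_mul, Finset.prod_mul_distrib]
            simp only [abs_two, Finset.prod_const, Finset.card_univ, Fintype.card_fin]
            exact mul_le_mul_of_nonneg_left (prod_abs_cos_le x hr hr0 g) (by positivity)
      _ = 2 ^ n * (∫ g, Real.exp (-a * g ^ 2) ∂(gaussianReal 0 1) + r) := by
          rw [integral_const_mul, integral_add hint1 (hint2.const_mul r), integral_const_mul, hvar,
            mul_one]
      _ ≤ _ := by
          gcongr; exact integral_exp_neg_mul_sq_gaussianReal_le ha0
  -- From `a ≥ 2 c / π²` one gets `1 / √(2 a) ≤ π / (2 √c)`, and `π < 4`.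
  have h5 : 1 / √(2 * a) ≤ 2 / √c := by
    rw [div_le_div_iff₀ (by positivity) (by positivity), one_mul]
    have : √c ≤ √(4 * (2 * a)) := by
      refine Real.sqrt_le_sqrt ?_
      have h6 : c ≤ 16 / Real.pi ^ 2 * c := by
        refine le_mul_of_one_le_left hc.le ?_
        rw [le_div_iff₀ (by positivity)]
        nlinarith [Real.pi_lt_four]
      have : 16 / Real.pi ^ 2 * c = 8 * (2 / Real.pi ^ 2 * c) := by ring
      linarith
    rw [Real.sqrt_mul (by norm_num), show (4 : ℝ) = 2 ^ 2 by norm_num,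
      Real.sqrt_sq (by norm_num)] at this
    exact this
  calc _ ≤ 2 * (2 ^ n * (1 / √(2 * a) + r)) := by rw [h3] at h1; linarith
    _ ≤ 2 * (2 ^ n * (2 / √c + r)) := by gcongr
    _ = _ := by ring

/-! ### A leading direction nearly orthogonal to the axis forces a small cross term. -/

/-- A near maximiser, on the unit sphere, of a quadratic form `F` whose cross terms between `e` and
its orthogonal complement are given by `a`: if it is nearly orthogonal to `e`, then the cross term
at a maximiser on the orthogonal complement of `e` is small. -/
lemma abs_cross_le_of_nearly_max {E : Type*} [NormedAddCommGroup E] [InnerProductSpace ℝ E]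
    {F a : E → ℝ} {e v x : E} {η ρ δ : ℝ} (he : ‖e‖ = 1)
    (hF : ∀ x τ, ⟪e, x⟫ = 0 → F (x + τ • e) = F x + 2 * τ * a x + τ ^ 2 * F e)
    (hhom : ∀ (c : ℝ) x, F (c • x) = c ^ 2 * F x)
    (hv1 : ‖v‖ = 1) (hev : ⟪e, v⟫ = 0) (hv : ∀ z, ‖z‖ = 1 → ⟪e, z⟫ = 0 → F z ≤ F v)
    (hx1 : ‖x‖ = 1) (hx : ∀ y, ‖y‖ = 1 → F y ≤ F x + ρ)
    (ha : ∀ z, ⟪e, z⟫ = 0 → ‖z‖ ≤ 1 → |a z| ≤ η) (hD : F v - F e ≤ 2 * η)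
    (hρ : 0 ≤ ρ) (hδ0 : 0 < δ) (hδ : δ ≤ 1 / 2) (hex : |⟪e, x⟫| ≤ δ) :
    |a v| ≤ 3 * η * √δ + ρ / √δ := by
  have hη : 0 ≤ η := (abs_nonneg _).trans (ha 0 (by simp) (by simp))
  set c := ⟪e, x⟫
  set z := x - c • e
  have hee : ⟪e, e⟫ = 1 := by rw [real_inner_self_eq_norm_sq, he, one_pow]
  have hez : ⟪e, z⟫ = 0 := by
    simp only [z, inner_sub_right, inner_smul_right, hee]; simp [c]
  have hxz : x = z + c • e := by simp [z]
  have hnz : ‖z‖ ^ 2 = 1 - c ^ 2 := by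
    rw [← real_inner_self_eq_norm_sq]
    simp only [z, inner_sub_left, inner_sub_right, inner_smul_left, inner_smul_right, hee]
    rw [real_inner_self_eq_norm_sq, hx1, real_inner_comm e x]
    simp only [conj_trivial]
    rw [show ⟪e, x⟫ = c from rfl]
    ring
  have hc2 : c ^ 2 ≤ δ ^ 2 := by
    rw [← sq_abs]; exact pow_le_pow_left₀ (abs_nonneg _) hex 2
  have hz0 : 0 < ‖z‖ := by
    rcases (norm_nonneg z).lt_or_eq with h | h
    · exact h
    · rw [← h] at hnz; nlinarith
  have hFz : F z ≤ (1 - c ^ 2) * F v := by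
    have h1 := hv (‖z‖⁻¹ • z) (by rw [norm_smul, norm_inv, norm_norm, inv_mul_cancel₀ hz0.ne'])
      (by rw [inner_smul_right, hez, mul_zero])
    rw [hhom] at h1
    rw [← hnz]
    calc F z = ‖z‖ ^ 2 * (‖z‖⁻¹ ^ 2 * F z) := by field_simp
      _ ≤ _ := mul_le_mul_of_nonneg_left h1 (sq_nonneg _)
  have hFx : F x ≤ (1 - c ^ 2) * F v + 2 * (δ * η) + c ^ 2 * F e := by
    have h1 : |a z| ≤ η := ha z hez (by
      have : ‖z‖ ^ 2 ≤ 1 := by rw [hnz]; linarith [sq_nonneg c]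
      nlinarith)
    have h2 : c * a z ≤ δ * η := by
      refine (le_abs_self _).trans ?_
      rw [abs_mul]; exact mul_le_mul hex h1 (abs_nonneg _) hδ0.le
    have h3 : F x = F z + 2 * c * a z + c ^ 2 * F e := by
      conv_lhs => rw [hxz]
      exact hF z c hez
    linarith
  obtain ⟨σ, hσ1, hσ⟩ : ∃ σ : ℝ, σ ^ 2 = 1 ∧ σ * a v = |a v| := by
    rcases le_or_gt 0 (a v) with h | h
    · exact ⟨1, by norm_num, by rw [abs_of_nonneg h, one_mul]⟩
    · exact ⟨-1, by norm_num, by rw [abs_of_neg h, neg_one_mul]⟩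
  have hs : √δ ^ 2 = δ := Real.sq_sqrt hδ0.le
  have hs0 : 0 < √δ := Real.sqrt_pos.2 hδ0
  -- The competitor tilts the slice maximiser `v` towards `± e`, with the sign that increases `F`.
  -- The tilt `√δ` gains `2 √δ |a v|`, while near maximality of `x`, whose own tilt is only `δ`,
  -- limits the gain to `O(δ η) + O(ρ)`. Dividing by `√δ` gives the bound.
  set y0 := v + (√δ * σ) • e
  have hny0 : ‖y0‖ ^ 2 = 1 + δ := by
    rw [← real_inner_self_eq_norm_sq]
    simp only [y0, inner_add_left, inner_add_right, inner_smul_left, inner_smul_right, hee, hev,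
      real_inner_comm e v]
    rw [real_inner_self_eq_norm_sq, hv1]
    simp only [conj_trivial]
    have : √δ * σ * (√δ * σ) = √δ ^ 2 * σ ^ 2 := by ring
    rw [hs, hσ1] at this
    linarith
  have hny : 0 < ‖y0‖ := by
    rcases (norm_nonneg y0).lt_or_eq with h | h
    · exact h
    · rw [← h] at hny0; nlinarith
  have hFy : F v + 2 * √δ * |a v| + δ * F e ≤ (1 + δ) * (F x + ρ) := by
    have h1 := hx (‖y0‖⁻¹ • y0) (by rw [norm_smul, norm_inv, norm_norm, inv_mul_cancel₀ hny.ne'])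
    rw [hhom] at h1
    have h2 : F y0 = F v + 2 * √δ * |a v| + δ * F e := by
      rw [hF v _ hev, mul_pow, hs, hσ1, ← hσ]; ring
    rw [← h2, ← hny0]
    calc F y0 = ‖y0‖ ^ 2 * (‖y0‖⁻¹ ^ 2 * F y0) := by field_simp
      _ ≤ _ := mul_le_mul_of_nonneg_left h1 (sq_nonneg _)
  have hcoef0 : 0 ≤ δ - (1 + δ) * c ^ 2 := by nlinarith
  have hcoef1 : δ - (1 + δ) * c ^ 2 ≤ δ := by nlinarith [sq_nonneg c]
  have h1 : (δ - (1 + δ) * c ^ 2) * (F v - F e) ≤ δ * (2 * η) :=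
    (mul_le_mul_of_nonneg_left hD hcoef0).trans (mul_le_mul_of_nonneg_right hcoef1 (by linarith))
  have h2 : (1 + δ) * (F x + ρ) ≤
      (1 + δ) * ((1 - c ^ 2) * F v + 2 * (δ * η) + c ^ 2 * F e + ρ) :=
    mul_le_mul_of_nonneg_left (by linarith) (by linarith)
  have h3 : 2 * √δ * |a v| ≤ δ * (2 * η) + (1 + δ) * (2 * (δ * η) + ρ) := by nlinarith
  have h4 : (1 + δ) * (2 * (δ * η) + ρ) ≤ (3 / 2) * (2 * (δ * η) + ρ) :=
    mul_le_mul_of_nonneg_right (by linarith) (by positivity)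
  have h5 : 2 * √δ * |a v| ≤ 2 * √δ * (3 * η * √δ + ρ / √δ) := by
    have : 2 * √δ * (3 * η * √δ + ρ / √δ) = 6 * η * √δ ^ 2 + 2 * ρ := by field_simp; ring
    rw [this, hs]
    have := mul_nonneg hδ0.le hη
    linarith
  exact le_of_mul_le_mul_left h5 (by positivity)

/-! ### Scaled cross terms, sign flips of the first coordinate, and anticoncentration. -/

section
variable {p n : ℕ} [NeZero p]

/-- The first vector of the standard basis. -/
def e0 (p : ℕ) [NeZero p] : EuclideanSpace ℝ (Fin p) := EuclideanSpace.single 0 1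

lemma norm_e0 : ‖e0 p‖ = 1 := by simp [e0]

lemma inner_e0 (x : EuclideanSpace ℝ (Fin p)) : ⟪e0 p, x⟫ = x 0 := by
  rw [e0, EuclideanSpace.inner_single_left]; simp

/-- The diagonal map with entries `κ`. -/
def scale (κ : Fin p → ℝ) : EuclideanSpace ℝ (Fin p) →ₗ[ℝ] EuclideanSpace ℝ (Fin p) where
  toFun x := WithLp.toLp 2 fun k => κ k * x k
  map_add' x y := by ext k; simp [mul_add]
  map_smul' c x := by ext k; simp; ring

lemma scale_apply (κ : Fin p → ℝ) (x : EuclideanSpace ℝ (Fin p)) (k : Fin p) :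
    scale κ x k = κ k * x k := rfl

lemma scale_e0 {κ : Fin p → ℝ} (h : κ 0 = 1) : scale κ (e0 p) = e0 p := by
  ext k
  rw [scale_apply, e0]
  by_cases hk : k = 0
  · subst hk; simp [h]
  · simp [hk]

lemma inner_e0_scale {κ : Fin p → ℝ} (h : κ 0 = 1) (x : EuclideanSpace ℝ (Fin p)) :
    ⟪e0 p, scale κ x⟫ = ⟪e0 p, x⟫ := by
  rw [inner_e0, inner_e0, scale_apply, h, one_mul]

lemma norm_scale_le {κ : Fin p → ℝ} (h : ∀ k, |κ k| ≤ 1) (x : EuclideanSpace ℝ (Fin p)) :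
    ‖scale κ x‖ ≤ ‖x‖ := by
  rw [EuclideanSpace.norm_eq, EuclideanSpace.norm_eq]
  refine Real.sqrt_le_sqrt (Finset.sum_le_sum fun k _ => ?_)
  rw [scale_apply, norm_mul, mul_pow, Real.norm_eq_abs (κ k)]
  exact mul_le_of_le_one_left (sq_nonneg _) (pow_le_one₀ (abs_nonneg _) (h k))

/-- The cross terms of the quadratic form `linTyler w` between orthogonal vectors. -/
def crossTyler (w : Fin n → EuclideanSpace ℝ (Fin p)) (x y : EuclideanSpace ℝ (Fin p)) : ℝ :=
  (p + 2) * ((n : ℝ)⁻¹ * ∑ i, ⟪y, w i⟫ * ⟪x, w i⟫)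

lemma linTyler_add_smul (w : Fin n → EuclideanSpace ℝ (Fin p)) {x y : EuclideanSpace ℝ (Fin p)}
    (h : ⟪y, x⟫ = 0) (τ : ℝ) :
    linTyler w (x + τ • y) = linTyler w x + 2 * τ * crossTyler w x y + τ ^ 2 * linTyler w y := by
  have h1 : ∑ i, ⟪x + τ • y, w i⟫ ^ 2 = ∑ i, ⟪x, w i⟫ ^ 2 +
      2 * τ * ∑ i, ⟪y, w i⟫ * ⟪x, w i⟫ + τ ^ 2 * ∑ i, ⟪y, w i⟫ ^ 2 := by
    rw [Finset.mul_sum, Finset.mul_sum, ← Finset.sum_add_distrib, ← Finset.sum_add_distrib]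
    refine Finset.sum_congr rfl fun i _ => ?_
    rw [inner_add_left, inner_smul_left, conj_trivial]; ring
  have h2 : ‖x + τ • y‖ ^ 2 = ‖x‖ ^ 2 + τ ^ 2 * ‖y‖ ^ 2 := by
    rw [norm_add_sq_real, inner_smul_right, real_inner_comm, h, norm_smul, mul_pow,
      Real.norm_eq_abs, sq_abs]; ring
  rw [linTyler, linTyler, linTyler, crossTyler, h1, h2]; ring

lemma linTyler_smul (w : Fin n → EuclideanSpace ℝ (Fin p)) (c : ℝ)
    (x : EuclideanSpace ℝ (Fin p)) : linTyler w (c • x) = c ^ 2 * linTyler w x := by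
  rw [linTyler, linTyler, norm_smul, mul_pow, Real.norm_eq_abs, sq_abs]
  simp_rw [inner_smul_left, conj_trivial, mul_pow, ← Finset.mul_sum]
  ring

lemma FourthMomentsClose.linTyler_sub_le {w : Fin n → EuclideanSpace ℝ (Fin p)} {ε : ℝ}
    (h : FourthMomentsClose w ε) (hw : ∀ i, ‖w i‖ = 1) (x : EuclideanSpace ℝ (Fin p)) :
    |linTyler w x - ‖x‖ ^ 2| ≤ (p + 2) * p * ε * ‖x‖ ^ 2 := by
  have hp0 : (0 : ℝ) < p := Nat.cast_pos.2 (Nat.pos_of_ne_zero (NeZero.ne p))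
  have h1 : linTyler w x - ‖x‖ ^ 2 =
      (p + 2) * ((n : ℝ)⁻¹ * ∑ i, ⟪x, w i⟫ ^ 2 - ‖x‖ ^ 2 / p) := by
    rw [linTyler]; field_simp; ring
  rw [h1, abs_mul, abs_of_pos (by positivity)]
  calc _ ≤ ((p : ℝ) + 2) * (p * ε * ‖x‖ ^ 2) :=
        mul_le_mul_of_nonneg_left (h.second hw x) (by positivity)
    _ = _ := by ring

/-- Polarization: `4 crossTyler w x y` is the difference of `linTyler` at `x + y` and `x - y`, whose
norms agree by orthogonality. -/
lemma FourthMomentsClose.abs_crossTyler_le {w : Fin n → EuclideanSpace ℝ (Fin p)} {ε : ℝ}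
    (h : FourthMomentsClose w ε) (hε : 0 ≤ ε) (hw : ∀ i, ‖w i‖ = 1)
    {x y : EuclideanSpace ℝ (Fin p)}
    (hxy : ⟪y, x⟫ = 0) (hx : ‖x‖ ≤ 1) (hy : ‖y‖ ≤ 1) :
    |crossTyler w x y| ≤ (p + 2) * p * ε := by
  have h1 := linTyler_add_smul w hxy 1
  have h2 := linTyler_add_smul w hxy (-1)
  have h3 := h.linTyler_sub_le hw (x + (1 : ℝ) • y)
  have h4 := h.linTyler_sub_le hw (x + (-1 : ℝ) • y)
  have hn : ∀ τ : ℝ, ‖x + τ • y‖ ^ 2 = ‖x‖ ^ 2 + τ ^ 2 * ‖y‖ ^ 2 := fun τ => by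
    rw [norm_add_sq_real, inner_smul_right, real_inner_comm, hxy, norm_smul, mul_pow,
      Real.norm_eq_abs, sq_abs]; ring
  rw [h1, hn] at h3
  rw [h2, hn] at h4
  have hx2 : ‖x‖ ^ 2 ≤ 1 := pow_le_one₀ (norm_nonneg _) hx
  have hy2 : ‖y‖ ^ 2 ≤ 1 := pow_le_one₀ (norm_nonneg _) hy
  have h5 : (p + 2) * p * ε * (‖x‖ ^ 2 + ‖y‖ ^ 2) ≤ (p + 2) * p * ε * 2 :=
    mul_le_mul_of_nonneg_left (by linarith) (by positivity)
  rw [abs_le] at h3 h4 ⊢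
  constructor <;> linarith

/-- Unit maximisers, on the orthogonal complement of the first basis vector, of the scaled
linearization of Tyler's estimator. -/
def IsSliceMax (w : Fin n → EuclideanSpace ℝ (Fin p)) (κ : Fin p → ℝ)
    (v : EuclideanSpace ℝ (Fin p)) : Prop :=
  (‖v‖ = 1 ∧ ⟪e0 p, v⟫ = 0) ∧ ∀ z, ‖z‖ = 1 → ⟪e0 p, z⟫ = 0 →
    linTyler w (scale κ z) ≤ linTyler w (scale κ v)

lemma continuous_linTyler (w : Fin n → EuclideanSpace ℝ (Fin p)) : Continuous (linTyler w) := by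
  unfold linTyler; fun_prop

lemma continuous_scale (κ : Fin p → ℝ) : Continuous (scale κ) :=
  LinearMap.continuous_of_finiteDimensional _

lemma isCompact_slice :
    IsCompact {v : EuclideanSpace ℝ (Fin p) | ‖v‖ = 1 ∧ ⟪e0 p, v⟫ = 0} := by
  have : {v : EuclideanSpace ℝ (Fin p) | ‖v‖ = 1 ∧ ⟪e0 p, v⟫ = 0} =
      Metric.sphere 0 1 ∩ {v | ⟪e0 p, v⟫ = 0} := by ext v; simp
  rw [this]
  exact (isCompact_sphere _ _).inter_right (isClosed_eq (by fun_prop) continuous_const)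

lemma exists_isSliceMax (w : Fin n → EuclideanSpace ℝ (Fin p)) (κ : Fin p → ℝ) {k : Fin p}
    (hk : k ≠ 0) : ∃ v, IsSliceMax w κ v := by
  obtain ⟨v, hv, hmax⟩ := isCompact_slice.exists_isMaxOn
    ⟨EuclideanSpace.single k 1, by simp, by rw [inner_e0]; simp [hk.symm]⟩
    (((continuous_linTyler w).comp (continuous_scale κ)).continuousOn)
  exact ⟨v, hv, fun z h1 h2 => hmax ⟨h1, h2⟩⟩

/-- A scaled near maximiser that is nearly orthogonal to the first basis vector forces a small
cross term at all slice maximisers. -/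
lemma abs_crossTyler_le_of_nearly_max {w : Fin n → EuclideanSpace ℝ (Fin p)} {κ : Fin p → ℝ}
    {ε ρ δ : ℝ} (h : FourthMomentsClose w ε) (hε : 0 ≤ ε) (hw : ∀ i, ‖w i‖ = 1)
    (hκ0 : κ 0 = 1) (hκ : ∀ k, |κ k| ≤ 1) {x v : EuclideanSpace ℝ (Fin p)}
    (hv : IsSliceMax w κ v) (hx1 : ‖x‖ = 1)
    (hx : ∀ y, ‖y‖ = 1 → linTyler w (scale κ y) ≤ linTyler w (scale κ x) + ρ)
    (hρ : 0 ≤ ρ) (hδ0 : 0 < δ) (hδ : δ ≤ 1 / 2) (hex : |⟪e0 p, x⟫| ≤ δ) :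
    |crossTyler w (scale κ v) (e0 p)| ≤ 3 * ((p + 2) * p * ε) * √δ + ρ / √δ := by
  refine abs_cross_le_of_nearly_max (F := fun x => linTyler w (scale κ x))
    (a := fun x => crossTyler w (scale κ x) (e0 p)) norm_e0 ?_ ?_ hv.1.1 hv.1.2 hv.2 hx1 hx ?_ ?_
    hρ hδ0 hδ hex
  · intro x τ hx
    change linTyler w (scale κ (x + τ • e0 p)) = _
    rw [map_add, map_smul, scale_e0 hκ0, linTyler_add_smul w (by rw [inner_e0_scale hκ0, hx])]
  · intro c x
    change linTyler w (scale κ (c • x)) = _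
    rw [map_smul, linTyler_smul]
  · intro z hz hz1
    exact h.abs_crossTyler_le hε hw (by rw [inner_e0_scale hκ0, hz])
      ((norm_scale_le hκ z).trans hz1) norm_e0.le
  · have h1 := (abs_le.1 (h.linTyler_sub_le hw (scale κ v))).2
    have h2 := (abs_le.1 (h.linTyler_sub_le hw (e0 p))).1
    have h3 : ‖scale κ v‖ ^ 2 ≤ 1 :=
      pow_le_one₀ (norm_nonneg _) ((norm_scale_le hκ v).trans_eq hv.1.1)
    have h4 : (p + 2) * p * ε * ‖scale κ v‖ ^ 2 ≤ (p + 2) * p * ε * 1 :=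
      mul_le_mul_of_nonneg_left h3 (by positivity)
    simp only [scale_e0 hκ0]
    rw [norm_e0] at h2
    linarith

/-- Reflection of the first coordinate. -/
def flip0 (p : ℕ) [NeZero p] : EuclideanSpace ℝ (Fin p) ≃ₗᵢ[ℝ] EuclideanSpace ℝ (Fin p) :=
  (ℝ ∙ e0 p)ᗮ.reflection

lemma inner_flip0 (x y : EuclideanSpace ℝ (Fin p)) : ⟪x, flip0 p y⟫ = ⟪flip0 p x, y⟫ := by
  rw [← (flip0 p).inner_map_map (flip0 p x) y, flip0, Submodule.reflection_reflection]

lemma flip0_e0 : flip0 p (e0 p) = -e0 p :=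
  Submodule.reflection_orthogonalComplement_singleton_eq_neg _

lemma flip0_of_inner_eq_zero {x : EuclideanSpace ℝ (Fin p)} (h : ⟪e0 p, x⟫ = 0) :
    flip0 p x = x :=
  Submodule.reflection_mem_subspace_eq_self (Submodule.mem_orthogonal_singleton_iff_inner_right.2 h)

/-- Flip the sign of the first coordinate of part of the sample. -/
def flipSample (s : Fin n → Bool) (u : Fin n → Sph p) : Fin n → Sph p :=
  fun i => if s i then u i else sphMap (flip0 p) (u i)

lemma measurePreserving_flipSample (s : Fin n → Bool) :
    MeasurePreserving (flipSample (p := p) s) (Measure.pi fun _ => unif p)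
      (Measure.pi fun _ => unif p) := by
  have := measurePreserving_pi (fun _ : Fin n => unif p) (fun _ => unif p)
    (f := fun i u => if s i then u else sphMap (flip0 p) u) (fun i => by
      by_cases hs : s i = true
      · simp only [hs, if_true]; exact MeasurePreserving.id _
      · simp only [hs]; exact measurePreserving_sphMap _)
  exact this

lemma inner_e0_flipSample (s : Fin n → Bool) (u : Fin n → Sph p) (i : Fin n) :
    ⟪e0 p, (flipSample s u i : EuclideanSpace ℝ (Fin p))⟫ =
      bsign (s i) * ⟪e0 p, (u i : EuclideanSpace ℝ (Fin p))⟫ := by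
  by_cases hs : s i = true
  · simp [flipSample, hs, bsign]
  · simp only [flipSample, hs, bsign]
    change ⟪e0 p, flip0 p (u i)⟫ = _
    rw [inner_flip0, flip0_e0, inner_neg_left]; simp

lemma inner_flipSample (s : Fin n → Bool) (u : Fin n → Sph p) (i : Fin n)
    {x : EuclideanSpace ℝ (Fin p)} (hx : ⟪e0 p, x⟫ = 0) :
    ⟪x, (flipSample s u i : EuclideanSpace ℝ (Fin p))⟫ =
      ⟪x, (u i : EuclideanSpace ℝ (Fin p))⟫ := by
  by_cases hs : s i = true
  · simp [flipSample, hs]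
  · simp only [flipSample, hs]
    change ⟪x, flip0 p (u i)⟫ = _
    rw [inner_flip0, flip0_of_inner_eq_zero hx]

/-- On the slice the scaled form does not see the first coordinates of the sample. The same
maximiser therefore serves all sign patterns, and given the remaining data the cross term is linear
in independent signs. -/
lemma IsSliceMax.flipSample {u : Fin n → Sph p} {κ : Fin p → ℝ} (hκ0 : κ 0 = 1)
    {v : EuclideanSpace ℝ (Fin p)} (hv : IsSliceMax (fun i => (u i : EuclideanSpace ℝ (Fin p))) κ v)
    (s : Fin n → Bool) :
    IsSliceMax (fun i => (flipSample s u i : EuclideanSpace ℝ (Fin p))) κ v := by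
  have h : ∀ z, ⟪e0 p, z⟫ = 0 →
      linTyler (fun i => (SignTest.flipSample s u i : EuclideanSpace ℝ (Fin p))) (scale κ z) =
        linTyler (fun i => (u i : EuclideanSpace ℝ (Fin p))) (scale κ z) := fun z hz => by
    simp only [linTyler]
    simp_rw [inner_flipSample s u _ (show ⟪e0 p, scale κ z⟫ = 0 by rw [inner_e0_scale hκ0, hz])]
  refine ⟨hv.1, fun z h1 h2 => ?_⟩
  rw [h z h2, h v hv.1.2]
  exact hv.2 z h1 h2

/-- Samples for which the cross terms at all slice maximisers are small. -/
def smallCross (κ : Fin p → ℝ) (r : ℝ) : Set (Fin n → Sph p) :=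
  {u | ∀ v, IsSliceMax (fun i => (u i : EuclideanSpace ℝ (Fin p))) κ v →
    |∑ i, ⟪e0 p, (u i : EuclideanSpace ℝ (Fin p))⟫ *
      ⟪scale κ v, (u i : EuclideanSpace ℝ (Fin p))⟫| < r}

/-- The complement is a projection of a closed set along the compact slice, hence closed.
Quantifying over all slice maximisers avoids choosing one measurably. -/
lemma measurableSet_smallCross (κ : Fin p → ℝ) (r : ℝ) :
    MeasurableSet (smallCross (n := n) κ r) := by
  have hcl : IsClosed (smallCross (n := n) κ r)ᶜ := by
    set S : Set ((Fin n → Sph p) × EuclideanSpace ℝ (Fin p)) :=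
      {q | (‖q.2‖ = 1 ∧ ⟪e0 p, q.2⟫ = 0) ∧ (∀ z, ‖z‖ = 1 → ⟪e0 p, z⟫ = 0 →
        linTyler (fun i => (q.1 i : EuclideanSpace ℝ (Fin p))) (scale κ z) ≤
          linTyler (fun i => (q.1 i : EuclideanSpace ℝ (Fin p))) (scale κ q.2)) ∧
        r ≤ |∑ i, ⟪e0 p, (q.1 i : EuclideanSpace ℝ (Fin p))⟫ *
          ⟪scale κ q.2, (q.1 i : EuclideanSpace ℝ (Fin p))⟫|} with hS
    have himg : (smallCross (n := n) κ r)ᶜ = Prod.fst '' S := by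
      ext u
      simp only [smallCross, Set.mem_compl_iff, Set.mem_ofPred_eq, Set.mem_image, hS, IsSliceMax]
      push Not
      constructor
      · rintro ⟨v, ⟨h1, h2⟩, h3⟩; exact ⟨(u, v), ⟨h1, h2, h3⟩, rfl⟩
      · rintro ⟨⟨u', v⟩, ⟨h1, h2, h3⟩, rfl⟩; exact ⟨v, ⟨h1, h2⟩, h3⟩
    have hsc := continuous_scale (p := p) κ
    have hSc : IsClosed S := by
      have h1 : IsClosed {q : (Fin n → Sph p) × EuclideanSpace ℝ (Fin p) |
          ‖q.2‖ = 1 ∧ ⟪e0 p, q.2⟫ = 0} :=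
        (isClosed_eq (by fun_prop) continuous_const).inter
          (isClosed_eq (by fun_prop) continuous_const)
      have h2 : IsClosed {q : (Fin n → Sph p) × EuclideanSpace ℝ (Fin p) |
          ∀ z, ‖z‖ = 1 → ⟪e0 p, z⟫ = 0 →
          linTyler (fun i => (q.1 i : EuclideanSpace ℝ (Fin p))) (scale κ z) ≤
          linTyler (fun i => (q.1 i : EuclideanSpace ℝ (Fin p))) (scale κ q.2)} := by
        simp only [Set.ofPred_forall]
        refine isClosed_iInter fun z => isClosed_iInter fun _ => isClosed_iInter fun _ =>
          isClosed_le ?_ ?_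
        · unfold linTyler; fun_prop
        · unfold linTyler; fun_prop
      have h3 : IsClosed {q : (Fin n → Sph p) × EuclideanSpace ℝ (Fin p) |
          r ≤ |∑ i, ⟪e0 p, (q.1 i : EuclideanSpace ℝ (Fin p))⟫ *
          ⟪scale κ q.2, (q.1 i : EuclideanSpace ℝ (Fin p))⟫|} :=
        isClosed_le continuous_const (by fun_prop)
      exact h1.inter (h2.inter h3)
    have hcomp : IsCompact S := by
      refine (isCompact_univ.prod (isCompact_slice (p := p))).of_isClosed_subset hSc ?_
      rintro q ⟨h1, -⟩
      exact ⟨Set.mem_univ _, h1⟩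
    rw [himg]
    exact (hcomp.image continuous_fst).isClosed
  exact hcl.measurableSet.of_compl

/-- Anticoncentration of the cross terms. -/
lemma measure_smallCross_le {κ : Fin p → ℝ} (hκ0 : κ 0 = 1) (hκ : ∀ k, |κ k| ≤ 1) {k : Fin p}
    (hk : k ≠ 0) (hk2 : 1 / 2 ≤ κ k ^ 2) {ε η : ℝ} (hε : 4 * ((p + 2) * p * ε) ≤ 1)
    (hη : 0 < η) (hn : n ≠ 0) :
    (Measure.pi fun _ => unif p) (smallCross (n := n) κ (η * √n)) ≤
      ENNReal.ofReal (4 * √(8 * (p * (p + 2))) * η + 2 / (η ^ 2 * n)) +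
        (Measure.pi fun _ => unif p) {u : Fin n → Sph p |
          ¬ FourthMomentsClose (fun i => (u i : EuclideanSpace ℝ (Fin p))) ε} := by
  have hp0 : (0 : ℝ) < p := Nat.cast_pos.2 (Nat.pos_of_ne_zero (NeZero.ne p))
  have hn0 : (0 : ℝ) < n := Nat.cast_pos.2 (Nat.pos_of_ne_zero hn)
  set B := 4 * √(8 * (p * (p + 2))) * η + 2 / (η ^ 2 * n)
  have hB : 0 ≤ B := by positivity
  set Q := Measure.pi fun _ : Fin n => unif p
  set S := smallCross (n := n) κ (η * √n)
  set M := {u : Fin n → Sph p |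
          ¬ FourthMomentsClose (fun i => (u i : EuclideanSpace ℝ (Fin p))) ε}
  classical
  have hSm : MeasurableSet S := measurableSet_smallCross κ _
  -- the small ball estimate for a fixed sample
  have hpt : ∀ u : Fin n → Sph p, u ∉ M →
      (((Finset.univ : Finset (Fin n → Bool)).filter fun s => flipSample s u ∈ S).card : ℝ) ≤
        2 ^ n * B := by
    intro u hu
    have h4 : FourthMomentsClose (fun i => (u i : EuclideanSpace ℝ (Fin p))) ε := not_not.1 hu
    have hw : ∀ i, ‖(u i : EuclideanSpace ℝ (Fin p))‖ = 1 := fun i => norm_eq_of_mem_sphere _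
    obtain ⟨v, hv⟩ := exists_isSliceMax (fun i => (u i : EuclideanSpace ℝ (Fin p))) κ hk
    set x : Fin n → ℝ := fun i => (η * √n)⁻¹ * (⟪e0 p, (u i : EuclideanSpace ℝ (Fin p))⟫ *
      ⟪scale κ v, (u i : EuclideanSpace ℝ (Fin p))⟫)
    have hsv1 : ‖scale κ v‖ ≤ 1 := (norm_scale_le hκ v).trans_eq hv.1.1
    -- The slice maximiser does at least as well as the `k`-th axis. As `linTyler` is within a
    -- factor `1 ± 1/4` of the squared norm, `(5/4) ‖scale κ v‖² ≥ (3/4) κ k² ≥ 3/8`.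
    have hsv : 1 / 4 ≤ ‖scale κ v‖ ^ 2 := by
      have h1 := hv.2 (EuclideanSpace.single k 1) (by simp) (by rw [inner_e0]; simp [hk.symm])
      have h2 := (abs_le.1 (h4.linTyler_sub_le hw (scale κ v))).2
      have h3 := (abs_le.1 (h4.linTyler_sub_le hw (scale κ (EuclideanSpace.single k 1)))).1
      have h5 : ‖scale κ (EuclideanSpace.single k 1)‖ ^ 2 = κ k ^ 2 := by
        rw [EuclideanSpace.norm_sq_eq, Finset.sum_eq_single k]
        · simp [scale_apply]
        · intro j _ hj; simp [scale_apply, hj]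
        · simp
      rw [h5] at h3
      set ee := (p + 2) * p * ε
      have h6 : ee * κ k ^ 2 ≤ 1 / 4 * κ k ^ 2 :=
        mul_le_mul_of_nonneg_right (by linarith) (sq_nonneg _)
      have h7 : ee * ‖scale κ v‖ ^ 2 ≤ 1 / 4 * ‖scale κ v‖ ^ 2 :=
        mul_le_mul_of_nonneg_right (by linarith) (sq_nonneg _)
      linarith
    have hηn : (η * √n) ^ 2 = η ^ 2 * n := by rw [mul_pow, Real.sq_sqrt hn0.le]
    have hr : ∀ i, x i ^ 2 ≤ 1 / (η ^ 2 * n) := by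
      intro i
      have h1 : |⟪e0 p, (u i : EuclideanSpace ℝ (Fin p))⟫ *
          ⟪scale κ v, (u i : EuclideanSpace ℝ (Fin p))⟫| ≤ 1 := by
        rw [abs_mul]
        refine mul_le_one₀ ?_ (abs_nonneg _) ?_
        · refine (abs_real_inner_le_norm _ _).trans ?_
          rw [hw, norm_e0, one_mul]
        · refine (abs_real_inner_le_norm _ _).trans ?_
          rw [hw, mul_one]; exact hsv1
      simp only [x]
      rw [mul_pow, inv_pow, hηn, ← sq_abs (_ * _), one_div]
      exact mul_le_of_le_one_right (by positivity) (pow_le_one₀ (abs_nonneg _) h1)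
    -- The conditional variance of the Rademacher sum is an empirical fourth moment at the
    -- orthogonal vectors `e0 p` and `scale κ v`, close to `‖scale κ v‖² / (p (p + 2))`.
    have hsum : 1 / (8 * (p * (p + 2))) / η ^ 2 ≤ ∑ i, x i ^ 2 := by
      have h1 := (abs_le.1 (h4 (e0 p) (scale κ v))).1
      rw [inner_e0_scale hκ0, hv.1.2, norm_e0] at h1
      have h2 : ∑ i, x i ^ 2 = (η ^ 2)⁻¹ * ((n : ℝ)⁻¹ * ∑ i,
          ⟪e0 p, (u i : EuclideanSpace ℝ (Fin p))⟫ ^ 2 *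
            ⟪scale κ v, (u i : EuclideanSpace ℝ (Fin p))⟫ ^ 2) := by
        rw [Finset.mul_sum, Finset.mul_sum]
        refine Finset.sum_congr rfl fun i _ => ?_
        simp only [x]
        rw [mul_pow, inv_pow, hηn, mul_inv]; ring
      rw [h2, div_eq_inv_mul]
      refine mul_le_mul_of_nonneg_left ?_ (by positivity)
      have h3 : ε ≤ 1 / (4 * (p * (p + 2))) := by
        rw [le_div_iff₀ (by positivity)]; linarith
      have h5 : ε * ‖scale κ v‖ ^ 2 ≤ 1 / (4 * (p * (p + 2))) * ‖scale κ v‖ ^ 2 :=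
        mul_le_mul_of_nonneg_right h3 (sq_nonneg _)
      have h6 : 1 / (8 * (p * (p + 2))) ≤ 3 / (4 * (p * ((p : ℝ) + 2))) * ‖scale κ v‖ ^ 2 := by
        calc 1 / (8 * (p * ((p : ℝ) + 2))) ≤ 3 / (4 * (p * ((p : ℝ) + 2))) * (1 / 4) := by
              rw [div_mul_div_comm, div_le_div_iff₀ (by positivity) (by positivity)]
              have : 0 < p * ((p : ℝ) + 2) := by positivity
              linarith
          _ ≤ _ := mul_le_mul_of_nonneg_left hsv (by positivity)
      have h7 : (2 * 0 ^ 2 + 1 ^ 2 * ‖scale κ v‖ ^ 2) / (p * ((p : ℝ) + 2)) =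
          4 / (4 * (p * ((p : ℝ) + 2))) * ‖scale κ v‖ ^ 2 := by field_simp; ring
      rw [h7] at h1
      have h8 : 4 / (4 * (p * ((p : ℝ) + 2))) * ‖scale κ v‖ ^ 2 =
        3 / (4 * (p * ((p : ℝ) + 2))) * ‖scale κ v‖ ^ 2 +
          1 / (4 * (p * ((p : ℝ) + 2))) * ‖scale κ v‖ ^ 2 := by ring
      linarith
    have hsb := card_sign_sum_lt_le x hr (by positivity) (by positivity) hsum
    refine le_trans ?_ (hsb.trans (le_of_eq ?_))
    · refine Nat.cast_le.2 (Finset.card_le_card fun s hs => ?_)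
      rw [Finset.mem_filter] at hs ⊢
      refine ⟨hs.1, ?_⟩
      have h1 := hs.2 v (hv.flipSample hκ0 s)
      have h2 : ∑ i, bsign (s i) * x i = (η * √n)⁻¹ *
          ∑ i, ⟪e0 p, (flipSample s u i : EuclideanSpace ℝ (Fin p))⟫ *
            ⟪scale κ v, (flipSample s u i : EuclideanSpace ℝ (Fin p))⟫ := by
        rw [Finset.mul_sum]
        refine Finset.sum_congr rfl fun i _ => ?_
        rw [inner_e0_flipSample, inner_flipSample _ _ _ (by rw [inner_e0_scale hκ0, hv.1.2])]
        simp only [x]; ring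
      have hpos : 0 < η * √n := by positivity
      rw [h2, abs_mul, abs_of_pos (inv_pos.2 hpos), inv_mul_lt_iff₀ hpos, mul_one]
      exact h1
    · congr 1
      rw [Real.sqrt_div (by positivity), Real.sqrt_sq hη.le, Real.sqrt_div (by positivity),
        Real.sqrt_one]
      simp only [B]
      have : 0 < √(8 * (p * ((p : ℝ) + 2))) := by positivity
      field_simp
  -- Each of the `2 ^ n` flips preserves the product measure, so the probability is the average over
  -- flips; sum and integral are exchanged and the counting bound is applied pointwise off `M`. An
  -- upper integral suffices for `M`, so its measurability plays no role.
  have hmain : (2 : ENNReal) ^ n * Q S ≤ 2 ^ n * (ENNReal.ofReal B + Q M) := by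
    calc (2 : ENNReal) ^ n * Q S = ∑ s : Fin n → Bool, Q (flipSample s ⁻¹' S) := by
          rw [Finset.sum_congr rfl fun s _ =>
            (measurePreserving_flipSample (p := p) s).measure_preimage hSm.nullMeasurableSet]
          simp [Q]
      _ = ∑ s : Fin n → Bool, ∫⁻ u, (flipSample s ⁻¹' S).indicator 1 u ∂Q :=
          Finset.sum_congr rfl fun s _ => (lintegral_indicator_one
            ((measurePreserving_flipSample s).measurable hSm)).symm
      _ = ∫⁻ u, ∑ s : Fin n → Bool, (flipSample s ⁻¹' S).indicator 1 u ∂Q := by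
          rw [lintegral_finsetSum]
          exact fun s _ => measurable_one.indicator ((measurePreserving_flipSample s).measurable hSm)
      _ ≤ ∫⁻ u, (2 ^ n * ENNReal.ofReal B + 2 ^ n * M.indicator 1 u) ∂Q := by
          refine lintegral_mono fun u => ?_
          have hcard : ∑ s : Fin n → Bool, (flipSample s ⁻¹' S).indicator (1 : (Fin n → Sph p) → ENNReal) u =
              (((Finset.univ : Finset (Fin n → Bool)).filter
                fun s => flipSample s u ∈ S).card : ENNReal) := by
            rw [Finset.card_filter]
            push_cast
            exact Finset.sum_congr rfl fun s _ => by simp [Set.indicator_apply]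
          rw [hcard]
          by_cases hu : u ∈ M
          · rw [Set.indicator_of_mem hu]
            refine le_trans ?_ le_add_self
            have : ((Finset.univ : Finset (Fin n → Bool)).filter
                fun s => flipSample s u ∈ S).card ≤ 2 ^ n := by
              refine (Finset.card_le_univ _).trans ?_
              simp
            simp only [Pi.one_apply, mul_one]
            exact_mod_cast this
          · rw [Set.indicator_of_notMem hu, mul_zero, add_zero]
            have h1 := ENNReal.ofReal_le_ofReal (hpt u hu)
            rw [ENNReal.ofReal_natCast, ENNReal.ofReal_mul (by positivity),
              ENNReal.ofReal_pow (by norm_num), ENNReal.ofReal_ofNat] at h1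
            exact h1
      _ ≤ _ := by
          rw [lintegral_add_left measurable_const, lintegral_const, mul_add]
          simp only [Q, measure_univ, mul_one]
          refine add_le_add le_rfl ?_
          rw [lintegral_const_mul' _ _ (by simp)]
          exact mul_le_mul_right (lintegral_indicator_one_le _) _
  exact (ENNReal.mul_le_mul_iff_right (by simp) (by simp)).1 hmain

end

/-! ### Expansion of the sign vector under a small block-diagonal perturbation. -/

section
variable {p n : ℕ} [NeZero p]

/-- Inversion reverses the comparison of positive quadratic forms. -/
lemma sum_inv_mul_sq_le_of_le {l m : Fin p → ℝ}
    {b t : OrthonormalBasis (Fin p) ℝ (EuclideanSpace ℝ (Fin p))} {c : ℝ}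
    (hl : ∀ k, 0 < l k) (hm : ∀ k, 0 < m k)
    (h : ∀ y, ∑ k, m k * ⟪t k, y⟫ ^ 2 ≤ c * ∑ k, l k * ⟪b k, y⟫ ^ 2)
    (z : EuclideanSpace ℝ (Fin p)) :
    ∑ k, (l k)⁻¹ * ⟪b k, z⟫ ^ 2 ≤ c * ∑ k, (m k)⁻¹ * ⟪t k, z⟫ ^ 2 := by
  -- `y` is the inverse of the first matrix applied to `z`, so `⟪z, y⟫ = A`. Cauchy-Schwarz in the
  -- basis `t` gives `A² ≤ B · (form of y) ≤ B · c A`.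
  set y := ∑ k, ((l k)⁻¹ * ⟪b k, z⟫) • b k
  have hby : ∀ k, ⟪b k, y⟫ = (l k)⁻¹ * ⟪b k, z⟫ := fun k => by
    simp only [y, inner_sum, inner_smul_right, b.inner_eq_ite]; simp
  set A := ∑ k, (l k)⁻¹ * ⟪b k, z⟫ ^ 2
  set B := ∑ k, (m k)⁻¹ * ⟪t k, z⟫ ^ 2
  have hA0 : 0 ≤ A := Finset.sum_nonneg fun k _ => by have := hl k; positivity
  have hB0 : 0 ≤ B := Finset.sum_nonneg fun k _ => by have := hm k; positivity
  have h1 : ∑ k, l k * ⟪b k, y⟫ ^ 2 = A := Finset.sum_congr rfl fun k _ => by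
    have := (hl k).ne'
    rw [hby]; field_simp
  have h2 : ⟪z, y⟫ = A := by
    rw [← b.sum_inner_mul_inner z y]
    exact Finset.sum_congr rfl fun k _ => by rw [hby, real_inner_comm]; ring
  have h3 : ⟪z, y⟫ ^ 2 ≤ B * ∑ k, m k * ⟪t k, y⟫ ^ 2 := by
    rw [← t.sum_inner_mul_inner z y]
    refine Finset.sum_sq_le_sum_mul_sum_of_sq_le_mul _ (fun k _ => ?_) (fun k _ => ?_)
      fun k _ => ?_
    · have := hm k; positivity
    · have := hm k; positivity
    · have := (hm k).ne'
      rw [real_inner_comm (t k) z]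
      exact le_of_eq (by field_simp)
  have h4 := h y
  rw [h1] at h4
  rw [h2] at h3
  have h5 : A ^ 2 ≤ B * (c * A) := h3.trans (mul_le_mul_of_nonneg_left h4 hB0)
  rcases hA0.lt_or_eq with h6 | h6
  · have : A * A ≤ (c * B) * A := by nlinarith
    exact le_of_mul_le_mul_right this h6
  · rw [← h6]
    rcases hB0.lt_or_eq with h7 | h7
    · rcases le_or_gt 0 c with hc | hc
      · positivity
      · exfalso
        have hz : z ≠ 0 := by
          rintro rfl; simp [B] at h7
        have h8 := h z
        have h9 : 0 < ∑ k, m k * ⟪t k, z⟫ ^ 2 := by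
          rw [← qf_specMat]; exact (posDef_iff_qf.1 (specMat_posDef hm t)).2 z hz
        have h10 : 0 < ∑ k, l k * ⟪b k, z⟫ ^ 2 := by
          rw [← qf_specMat]; exact (posDef_iff_qf.1 (specMat_posDef hl b)).2 z hz
        nlinarith
    · rw [← h7, mul_zero]

/-- The sign statistic in the basis of eigenvectors of the scatter matrix. -/
lemma signStatistic_specMat {lam : Fin p → ℝ} (hlam : ∀ k, 0 < lam k)
    (t : OrthonormalBasis (Fin p) ℝ (EuclideanSpace ℝ (Fin p))) (u : Fin n → Sph p) :
    signStatistic (t 0) u (specMat lam t) = n * p * (p + 2) * ∑ k, if k = 0 then 0 else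
      (lam 0)⁻¹ * (lam k)⁻¹ * ((n : ℝ)⁻¹ * ∑ i, ⟪t 0, (u i : EuclideanSpace ℝ (Fin p))⟫ *
        ⟪t k, (u i : EuclideanSpace ℝ (Fin p))⟫ /
          ∑ j, (lam j)⁻¹ * ⟪t j, (u i : EuclideanSpace ℝ (Fin p))⟫ ^ 2) ^ 2 := by
  rw [signStatistic, ← sum_inner_sq t]
  congr 1
  refine Finset.sum_congr rfl fun k _ => ?_
  have hsymm : (1 - outer (t 0) : Matrix (Fin p) (Fin p) ℝ).transpose = 1 - outer (t 0) := by
    rw [Matrix.transpose_sub, Matrix.transpose_one, isSymm_outer]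
  have h1 : ⟪t k, WithLp.toLp 2 (((1 - outer (t 0)) * signCov u (specMat lam t)).mulVec
      (t 0).ofLp)⟫ = (if k = 0 then 0 else (t k).ofLp) ⬝ᵥ
        (signCov u (specMat lam t)).mulVec (t 0).ofLp := by
    rw [inner_eq_dotProduct, ← Matrix.mulVec_mulVec, Matrix.dotProduct_mulVec,
      ← Matrix.mulVec_transpose, hsymm, Matrix.sub_mulVec, Matrix.one_mulVec, outer_mulVec,
      ← inner_eq_dotProduct (t 0) (t k), t.inner_eq_ite]
    by_cases hk : k = 0
    · subst hk; simp
    · simp [hk, Ne.symm hk]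
  rw [h1]
  by_cases hk : k = 0
  · simp [hk]
  simp only [if_neg hk]
  have hs : ∀ k, ((√(lam k))⁻¹) ^ 2 = (lam k)⁻¹ := fun k => by
    rw [inv_pow, Real.sq_sqrt (hlam k).le]
  have h2 : (t k).ofLp ⬝ᵥ (signCov u (specMat lam t)).mulVec (t 0).ofLp =
      (√(lam 0))⁻¹ * (√(lam k))⁻¹ * ((n : ℝ)⁻¹ * ∑ i,
        ⟪t 0, (u i : EuclideanSpace ℝ (Fin p))⟫ * ⟪t k, (u i : EuclideanSpace ℝ (Fin p))⟫ /
          ∑ j, (lam j)⁻¹ * ⟪t j, (u i : EuclideanSpace ℝ (Fin p))⟫ ^ 2) := by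
    rw [signCov, Matrix.smul_mulVec, dotProduct_smul, Matrix.sum_mulVec, dotProduct_sum,
      smul_eq_mul]
    conv_rhs => rw [mul_left_comm, Finset.mul_sum]
    congr 1
    refine Finset.sum_congr rfl fun i _ => ?_
    rw [norm_sq_invSqrt_mulVec hlam, specMat_inv fun j => (hlam j).ne', qf_specMat,
      Matrix.smul_mulVec, dotProduct_smul, invSqrt_specMat, ← Matrix.mulVec_mulVec,
      ← Matrix.mulVec_mulVec, specMat_mulVec_self, Matrix.mulVec_smul, outer_mulVec,
      Matrix.mulVec_smul, Matrix.mulVec_smul, dotProduct_smul, dotProduct_smul,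
      Matrix.dotProduct_mulVec, ← Matrix.mulVec_transpose, isSymm_specMat, specMat_mulVec_self,
      smul_dotProduct, ← inner_eq_dotProduct, ← inner_eq_dotProduct,
      real_inner_comm (t 0) (u i : EuclideanSpace ℝ (Fin p))]
    simp only [smul_eq_mul]
    ring
  rw [h2, mul_pow, mul_pow, hs, hs]

lemma abs_inv_one_add_sub_le {h H : ℝ} (hh : |h| ≤ H) (hH : H ≤ 1 / 2) :
    |(1 + h)⁻¹ - (1 - h + h ^ 2)| ≤ 2 * H ^ 3 := by
  have h1 := abs_le.1 hh
  have h2 : 1 / 2 ≤ 1 + h := by linarith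
  have hpos : 0 < 1 + h := by linarith
  have h3 : (1 + h)⁻¹ - (1 - h + h ^ 2) = -(h ^ 3) * (1 + h)⁻¹ := by
    have : 1 + h ≠ 0 := hpos.ne'
    field_simp; ring
  rw [h3, abs_mul, abs_neg, abs_pow, abs_of_pos (inv_pos.2 hpos)]
  have h4 : (1 + h)⁻¹ ≤ 2 := by
    rw [inv_le_comm₀ (by linarith) (by norm_num)]; linarith
  calc |h| ^ 3 * (1 + h)⁻¹ ≤ H ^ 3 * 2 :=
        mul_le_mul (pow_le_pow_left₀ (abs_nonneg _) hh 3) h4 (by positivity)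
          (pow_nonneg ((abs_nonneg _).trans hh) 3)
    _ = _ := by ring

/-- Boundedness of the normalized sums of monomials that are odd in the first coordinate and have
degree six. -/
def OddSumsSmall (w : Fin n → EuclideanSpace ℝ (Fin p)) (C : ℝ) : Prop :=
  ∀ j a b c d : Fin p, j ≠ 0 → (a = 0 ↔ b = 0) → (c = 0 ↔ d = 0) →
    |∑ i, w i 0 * w i j * (w i a * w i b) * (w i c * w i d)| ≤ C * √n

lemma sum_coord_sq {x : EuclideanSpace ℝ (Fin p)} (hx : ‖x‖ = 1) : ∑ k, x k * x k = 1 := by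
  have := EuclideanSpace.norm_sq_eq x
  rw [hx] at this
  simp only [Real.norm_eq_abs, sq_abs, one_pow] at this
  rw [this]
  exact Finset.sum_congr rfl fun k _ => by ring

lemma abs_sum_le_of_abs_le {f : Fin p → ℝ} {B : ℝ} (h : ∀ c, |f c| ≤ B) :
    |∑ c, f c| ≤ p * B := by
  refine (Finset.abs_sum_le_sum_abs _ _).trans ((Finset.sum_le_sum fun c _ => h c).trans ?_)
  simp

/-- Inserting `∑ c, (w i c)² = 1` raises the degree by two without changing parity, so control in
degree six covers degrees four and two. -/
lemma OddSumsSmall.degree_four {w : Fin n → EuclideanSpace ℝ (Fin p)} {C : ℝ}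
    (h : OddSumsSmall w C) (hw : ∀ i, ‖w i‖ = 1) {j a b : Fin p} (hj : j ≠ 0)
    (hab : a = 0 ↔ b = 0) : |∑ i, w i 0 * w i j * (w i a * w i b)| ≤ p * (C * √n) := by
  have h1 : ∑ i, w i 0 * w i j * (w i a * w i b) =
      ∑ c, ∑ i, w i 0 * w i j * (w i a * w i b) * (w i c * w i c) := by
    rw [Finset.sum_comm]
    exact Finset.sum_congr rfl fun i _ => by rw [← Finset.mul_sum, sum_coord_sq (hw i), mul_one]
  rw [h1]
  exact abs_sum_le_of_abs_le fun c => h j a b c c hj hab Iff.rfl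

lemma OddSumsSmall.degree_two {w : Fin n → EuclideanSpace ℝ (Fin p)} {C : ℝ}
    (h : OddSumsSmall w C) (hw : ∀ i, ‖w i‖ = 1) {j : Fin p} (hj : j ≠ 0) :
    |∑ i, w i 0 * w i j| ≤ p * (p * (C * √n)) := by
  have h1 : ∑ i, w i 0 * w i j = ∑ c, ∑ i, w i 0 * w i j * (w i c * w i c) := by
    rw [Finset.sum_comm]
    exact Finset.sum_congr rfl fun i _ => by rw [← Finset.mul_sum, sum_coord_sq (hw i), mul_one]
  rw [h1]
  exact abs_sum_le_of_abs_le fun c => h.degree_four hw hj Iff.rfl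

/-- The quadratic form with coefficients `H`. -/
def coefForm (H : Fin p → Fin p → ℝ) (x : EuclideanSpace ℝ (Fin p)) : ℝ :=
  ∑ a, ∑ b, H a b * (x a * x b)

lemma abs_sum_coef_le {H Z : Fin p → Fin p → ℝ} {h B : ℝ}
    (hH : ∀ a b, |H a b| ≤ h) (hH0 : ∀ a b, ¬(a = 0 ↔ b = 0) → H a b = 0) (hB : 0 ≤ B)
    (hZ : ∀ a b, (a = 0 ↔ b = 0) → |Z a b| ≤ B) :
    |∑ a, ∑ b, H a b * Z a b| ≤ p ^ 2 * h * B := by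
  have h1 : |∑ a, ∑ b, H a b * Z a b| ≤ p * (p * (h * B)) :=
    abs_sum_le_of_abs_le fun a => abs_sum_le_of_abs_le fun b => by
      have hh : 0 ≤ h := (abs_nonneg _).trans (hH a b)
      by_cases hab : a = 0 ↔ b = 0
      · rw [abs_mul]; exact mul_le_mul (hH a b) (hZ a b hab) (abs_nonneg _) hh
      · rw [hH0 a b hab, zero_mul, abs_zero]; positivity
  exact h1.trans (le_of_eq (by ring))

lemma abs_coord_le {x : EuclideanSpace ℝ (Fin p)} (hx : ‖x‖ = 1) (k : Fin p) : |x k| ≤ 1 := by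
  rw [← hx, ← Real.norm_eq_abs]; exact PiLp.norm_apply_le x k

/-- Effect, on the normalized sign vector, of a small perturbation of the scatter matrix. -/
lemma OddSumsSmall.weighted_sub_le {w : Fin n → EuclideanSpace ℝ (Fin p)} {C h : ℝ}
    {H : Fin p → Fin p → ℝ} (hO : OddSumsSmall w C) (hC : 0 ≤ C) (hw : ∀ i, ‖w i‖ = 1)
    (hn : n ≠ 0) (hH : ∀ a b, |H a b| ≤ h) (hH0 : ∀ a b, ¬(a = 0 ↔ b = 0) → H a b = 0)
    (hh : p ^ 2 * h ≤ 1 / 2) {j : Fin p} (hj : j ≠ 0) :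
    |(√n)⁻¹ * ∑ i, w i 0 * w i j * (1 + coefForm H (w i))⁻¹ - (√n)⁻¹ * ∑ i, w i 0 * w i j| ≤
      p ^ 3 * C * h + p ^ 4 * C * h ^ 2 + 2 * (p ^ 2 * h) ^ 3 * √n := by
  have hn0 : (0 : ℝ) < n := Nat.cast_pos.2 (Nat.pos_of_ne_zero hn)
  have hsn : 0 < √(n : ℝ) := Real.sqrt_pos.2 hn0
  have hq : ∀ i, |coefForm H (w i)| ≤ p ^ 2 * h := fun i => by
    have := abs_sum_coef_le (Z := fun a b => w i a * w i b) hH hH0 zero_le_one (fun a b _ => by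
      rw [abs_mul]
      exact mul_le_one₀ (abs_coord_le (hw i) a) (abs_nonneg _) (abs_coord_le (hw i) b))
    rwa [mul_one] at this
  have h1 : |∑ i, w i 0 * w i j * coefForm H (w i)| ≤ p ^ 2 * h * (p * (C * √n)) := by
    have h2 : ∑ i, w i 0 * w i j * coefForm H (w i) =
        ∑ a, ∑ b, H a b * ∑ i, w i 0 * w i j * (w i a * w i b) := by
      simp_rw [coefForm, Finset.mul_sum]
      rw [Finset.sum_comm]
      refine Finset.sum_congr rfl fun a _ => ?_
      rw [Finset.sum_comm]
      exact Finset.sum_congr rfl fun b _ => Finset.sum_congr rfl fun i _ => by ring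
    rw [h2]
    exact abs_sum_coef_le hH hH0 (by positivity) fun a b hab => hO.degree_four hw hj hab
  have h2 : |∑ i, w i 0 * w i j * coefForm H (w i) ^ 2| ≤
      p ^ 2 * h * (p ^ 2 * h * (C * √n)) := by
    have h3 : ∑ i, w i 0 * w i j * coefForm H (w i) ^ 2 =
        ∑ a, ∑ b, H a b * ∑ c, ∑ d, H c d *
          ∑ i, w i 0 * w i j * (w i a * w i b) * (w i c * w i d) := by
      simp_rw [sq, coefForm, Finset.sum_mul, Finset.mul_sum]
      rw [Finset.sum_comm]
      refine Finset.sum_congr rfl fun a _ => ?_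
      rw [Finset.sum_comm]
      refine Finset.sum_congr rfl fun b _ => ?_
      rw [Finset.sum_comm]
      refine Finset.sum_congr rfl fun c _ => ?_
      rw [Finset.sum_comm]
      exact Finset.sum_congr rfl fun d _ => Finset.sum_congr rfl fun i _ => by ring
    have hhn : 0 ≤ h := (abs_nonneg _).trans (hH 0 0)
    rw [h3]
    exact abs_sum_coef_le hH hH0 (by positivity) fun a b hab =>
      abs_sum_coef_le hH hH0 (by positivity) fun c d hcd => hO j a b c d hj hab hcd
  -- The third-order remainder is the only place where no cancellation over the sample is used:
  -- after division by `√n` it costs `√n h³`.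
  have h3 : |∑ i, w i 0 * w i j * ((1 + coefForm H (w i))⁻¹ -
      (1 - coefForm H (w i) + coefForm H (w i) ^ 2))| ≤ n * (2 * (p ^ 2 * h) ^ 3) := by
    refine (Finset.abs_sum_le_sum_abs _ _).trans
      ((Finset.sum_le_sum fun i _ => ?_).trans (b := ∑ i : Fin n, 2 * (p ^ 2 * h) ^ 3) ?_)
    · rw [abs_mul]
      have h4 : |w i 0 * w i j| ≤ 1 := by
        rw [abs_mul]
        exact mul_le_one₀ (abs_coord_le (hw i) 0) (abs_nonneg _) (abs_coord_le (hw i) j)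
      have h5 := abs_inv_one_add_sub_le (hq i) hh
      calc _ ≤ 1 * (2 * (p ^ 2 * h) ^ 3) := mul_le_mul h4 h5 (abs_nonneg _) zero_le_one
        _ = _ := one_mul _
    · simp
  have h4 : ∑ i, w i 0 * w i j * (1 + coefForm H (w i))⁻¹ - ∑ i, w i 0 * w i j =
      ∑ i, w i 0 * w i j * ((1 + coefForm H (w i))⁻¹ -
        (1 - coefForm H (w i) + coefForm H (w i) ^ 2)) -
      ∑ i, w i 0 * w i j * coefForm H (w i) + ∑ i, w i 0 * w i j * coefForm H (w i) ^ 2 := by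
    rw [← Finset.sum_sub_distrib, ← Finset.sum_sub_distrib, ← Finset.sum_add_distrib]
    exact Finset.sum_congr rfl fun i _ => by ring
  rw [← mul_sub, h4, abs_mul, abs_of_pos (inv_pos.2 hsn), inv_mul_le_iff₀ hsn]
  have hnn : (n : ℝ) = √n * √n := (Real.mul_self_sqrt hn0.le).symm
  have h5 : √n * (p ^ 3 * C * h + p ^ 4 * C * h ^ 2 + 2 * (p ^ 2 * h) ^ 3 * √n) =
      n * (2 * (p ^ 2 * h) ^ 3) + p ^ 2 * h * (p * (C * √n)) +
        p ^ 2 * h * (p ^ 2 * h * (C * √n)) := by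
    nth_rewrite 3 [hnn]; ring
  rw [h5]
  exact (abs_add_le _ _).trans (add_le_add ((abs_sub _ _).trans (add_le_add h3 h1)) h2)

end

/-! ### The sign statistic in whitened coordinates. -/

section
variable {p n : ℕ} [NeZero p]

/-- The quadratic form of the inverse of `specMat m t`, in the coordinates given by `sqrtMap l b`. -/
def relForm (l m : Fin p → ℝ) (b t : OrthonormalBasis (Fin p) ℝ (EuclideanSpace ℝ (Fin p)))
    (x : EuclideanSpace ℝ (Fin p)) : ℝ :=
  ∑ k, (m k)⁻¹ * ⟪t k, sqrtMap l b x⟫ ^ 2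

variable {l m : Fin p → ℝ} {b t : OrthonormalBasis (Fin p) ℝ (EuclideanSpace ℝ (Fin p))}

lemma inner_sqrtMap (x y : EuclideanSpace ℝ (Fin p)) :
    ⟪y, sqrtMap l b x⟫ = ∑ a, x a * (√(l a) * ⟪y, b a⟫) := by
  simp only [sqrtMap, LinearMap.coe_mk, AddHom.coe_mk, inner_sum, inner_smul_right]
  exact Finset.sum_congr rfl fun a _ => by ring

/-- The statistic involves the inverse scatter matrix, so the two-sided comparison is inverted in
both directions; `1 / (1 - η) ≤ 1 + 2 η` for `η ≤ 1/4` yields the factor `2`. -/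
lemma abs_relForm_sub_le {η : ℝ} (hl : ∀ k, 0 < l k) (hm : ∀ k, 0 < m k) (hη0 : 0 ≤ η)
    (hη : η ≤ 1 / 4)
    (h : ∀ y, |∑ k, m k * ⟪t k, y⟫ ^ 2 - ∑ k, l k * ⟪b k, y⟫ ^ 2| ≤
      η * ∑ k, l k * ⟪b k, y⟫ ^ 2) (x : EuclideanSpace ℝ (Fin p)) :
    |relForm l m b t x - ‖x‖ ^ 2| ≤ 2 * η * ‖x‖ ^ 2 := by
  have hx : ∑ k, (l k)⁻¹ * ⟪b k, sqrtMap l b x⟫ ^ 2 = ‖x‖ ^ 2 := by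
    rw [EuclideanSpace.norm_sq_eq]
    refine Finset.sum_congr rfl fun k _ => ?_
    rw [inner_basis_sqrtMap, mul_pow, Real.sq_sqrt (hl k).le, Real.norm_eq_abs, sq_abs,
      inv_mul_cancel_left₀ (hl k).ne']
  have h1 := sum_inv_mul_sq_le_of_le hl hm (c := 1 + η) (fun y => by
    have := (abs_le.1 (h y)).2; linarith) (sqrtMap l b x)
  have h2 := sum_inv_mul_sq_le_of_le hm hl (c := (1 - η)⁻¹) (fun y => by
    have := (abs_le.1 (h y)).1
    rw [← div_eq_inv_mul, le_div_iff₀ (by linarith)]; linarith) (sqrtMap l b x)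
  rw [hx] at h1 h2
  rw [← div_eq_inv_mul, le_div_iff₀ (by linarith)] at h2
  change ‖x‖ ^ 2 ≤ (1 + η) * relForm l m b t x at h1
  change relForm l m b t x * (1 - η) ≤ ‖x‖ ^ 2 at h2
  set A := relForm l m b t x
  set B := ‖x‖ ^ 2
  have hB : 0 ≤ B := sq_nonneg _
  have hηB : 0 ≤ η * B := mul_nonneg hη0 hB
  have hA : A ≤ 2 * B := by nlinarith
  rw [abs_le]
  constructor
  · nlinarith [mul_le_mul_of_nonneg_left hA hη0]
  · nlinarith [mul_le_mul_of_nonneg_left hA hη0]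

/-- The normalized sign vector orthogonal to the first axis, for a general weight. -/
def signVec (w : Fin n → EuclideanSpace ℝ (Fin p)) (D : EuclideanSpace ℝ (Fin p) → ℝ) :
    EuclideanSpace ℝ (Fin p) :=
  WithLp.toLp 2 fun j => if j = 0 then 0 else (√n)⁻¹ * ∑ i, w i 0 * w i j * (D (w i))⁻¹

lemma inner_zero_sqrtMap (ht : t 0 = b 0) (x : EuclideanSpace ℝ (Fin p)) :
    ⟪t 0, sqrtMap l b x⟫ = √(l 0) * x 0 := by
  rw [ht, inner_basis_sqrtMap]

/-- Setting the first coordinate of `signVec` to zero loses nothing here: `t k` is orthogonal to `b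
0`, so that coordinate would not contribute. -/
lemma inner_sqrtMap_signVec (ht : t 0 = b 0) (w : Fin n → EuclideanSpace ℝ (Fin p))
    (D : EuclideanSpace ℝ (Fin p) → ℝ) {k : Fin p} (hk : k ≠ 0) :
    ⟪t k, sqrtMap l b (signVec w D)⟫ =
      (√n)⁻¹ * ∑ i, w i 0 * ⟪t k, sqrtMap l b (w i)⟫ * (D (w i))⁻¹ := by
  have h0 : ⟪t k, b 0⟫ = 0 := by rw [← ht, t.inner_eq_ite, if_neg hk]
  simp_rw [inner_sqrtMap, Finset.mul_sum, Finset.sum_mul, Finset.mul_sum]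
  rw [Finset.sum_comm]
  refine Finset.sum_congr rfl fun a _ => ?_
  simp only [signVec]
  by_cases ha : a = 0
  · subst ha; simp [h0]
  · rw [if_neg ha, Finset.mul_sum, Finset.sum_mul]
    exact Finset.sum_congr rfl fun i _ => by ring

/-- The sign statistic as a quadratic form in the normalized sign vector. -/
lemma signStatistic_eq_relForm {lam : Fin p → ℝ} {s : ℝ} (hs : 0 < s) (hl : ∀ k, 0 < l k)
    (hlam : ∀ k, 0 < lam k) (hn : n ≠ 0) (ht : t 0 = b 0) {u : Fin n → Sph p}
    {w : Fin n → EuclideanSpace ℝ (Fin p)} {c : Fin n → ℝ} (hc : ∀ i, 0 < c i)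
    (hu : ∀ i, (u i : EuclideanSpace ℝ (Fin p)) = c i • sqrtMap l b (w i)) :
    signStatistic (b 0) u (specMat lam t) = p * (p + 2) * (l 0 / (s * lam 0)) *
      relForm l (fun k => s * lam k) b t (signVec w (relForm l (fun k => s * lam k) b t)) := by
  have hn0 : (0 : ℝ) < n := Nat.cast_pos.2 (Nat.pos_of_ne_zero hn)
  have hsn : (√(n : ℝ)) ^ 2 = n := Real.sq_sqrt hn0.le
  have hsn0 : 0 < √(n : ℝ) := Real.sqrt_pos.2 hn0
  set D := relForm l (fun k => s * lam k) b t
  set R := signVec w D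
  have hD : ∀ i, ∑ j, (lam j)⁻¹ * ⟪t j, (u i : EuclideanSpace ℝ (Fin p))⟫ ^ 2 =
      c i ^ 2 * (s * D (w i)) := by
    intro i
    simp only [D, relForm, Finset.mul_sum]
    refine Finset.sum_congr rfl fun j _ => ?_
    rw [hu i, inner_smul_right, mul_inv]
    field_simp
  have hR0 : R 0 = 0 := by simp [R, signVec]
  rw [← ht, signStatistic_specMat hlam]
  rw [show D R = ∑ k, (s * lam k)⁻¹ * ⟪t k, sqrtMap l b R⟫ ^ 2
    from rfl, Finset.mul_sum, Finset.mul_sum]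
  refine Finset.sum_congr rfl fun k _ => ?_
  by_cases hk : k = 0
  · subst hk
    rw [if_pos rfl, inner_zero_sqrtMap ht, hR0]; simp
  · rw [if_neg hk, inner_sqrtMap_signVec ht w D hk]
    have h1 : ∑ i, ⟪t 0, (u i : EuclideanSpace ℝ (Fin p))⟫ *
        ⟪t k, (u i : EuclideanSpace ℝ (Fin p))⟫ /
          ∑ j, (lam j)⁻¹ * ⟪t j, (u i : EuclideanSpace ℝ (Fin p))⟫ ^ 2 =
        √(l 0) * s⁻¹ * ∑ i, w i 0 * ⟪t k, sqrtMap l b (w i)⟫ * (D (w i))⁻¹ := by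
      rw [Finset.mul_sum]
      refine Finset.sum_congr rfl fun i _ => ?_
      rw [hD i, hu i, inner_smul_right, inner_smul_right, inner_zero_sqrtMap ht]
      have := (hc i).ne'
      rw [div_eq_mul_inv, mul_inv, mul_inv]
      field_simp
    rw [h1]
    set Y := ∑ i, w i 0 * ⟪t k, sqrtMap l b (w i)⟫ * (D (w i))⁻¹
    have h2 : ((n : ℝ)⁻¹ * (√(l 0) * s⁻¹ * Y)) ^ 2 = (n : ℝ)⁻¹ ^ 2 * (l 0 * s⁻¹ ^ 2 * Y ^ 2) := by
      rw [mul_pow, mul_pow, mul_pow, Real.sq_sqrt (hl 0).le]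
    have h3 : ((√(n : ℝ))⁻¹ * Y) ^ 2 = (n : ℝ)⁻¹ * Y ^ 2 := by
      rw [mul_pow, inv_pow, hsn]
    rw [h2, h3]
    have := (hlam 0).ne'
    have := (hlam k).ne'
    field_simp

/-- The limiting form of the sign statistic, for a spherical sample. -/
def scoreStat (w : Fin n → EuclideanSpace ℝ (Fin p)) : ℝ :=
  p * (p + 2) * ‖signVec w fun _ => 1‖ ^ 2

/-- The sign statistic is close to its spherical version if the scatter matrix is close enough to
the true one. -/
theorem signStatistic_approx (p : ℕ) [NeZero p] {C : ℝ} (hC : 0 ≤ C) : ∃ K : ℝ, 0 ≤ K ∧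
    ∀ {n : ℕ} {l lam : Fin p → ℝ} {b t : OrthonormalBasis (Fin p) ℝ (EuclideanSpace ℝ (Fin p))}
    {s η : ℝ} {u : Fin n → Sph p} {w : Fin n → EuclideanSpace ℝ (Fin p)} {c : Fin n → ℝ},
    n ≠ 0 → 0 < s → (∀ k, 0 < l k) → (∀ k, 0 < lam k) → t 0 = b 0 → (∀ i, 0 < c i) →
    (∀ i, (u i : EuclideanSpace ℝ (Fin p)) = c i • sqrtMap l b (w i)) → (∀ i, ‖w i‖ = 1) →
    OddSumsSmall w C → 0 ≤ η → 4 * p ^ 2 * η ≤ 1 → η + √n * η ^ 3 ≤ 1 →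
    (∀ y, |∑ k, s * lam k * ⟪t k, y⟫ ^ 2 - ∑ k, l k * ⟪b k, y⟫ ^ 2| ≤
      η * ∑ k, l k * ⟪b k, y⟫ ^ 2) →
    |signStatistic (b 0) u (specMat lam t) - scoreStat w| ≤ K * (η + √n * η ^ 3) := by
  have hp0 : (0 : ℝ) < p := Nat.cast_pos.2 (Nat.pos_of_ne_zero (NeZero.ne p))
  have hp1 : (1 : ℝ) ≤ p := Nat.one_le_cast.2 (Nat.pos_of_ne_zero (NeZero.ne p))
  -- `A` is the sum of the coefficients in `OddSumsSmall.weighted_sub_le` at `h = 2 η`, and `a`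
  -- bounds the coordinates of the unperturbed sign vector through `OddSumsSmall.degree_two`.
  set A : ℝ := 2 * p ^ 3 * C + 4 * p ^ 4 * C + 16 * p ^ 6
  set a : ℝ := p ^ 2 * C
  have hA : 0 ≤ A := by positivity
  have ha : 0 ≤ a := by positivity
  refine ⟨p * (p + 2) * (8 * (p * (a + A) ^ 2) + p * (A * (2 * a + A))), by positivity, ?_⟩
  intro n l lam b t s η u w c hn hs hl hlam ht hc hu hw hO hη0 hη hη1 hclose
  have hn0 : (0 : ℝ) < n := Nat.cast_pos.2 (Nat.pos_of_ne_zero hn)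
  have hsn0 : 0 < √(n : ℝ) := Real.sqrt_pos.2 hn0
  have hη4 : η ≤ 1 / 4 := by
    have : 4 * (p : ℝ) ^ 2 * η ≥ 4 * 1 * η := by
      gcongr; exact one_le_pow₀ hp1
    linarith
  set m : Fin p → ℝ := fun k => s * lam k
  have hm : ∀ k, 0 < m k := fun k => mul_pos hs (hlam k)
  set D := relForm l m b t
  have hD : ∀ x, |D x - ‖x‖ ^ 2| ≤ 2 * η * ‖x‖ ^ 2 :=
    abs_relForm_sub_le hl hm hη0 hη4 hclose
  rw [signStatistic_eq_relForm hs hl hlam hn ht hc hu, scoreStat]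
  change |p * (p + 2) * (l 0 / m 0) * D (signVec w D) - _| ≤ _
  -- the coefficients of the quadratic form `D`
  set g : Fin p → Fin p → ℝ := fun k a => √(l a) * ⟪t k, b a⟫
  set H : Fin p → Fin p → ℝ := fun a b =>
    ∑ k, (m k)⁻¹ * (g k a * g k b) - if a = b then 1 else 0
  have hDg : ∀ x, D x = ∑ k, (m k)⁻¹ * (∑ a, x a * g k a) ^ 2 := fun x => by
    simp only [D, relForm, inner_sqrtMap]; rfl
  have hDH : ∀ i, 1 + coefForm H (w i) = D (w i) := by
    intro i
    have h1 : coefForm H (w i) = ∑ a, ∑ b, ∑ k, (m k)⁻¹ * (g k a * g k b) * (w i a * w i b) -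
        ∑ a, w i a * w i a := by
      simp only [coefForm, H, sub_mul, Finset.sum_sub_distrib, Finset.sum_mul]
      congr 1
      exact Finset.sum_congr rfl fun a _ => by simp
    have h2 : D (w i) = ∑ a, ∑ b, ∑ k, (m k)⁻¹ * (g k a * g k b) * (w i a * w i b) := by
      rw [hDg]
      simp_rw [sq, Finset.sum_mul_sum, Finset.mul_sum]
      rw [Finset.sum_comm]
      refine Finset.sum_congr rfl fun a _ => ?_
      rw [Finset.sum_comm]
      exact Finset.sum_congr rfl fun b _ => Finset.sum_congr rfl fun k _ => by ring
    rw [h1, h2, sum_coord_sq (hw i)]; ring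
  have hgs : ∀ (a : Fin p) k (x : ℝ), ∑ c, (EuclideanSpace.single a x) c * g k c = x * g k a := by
    intro a k x
    rw [Finset.sum_eq_single a]
    · simp
    · intro c _ hca; simp [hca]
    · simp
  have hH : ∀ a b, |H a b| ≤ 2 * η := by
    intro a c
    set x : EuclideanSpace ℝ (Fin p) := EuclideanSpace.single a 1
    set y : EuclideanSpace ℝ (Fin p) := EuclideanSpace.single c 1
    have h1 := hD (x + y)
    have h2 := hD (x - y)
    have hx : ‖x‖ ^ 2 = 1 := by simp [x]
    have hy : ‖y‖ ^ 2 = 1 := by simp [y]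
    have hxy : ⟪x, y⟫ = if a = c then 1 else 0 := by
      simp only [x, y, EuclideanSpace.inner_single_left]; simp
    have h3 : D (x + y) = ∑ k, (m k)⁻¹ * (g k a + g k c) ^ 2 := by
      rw [hDg]
      refine Finset.sum_congr rfl fun k _ => ?_
      simp only [PiLp.add_apply, add_mul, Finset.sum_add_distrib, x, y, hgs, one_mul]
    have h4 : D (x - y) = ∑ k, (m k)⁻¹ * (g k a - g k c) ^ 2 := by
      rw [hDg]
      refine Finset.sum_congr rfl fun k _ => ?_
      simp only [PiLp.sub_apply, sub_mul, Finset.sum_sub_distrib, x, y, hgs, one_mul]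
    have h5 : D (x + y) - D (x - y) = 4 * ∑ k, (m k)⁻¹ * (g k a * g k c) := by
      rw [h3, h4, ← Finset.sum_sub_distrib, Finset.mul_sum]
      exact Finset.sum_congr rfl fun k _ => by ring
    rw [norm_add_sq_real, hx, hy, hxy] at h1
    rw [norm_sub_sq_real, hx, hy, hxy] at h2
    simp only [H]
    rw [abs_le] at h1 h2 ⊢
    split_ifs at * <;> constructor <;> linarith
  have hg0 : ∀ k a, k ≠ 0 → a = 0 → g k a = 0 := fun k a hk ha => by
    simp only [g]; rw [ha, ← ht, t.inner_eq_ite, if_neg hk, mul_zero]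
  have hg1 : ∀ k a, k = 0 → a ≠ 0 → g k a = 0 := fun k a hk ha => by
    simp only [g]; rw [hk, ht, b.inner_eq_ite, if_neg (Ne.symm ha), mul_zero]
  -- Here `t 0 = b 0` matters: the perturbation has no entries linking the first axis to the others,
  -- so all the monomials produced by the expansion remain odd in the first coordinate.
  have hH0 : ∀ a b, ¬(a = 0 ↔ b = 0) → H a b = 0 := by
    intro a c hac
    have hne : a ≠ c := fun h => hac (by rw [h])
    simp only [H]
    rw [if_neg hne, sub_zero]
    refine Finset.sum_eq_zero fun k _ => ?_
    by_cases hk : k = 0 <;> by_cases ha0 : a = 0 <;> by_cases hc0 : c = 0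
    · exact absurd (iff_of_true ha0 hc0) hac
    · rw [hg1 k c hk hc0]; ring
    · rw [hg1 k a hk ha0]; ring
    · exact absurd (iff_of_false ha0 hc0) hac
    · exact absurd (iff_of_true ha0 hc0) hac
    · rw [hg0 k a hk ha0]; ring
    · rw [hg0 k c hk hc0]; ring
    · exact absurd (iff_of_false ha0 hc0) hac
  -- comparison of the sign vectors
  set x := η + √n * η ^ 3
  have hx0 : 0 ≤ x := by positivity
  have hηx : η ≤ x := le_add_of_nonneg_right (by positivity)
  have hcx : √n * η ^ 3 ≤ x := le_add_of_nonneg_left hη0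
  set R := signVec w D
  set R0 := signVec w fun _ => (1 : ℝ)
  have hRd : ∀ j, |R j - R0 j| ≤ A * x := by
    intro j
    by_cases hj : j = 0
    · simp only [R, R0, signVec, hj, if_true, sub_self, abs_zero]; positivity
    · have h1 := hO.weighted_sub_le hC hw hn hH hH0 (by linarith) hj
      simp_rw [hDH] at h1
      simp only [R, R0, signVec, if_neg hj, inv_one, mul_one]
      refine h1.trans ?_
      have h2 : η ^ 2 ≤ x := by nlinarith
      calc _ = 2 * p ^ 3 * C * η + 4 * p ^ 4 * C * η ^ 2 + 16 * p ^ 6 * (√n * η ^ 3) := by ring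
        _ ≤ 2 * p ^ 3 * C * x + 4 * p ^ 4 * C * x + 16 * p ^ 6 * x := by gcongr
        _ = A * x := by simp only [A]; ring
  have hR0 : ∀ j, |R0 j| ≤ a := by
    intro j
    by_cases hj : j = 0
    · simp only [R0, signVec, hj, if_true, abs_zero]; exact ha
    · have h1 := hO.degree_two hw hj
      simp only [R0, signVec, if_neg hj, inv_one, mul_one]
      rw [abs_mul, abs_of_pos (inv_pos.2 hsn0), inv_mul_le_iff₀ hsn0]
      exact h1.trans (le_of_eq (by simp only [a]; ring))
  have hR : ∀ j, |R j| ≤ a + A := fun j => by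
    have h1 : R j = R0 j + (R j - R0 j) := by ring
    rw [h1]
    refine (abs_add_le _ _).trans (add_le_add (hR0 j) ((hRd j).trans ?_))
    exact mul_le_of_le_one_right hA hη1
  have hnR : ‖R‖ ^ 2 ≤ p * (a + A) ^ 2 := by
    rw [EuclideanSpace.norm_sq_eq]
    calc _ ≤ ∑ j : Fin p, (a + A) ^ 2 := Finset.sum_le_sum fun j _ =>
          pow_le_pow_left₀ (norm_nonneg _) (hR j) 2
      _ = _ := by simp
  have hnd : |‖R‖ ^ 2 - ‖R0‖ ^ 2| ≤ p * (A * (2 * a + A)) * x := by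
    rw [EuclideanSpace.norm_sq_eq, EuclideanSpace.norm_sq_eq, ← Finset.sum_sub_distrib]
    have h1 : ∀ j, |‖R j‖ ^ 2 - ‖R0 j‖ ^ 2| ≤ A * x * (2 * a + A) := by
      intro j
      have h2 : ‖R j‖ ^ 2 - ‖R0 j‖ ^ 2 = (R j - R0 j) * (R j + R0 j) := by
        rw [Real.norm_eq_abs, Real.norm_eq_abs, sq_abs, sq_abs]; ring
      rw [h2, abs_mul]
      refine mul_le_mul (hRd j) ?_ (abs_nonneg _) (by positivity)
      refine (abs_add_le _ _).trans ?_
      linarith [hR j, hR0 j]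
    exact (abs_sum_le_of_abs_le h1).trans (le_of_eq (by ring))
  -- The scalar prefactor is itself a value of the form `D`, so the same relative bound controls it.
  have hl0 : D (e0 p) = l 0 / m 0 := by
    rw [hDg, Finset.sum_eq_single 0]
    · simp only [e0, hgs, one_mul, g]
      rw [ht, real_inner_self_eq_norm_sq, b.norm_eq_one]
      simp only [one_pow, mul_one]
      rw [Real.sq_sqrt (hl 0).le, div_eq_inv_mul]
    · intro k _ hk
      simp only [e0, hgs, hg0 k 0 hk rfl]; simp
    · simp
  have h0 := hD (e0 p)
  rw [hl0, norm_e0] at h0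
  have hDR := hD R
  set z := l 0 / m 0
  have hmain : |z * D R - ‖R‖ ^ 2| ≤ 8 * (p * (a + A) ^ 2) * x := by
    have h1 : z * D R - ‖R‖ ^ 2 = z * (D R - ‖R‖ ^ 2) + (z - 1) * ‖R‖ ^ 2 := by ring
    have hz : |z - 1| ≤ 2 * η := by
      have : |z - 1 ^ 2| ≤ 2 * η * 1 ^ 2 := h0
      simpa using this
    have hz2 : |z| ≤ 2 := by
      rw [abs_le] at hz ⊢; constructor <;> linarith
    rw [h1]
    calc _ ≤ |z| * |D R - ‖R‖ ^ 2| + |z - 1| * ‖R‖ ^ 2 := by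
          refine (abs_add_le _ _).trans (le_of_eq ?_)
          rw [abs_mul, abs_mul, abs_of_nonneg (sq_nonneg ‖R‖)]
      _ ≤ 2 * (2 * η * ‖R‖ ^ 2) + 2 * η * ‖R‖ ^ 2 := by gcongr
      _ = 6 * η * ‖R‖ ^ 2 := by ring
      _ ≤ 8 * x * (p * (a + A) ^ 2) := by gcongr; norm_num
      _ = _ := by ring
  have hfin : p * (p + 2) * z * D R - p * (p + 2) * ‖R0‖ ^ 2 =
      p * (p + 2) * ((z * D R - ‖R‖ ^ 2) + (‖R‖ ^ 2 - ‖R0‖ ^ 2)) := by ring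
  have hpp : 0 < (p : ℝ) * (p + 2) := by positivity
  rw [hfin, abs_mul, abs_of_pos hpp]
  refine (mul_le_mul_of_nonneg_left ((abs_add_le _ _).trans (add_le_add hmain hnd))
    hpp.le).trans (le_of_eq ?_)
  ring

end

/-! ### Moment conditions hold with high probability. -/

section
variable {p n : ℕ} [NeZero p]

/-- Chebyshev's inequality for sums of bounded functions of a uniform sample. -/
lemma measure_abs_sum_sub_gt_le {f : Sph p → ℝ} (hf : Continuous f) (hf1 : ∀ u, |f u| ≤ 1)
    (hn : n ≠ 0) {c : ℝ} (hc : 0 < c) :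
    (Measure.pi fun _ : Fin n => unif p) {u | c * √n < |∑ i, f (u i) - n * ∫ x, f x ∂(unif p)|} ≤
      ENNReal.ofReal (1 / c ^ 2) := by
  have hn0 : (0 : ℝ) < n := Nat.cast_pos.2 (Nat.pos_of_ne_zero hn)
  have hmem : MemLp f 2 (unif p) :=
    MemLp.of_bound hf.aestronglyMeasurable 1 (ae_of_all _ fun u => by simpa using hf1 u)
  have hmem' : ∀ i : Fin n, MemLp (fun u : Fin n → Sph p => f (u i)) 2
      (Measure.pi fun _ : Fin n => unif p) := fun i =>
    hmem.comp_measurePreserving (measurePreserving_eval _ i)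
  have hvar : Var[∑ i : Fin n, fun u : Fin n → Sph p => f (u i);
      Measure.pi fun _ : Fin n => unif p] ≤ n := by
    rw [variance_sum_pi fun _ => hmem]
    calc _ ≤ ∑ i : Fin n, (1 : ℝ) := Finset.sum_le_sum fun i _ => by
          refine (variance_le_expectation_sq hf.aestronglyMeasurable).trans ?_
          calc ∫ x, (f ^ 2) x ∂(unif p) ≤ ∫ _, (1 : ℝ) ∂(unif p) := by
                refine integral_mono hmem.integrable_sq (integrable_const _) fun u => ?_
                simp only [Pi.pow_apply]
                rw [← sq_abs]; exact pow_le_one₀ (abs_nonneg _) (hf1 u)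
            _ = 1 := by simp
      _ = n := by simp
  have hmean : ∫ u, (∑ i : Fin n, fun u : Fin n → Sph p => f (u i)) u
      ∂(Measure.pi fun _ : Fin n => unif p) = n * ∫ x, f x ∂(unif p) := by
    simp only [Finset.sum_apply]
    rw [integral_finsetSum]
    · have : ∀ i : Fin n, ∫ u : Fin n → Sph p, f (u i) ∂(Measure.pi fun _ : Fin n => unif p) =
          ∫ x, f x ∂(unif p) := fun i => by
        have h := integral_map (μ := Measure.pi fun _ : Fin n => unif p)
          (measurable_pi_apply i).aemeasurable (f := f) hf.aestronglyMeasurable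
        rw [show Measure.map (fun u : Fin n → Sph p => u i) (Measure.pi fun _ => unif p) = unif p
          from (measurePreserving_eval (fun _ : Fin n => unif p) i).map_eq] at h
        exact h.symm
      simp [this]
    · exact fun i _ => (hmem' i).integrable (by norm_num)
  have hch := meas_ge_le_variance_div_sq (memLp_finsetSum' Finset.univ fun i _ => hmem' i)
    (c := c * √n) (by positivity)
  rw [hmean] at hch
  refine (measure_mono fun u hu => ?_).trans (hch.trans (ENNReal.ofReal_le_ofReal ?_))
  · rw [Set.mem_ofPred_eq] at hu ⊢
    simp only [Finset.sum_apply]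
    exact hu.le
  · rw [mul_pow, Real.sq_sqrt hn0.le, div_le_div_iff₀ (by positivity) (by positivity)]
    have := mul_le_mul_of_nonneg_right hvar (sq_nonneg c)
    linarith

/-- Simultaneous version for a finite family of functions. -/
lemma measure_exists_abs_sum_sub_gt_le {ι : Type*} [Fintype ι] {f : ι → Sph p → ℝ}
    (hf : ∀ k, Continuous (f k)) (hf1 : ∀ k u, |f k u| ≤ 1) (hn : n ≠ 0) {c : ℝ} (hc : 0 < c) :
    (Measure.pi fun _ : Fin n => unif p)
      {u | ∃ k, c * √n < |∑ i, f k (u i) - n * ∫ x, f k x ∂(unif p)|} ≤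
      ENNReal.ofReal (Fintype.card ι / c ^ 2) := by
  have h1 : {u : Fin n → Sph p | ∃ k, c * √n < |∑ i, f k (u i) - n * ∫ x, f k x ∂(unif p)|} =
      ⋃ k, {u | c * √n < |∑ i, f k (u i) - n * ∫ x, f k x ∂(unif p)|} := by
    ext u; simp
  rw [h1]
  refine (measure_iUnion_fintype_le _ _).trans
    ((Finset.sum_le_sum fun k _ => measure_abs_sum_sub_gt_le (hf k) (hf1 k) hn hc).trans ?_)
  rw [Finset.sum_const, Finset.card_univ, nsmul_eq_mul,
    div_eq_mul_one_div (Fintype.card ι : ℝ), ENNReal.ofReal_mul (Nat.cast_nonneg _), ENNReal.ofReal_natCast]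

lemma abs_coord_sph_le (u : Sph p) (k : Fin p) : |(u : EuclideanSpace ℝ (Fin p)) k| ≤ 1 :=
  abs_coord_le (norm_eq_of_mem_sphere u) k

/-- Monomials of degree four in the coordinates. -/
def mono4 (q : Fin p × Fin p × Fin p × Fin p) (u : Sph p) : ℝ :=
  (u : EuclideanSpace ℝ (Fin p)) q.1 * (u : EuclideanSpace ℝ (Fin p)) q.2.1 *
    ((u : EuclideanSpace ℝ (Fin p)) q.2.2.1 * (u : EuclideanSpace ℝ (Fin p)) q.2.2.2)

lemma continuous_mono4 (q : Fin p × Fin p × Fin p × Fin p) : Continuous (mono4 q) := by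
  unfold mono4; fun_prop

lemma abs_mul_le_one {a b : ℝ} (ha : |a| ≤ 1) (hb : |b| ≤ 1) : |a * b| ≤ 1 := by
  rw [abs_mul]; exact mul_le_one₀ ha (abs_nonneg _) hb

lemma abs_mono4_le (q : Fin p × Fin p × Fin p × Fin p) (u : Sph p) : |mono4 q u| ≤ 1 :=
  abs_mul_le_one (abs_mul_le_one (abs_coord_sph_le _ _) (abs_coord_sph_le _ _))
    (abs_mul_le_one (abs_coord_sph_le _ _) (abs_coord_sph_le _ _))

lemma inner_sq_mul_inner_sq_eq (x y : EuclideanSpace ℝ (Fin p)) (u : Sph p) :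
    ⟪x, (u : EuclideanSpace ℝ (Fin p))⟫ ^ 2 * ⟪y, (u : EuclideanSpace ℝ (Fin p))⟫ ^ 2 =
      ∑ q : Fin p × Fin p × Fin p × Fin p,
        x q.1 * x q.2.1 * (y q.2.2.1 * y q.2.2.2) * mono4 q u := by
  have h : ∀ z : EuclideanSpace ℝ (Fin p), ⟪z, (u : EuclideanSpace ℝ (Fin p))⟫ ^ 2 =
      ∑ a, ∑ b, z a * z b * ((u : EuclideanSpace ℝ (Fin p)) a *
        (u : EuclideanSpace ℝ (Fin p)) b) := fun z => by
    rw [inner_eq_dotProduct, dotProduct, sq, Finset.sum_mul_sum]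
    exact Finset.sum_congr rfl fun a _ => Finset.sum_congr rfl fun b _ => by ring
  rw [h x, h y]
  simp_rw [Fintype.sum_prod_type, Finset.sum_mul, Finset.mul_sum]
  exact Finset.sum_congr rfl fun a _ => Finset.sum_congr rfl fun b _ =>
    Finset.sum_congr rfl fun c _ => Finset.sum_congr rfl fun d _ => by simp only [mono4]; ring

lemma sq_sum_abs_le (x : EuclideanSpace ℝ (Fin p)) : (∑ a, |x a|) ^ 2 ≤ p * ‖x‖ ^ 2 := by
  rw [EuclideanSpace.norm_sq_eq]
  have := sq_sum_le_card_mul_sum_sq (s := Finset.univ) (f := fun a => |x a|)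
  simpa using this

/-- Expanding in monomials makes finitely many deviations control all `x` and `y` at once. The
coefficients sum in absolute value to `(∑ |x a|)² (∑ |y a|)² ≤ p² ‖x‖² ‖y‖²`. -/
lemma fourthMomentsClose_of_mono4 {u : Fin n → Sph p} {c : ℝ} (hn : n ≠ 0)
    (h : ∀ q, |∑ i, mono4 q (u i) - n * ∫ x, mono4 q x ∂(unif p)| ≤ c * √n) :
    FourthMomentsClose (fun i => (u i : EuclideanSpace ℝ (Fin p))) (p ^ 2 * c / √n) := by
  have hn0 : (0 : ℝ) < n := Nat.cast_pos.2 (Nat.pos_of_ne_zero hn)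
  have hsn : 0 < √(n : ℝ) := Real.sqrt_pos.2 hn0
  have hcn : 0 ≤ c := by
    have := (abs_nonneg _).trans (h (0, 0, 0, 0))
    exact nonneg_of_mul_nonneg_left this hsn
  intro x y
  rw [← integral_inner_sq_mul_inner_sq]
  simp_rw [inner_sq_mul_inner_sq_eq]
  rw [integral_finsetSum _ fun q _ => (integrable_unif (continuous_mono4 q)).const_mul _,
    Finset.sum_comm]
  simp_rw [integral_const_mul, ← Finset.mul_sum]
  have h1 : (n : ℝ)⁻¹ * ∑ q : Fin p × Fin p × Fin p × Fin p,
        x q.1 * x q.2.1 * (y q.2.2.1 * y q.2.2.2) * ∑ i, mono4 q (u i) -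
      ∑ q : Fin p × Fin p × Fin p × Fin p,
        x q.1 * x q.2.1 * (y q.2.2.1 * y q.2.2.2) * ∫ v, mono4 q v ∂(unif p) =
      (n : ℝ)⁻¹ * ∑ q : Fin p × Fin p × Fin p × Fin p,
        x q.1 * x q.2.1 * (y q.2.2.1 * y q.2.2.2) *
          (∑ i, mono4 q (u i) - n * ∫ v, mono4 q v ∂(unif p)) := by
    simp_rw [mul_sub, Finset.sum_sub_distrib]
    rw [mul_sub]
    congr 1
    rw [Finset.mul_sum]
    refine Finset.sum_congr rfl fun q _ => ?_
    field_simp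
  have h2 : |∑ q : Fin p × Fin p × Fin p × Fin p, x q.1 * x q.2.1 * (y q.2.2.1 * y q.2.2.2) *
          (∑ i, mono4 q (u i) - n * ∫ v, mono4 q v ∂(unif p))| ≤
      (∑ a, |x a|) ^ 2 * (∑ a, |y a|) ^ 2 * (c * √n) := by
    refine (Finset.abs_sum_le_sum_abs _ _).trans ?_
    calc _ ≤ ∑ q : Fin p × Fin p × Fin p × Fin p,
          |x q.1| * |x q.2.1| * (|y q.2.2.1| * |y q.2.2.2|) * (c * √n) :=
          Finset.sum_le_sum fun q _ => by
            rw [abs_mul, abs_mul, abs_mul, abs_mul]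
            exact mul_le_mul_of_nonneg_left (h q) (by positivity)
      _ = _ := by
          rw [← Finset.sum_mul]
          congr 1
          rw [sq, sq, Finset.sum_mul_sum, Finset.sum_mul_sum]
          simp_rw [Fintype.sum_prod_type, Finset.sum_mul, Finset.mul_sum]
  rw [h1, abs_mul, abs_of_pos (inv_pos.2 hn0)]
  calc (n : ℝ)⁻¹ * _ ≤ (n : ℝ)⁻¹ * ((p * ‖x‖ ^ 2) * (p * ‖y‖ ^ 2) * (c * √n)) := by
        refine mul_le_mul_of_nonneg_left (h2.trans ?_) (inv_pos.2 hn0).le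
        gcongr
        · exact sq_sum_abs_le x
        · exact sq_sum_abs_le y
    _ = _ := by
        have hs : (n : ℝ) = √n * √n := (Real.mul_self_sqrt hn0.le).symm
        rw [show (n : ℝ)⁻¹ = (√n)⁻¹ * (√n)⁻¹ by rw [← mul_inv, ← hs]]
        field_simp

/-- Monomials that are odd in the first coordinate, vanishing for other indices. -/
def oddMono (q : Fin p × Fin p × Fin p × Fin p × Fin p) (u : Sph p) : ℝ :=
  if q.1 ≠ 0 ∧ (q.2.1 = 0 ↔ q.2.2.1 = 0) ∧ (q.2.2.2.1 = 0 ↔ q.2.2.2.2 = 0) then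
    (u : EuclideanSpace ℝ (Fin p)) 0 * (u : EuclideanSpace ℝ (Fin p)) q.1 *
      ((u : EuclideanSpace ℝ (Fin p)) q.2.1 * (u : EuclideanSpace ℝ (Fin p)) q.2.2.1) *
      ((u : EuclideanSpace ℝ (Fin p)) q.2.2.2.1 * (u : EuclideanSpace ℝ (Fin p)) q.2.2.2.2)
  else 0

lemma continuous_oddMono (q : Fin p × Fin p × Fin p × Fin p × Fin p) : Continuous (oddMono q) := by
  unfold oddMono
  split_ifs
  · fun_prop
  · exact continuous_const

lemma abs_oddMono_le (q : Fin p × Fin p × Fin p × Fin p × Fin p) (u : Sph p) :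
    |oddMono q u| ≤ 1 := by
  unfold oddMono
  split_ifs
  · exact abs_mul_le_one (abs_mul_le_one
      (abs_mul_le_one (abs_coord_sph_le _ _) (abs_coord_sph_le _ _))
      (abs_mul_le_one (abs_coord_sph_le _ _) (abs_coord_sph_le _ _)))
      (abs_mul_le_one (abs_coord_sph_le _ _) (abs_coord_sph_le _ _))
  · simp

lemma sphMap_flip0_coord (u : Sph p) (k : Fin p) :
    (sphMap (flip0 p) u : EuclideanSpace ℝ (Fin p)) k =
      (if k = 0 then -1 else 1) * (u : EuclideanSpace ℝ (Fin p)) k := by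
  have h : ∀ x : EuclideanSpace ℝ (Fin p), x k = ⟪EuclideanSpace.single k (1 : ℝ), x⟫ := fun x => by
    rw [EuclideanSpace.inner_single_left]; simp
  rw [h, h]
  change ⟪_, flip0 p u⟫ = _
  rw [inner_flip0]
  split_ifs with hk
  · subst hk
    rw [show EuclideanSpace.single (0 : Fin p) (1 : ℝ) = e0 p from rfl, flip0_e0, inner_neg_left]
    ring
  · rw [flip0_of_inner_eq_zero (by rw [inner_e0]; simp [Ne.symm hk]), one_mul]

/-- Flipping the first coordinate preserves the law and changes the sign: the leading factor flips,
and each of the other two pairs is even. -/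
lemma integral_oddMono (q : Fin p × Fin p × Fin p × Fin p × Fin p) :
    ∫ u, oddMono q u ∂(unif p) = 0 := by
  have h1 := integral_sphMap (flip0 p) (continuous_oddMono q)
  have h2 : ∀ u, oddMono q (sphMap (flip0 p) u) = -oddMono q u := by
    intro u
    unfold oddMono
    split_ifs with h
    · obtain ⟨h1, h2, h3⟩ := h
      simp only [sphMap_flip0_coord, if_true, if_neg h1]
      by_cases ha : q.2.1 = 0 <;> by_cases hb : q.2.2.2.1 = 0
      · simp only [ha, hb, h2.1 ha, h3.1 hb, if_true]; ring
      · simp only [ha, h2.1 ha, if_true, if_neg hb, if_neg (mt h3.2 hb)]; ring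
      · simp only [hb, h3.1 hb, if_true, if_neg ha, if_neg (mt h2.2 ha)]; ring
      · simp only [if_neg ha, if_neg hb, if_neg (mt h2.2 ha), if_neg (mt h3.2 hb)]; ring
    · simp
  simp_rw [h2, integral_neg] at h1
  linarith

/-- The regularity conditions on a uniform sample hold with high probability. -/
theorem exists_measure_not_regular_le (p : ℕ) [NeZero p] {θ : ℝ} (hθ : 0 < θ) :
    ∃ C : ℝ, 0 < C ∧ ∀ n : ℕ, n ≠ 0 → (Measure.pi fun _ : Fin n => unif p)
      {u | ¬(FourthMomentsClose (fun i => (u i : EuclideanSpace ℝ (Fin p))) (C / √n) ∧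
        OddSumsSmall (fun i => (u i : EuclideanSpace ℝ (Fin p))) C)} ≤ ENNReal.ofReal θ := by
  obtain ⟨N4, hN4e⟩ : ∃ N : ℝ, N = Fintype.card (Fin p × Fin p × Fin p × Fin p) := ⟨_, rfl⟩
  obtain ⟨N5, hN5e⟩ : ∃ N : ℝ, N = Fintype.card (Fin p × Fin p × Fin p × Fin p × Fin p) :=
    ⟨_, rfl⟩
  have hp1 : (1 : ℝ) ≤ p := Nat.one_le_cast.2 (Nat.pos_of_ne_zero (NeZero.ne p))
  have hN4 : 0 ≤ N4 := hN4e ▸ Nat.cast_nonneg _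
  have hN5 : 0 ≤ N5 := hN5e ▸ Nat.cast_nonneg _
  -- Chebyshev and a union bound leave the probability `(N4 + N5) / c²`, which must not exceed `θ`;
  -- the `+ 1` makes positivity immediate.
  obtain ⟨c, hc, hc2⟩ : ∃ c : ℝ, 0 < c ∧ c ^ 2 = (N4 + N5 + 1) / θ :=
    ⟨√((N4 + N5 + 1) / θ), Real.sqrt_pos.2 (by positivity), Real.sq_sqrt (by positivity)⟩
  refine ⟨p ^ 2 * c, by positivity, fun n hn => ?_⟩
  set S := {u : Fin n → Sph p | ¬(FourthMomentsClose (fun i => (u i : EuclideanSpace ℝ (Fin p)))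
    (p ^ 2 * c / √n) ∧ OddSumsSmall (fun i => (u i : EuclideanSpace ℝ (Fin p))) (p ^ 2 * c))}
  set S4 := {u : Fin n → Sph p | ∃ k, c * √n < |∑ i, mono4 k (u i) - n * ∫ x, mono4 k x ∂(unif p)|}
  set S5 := {u : Fin n → Sph p |
    ∃ k, c * √n < |∑ i, oddMono k (u i) - n * ∫ x, oddMono k x ∂(unif p)|}
  have h4 : (Measure.pi fun _ : Fin n => unif p) S4 ≤ ENNReal.ofReal (N4 / c ^ 2) := by
    rw [hN4e]; exact measure_exists_abs_sum_sub_gt_le continuous_mono4 abs_mono4_le hn hc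
  have h5 : (Measure.pi fun _ : Fin n => unif p) S5 ≤ ENNReal.ofReal (N5 / c ^ 2) := by
    rw [hN5e]; exact measure_exists_abs_sum_sub_gt_le continuous_oddMono abs_oddMono_le hn hc
  have hsub : S ⊆ S4 ∪ S5 := by
    intro u hu
    by_contra hcon
    simp only [S4, S5, Set.mem_union, not_or, Set.mem_ofPred_eq, not_exists, not_lt] at hcon
    refine hu ⟨fourthMomentsClose_of_mono4 hn hcon.1, ?_⟩
    intro j a b c' d hj hab hcd
    have h := hcon.2 (j, a, b, c', d)
    rw [integral_oddMono, mul_zero, sub_zero] at h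
    simp only [oddMono, if_pos (⟨hj, hab, hcd⟩ : j ≠ 0 ∧ (a = 0 ↔ b = 0) ∧ (c' = 0 ↔ d = 0))] at h
    refine h.trans (mul_le_mul_of_nonneg_right ?_ (Real.sqrt_nonneg _))
    exact le_mul_of_one_le_left hc.le (one_le_pow₀ hp1)
  have hle : N4 / c ^ 2 + N5 / c ^ 2 ≤ θ := by
    have hN : 0 < N4 + N5 + 1 := by linarith
    rw [← add_div, hc2, div_div_eq_mul_div, div_le_iff₀ hN]
    linarith
  refine (measure_mono hsub).trans ((measure_union_le _ _).trans ((add_le_add h4 h5).trans ?_))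
  rw [← ENNReal.ofReal_add (div_nonneg hN4 (sq_nonneg c)) (div_nonneg hN5 (sq_nonneg c))]
  exact ENNReal.ofReal_le_ofReal hle

end

/-! ### Central limit theorem for the score and the chi-square limit. -/

section
variable {p n : ℕ} [NeZero p]

/-- The coordinates other than the first one. -/
def shift (j : Fin (p - 1)) : Fin p := ⟨j + 1, by have := j.2; omega⟩

lemma sum_ite_eq_sum_shift (f : Fin p → ℝ) :
    ∑ k, (if k = 0 then 0 else f k) = ∑ j : Fin (p - 1), f (shift j) := by
  obtain ⟨m, rfl⟩ : ∃ m, p = m + 1 := ⟨p - 1, by have := NeZero.ne p; omega⟩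
  rw [Fin.sum_univ_succ, if_pos rfl, zero_add]
  refine Finset.sum_congr rfl fun j _ => ?_
  rw [if_neg (Fin.succ_ne_zero j)]
  rfl

/-- Extension by zero to the first coordinate. -/
def extend0 (t : EuclideanSpace ℝ (Fin (p - 1))) : EuclideanSpace ℝ (Fin p) :=
  WithLp.toLp 2 fun k => if h : k = 0 then 0 else t ⟨k - 1, by
    have := k.2; have : (k : ℕ) ≠ 0 := fun h0 => h (Fin.ext (by simpa using h0)); omega⟩

lemma shift_ne_zero (j : Fin (p - 1)) : shift j ≠ 0 := fun h => by
  have := congrArg Fin.val h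
  simp [shift] at this

lemma extend0_shift (t : EuclideanSpace ℝ (Fin (p - 1))) (j : Fin (p - 1)) :
    extend0 t (shift j) = t j := by
  simp only [extend0, dif_neg (shift_ne_zero j)]
  rfl

lemma extend0_zero (t : EuclideanSpace ℝ (Fin (p - 1))) : extend0 t 0 = 0 := by
  simp [extend0]

lemma sum_extend0 (t : EuclideanSpace ℝ (Fin (p - 1))) (F : Fin p → ℝ → ℝ)
    (hF : F 0 0 = 0) :
    ∑ k, F k (extend0 t k) = ∑ j, F (shift j) (t j) := by
  have h : ∀ k, F k (extend0 t k) = if k = 0 then 0 else F k (extend0 t k) := fun k => by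
    split_ifs with hk
    · subst hk; rw [extend0_zero, hF]
    · rfl
  rw [Finset.sum_congr rfl fun k _ => h k, sum_ite_eq_sum_shift fun k => F k (extend0 t k)]
  simp_rw [extend0_shift]

lemma norm_extend0 (t : EuclideanSpace ℝ (Fin (p - 1))) : ‖extend0 t‖ ^ 2 = ‖t‖ ^ 2 := by
  rw [EuclideanSpace.norm_sq_eq, EuclideanSpace.norm_sq_eq]
  exact sum_extend0 t (fun _ x => ‖x‖ ^ 2) (by simp)

/-- The score of one observation. -/
def score (u : Sph p) : EuclideanSpace ℝ (Fin (p - 1)) :=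
  WithLp.toLp 2 fun j => √(p * (p + 2)) * ((u : EuclideanSpace ℝ (Fin p)) 0 *
    (u : EuclideanSpace ℝ (Fin p)) (shift j))

lemma continuous_score : Continuous (score (p := p)) := by
  unfold score
  refine (PiLp.continuous_toLp 2 _).comp (continuous_pi fun j => ?_)
  fun_prop

lemma inner_score (t : EuclideanSpace ℝ (Fin (p - 1))) (u : Sph p) :
    ⟪score u, t⟫ = √(p * (p + 2)) * (⟪e0 p, (u : EuclideanSpace ℝ (Fin p))⟫ *
      ⟪extend0 t, (u : EuclideanSpace ℝ (Fin p))⟫) := by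
  rw [inner_eq_dotProduct, inner_eq_dotProduct (extend0 t), inner_e0, dotProduct, dotProduct,
    sum_extend0 t (fun k x => x * (u : EuclideanSpace ℝ (Fin p)) k) (by simp), Finset.mul_sum,
    Finset.mul_sum]
  exact Finset.sum_congr rfl fun j _ => by simp only [score]; ring

lemma integral_inner_score (t : EuclideanSpace ℝ (Fin (p - 1))) :
    ∫ u, ⟪score u, t⟫ ∂(unif p) = 0 := by
  have h1 := integral_sphMap (flip0 p)
    (show Continuous fun u : Sph p => ⟪score u, t⟫ from continuous_score.inner continuous_const)
  have h2 : ∀ u : Sph p, ⟪score (sphMap (flip0 p) u), t⟫ = -⟪score u, t⟫ := fun u => by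
    have h : ⟪e0 p, extend0 t⟫ = 0 := by rw [inner_e0, extend0_zero]
    rw [inner_score, inner_score]
    change _ * (⟪e0 p, flip0 p u⟫ * ⟪extend0 t, flip0 p u⟫) = _
    rw [inner_flip0, inner_flip0, flip0_e0, flip0_of_inner_eq_zero h, inner_neg_left]; ring
  simp_rw [h2, integral_neg] at h1
  linarith

/-- This identity accounts for the factor `p (p + 2)` in the statistic: the mixed fourth moment of
orthogonal unit vectors is `1 / (p (p + 2))`, so the scores have identity covariance. -/
lemma integral_inner_score_sq (t : EuclideanSpace ℝ (Fin (p - 1))) :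
    ∫ u, ⟪score u, t⟫ ^ 2 ∂(unif p) = ‖t‖ ^ 2 := by
  have hp0 : (0 : ℝ) < p := Nat.cast_pos.2 (Nat.pos_of_ne_zero (NeZero.ne p))
  have h : ∀ u : Sph p, ⟪score u, t⟫ ^ 2 = p * (p + 2) *
      (⟪e0 p, (u : EuclideanSpace ℝ (Fin p))⟫ ^ 2 *
        ⟪extend0 t, (u : EuclideanSpace ℝ (Fin p))⟫ ^ 2) := fun u => by
    rw [inner_score, mul_pow, mul_pow, Real.sq_sqrt (by positivity)]
  simp_rw [h]
  rw [integral_const_mul, integral_inner_sq_mul_inner_sq, inner_e0, extend0_zero, norm_e0,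
    norm_extend0]
  field_simp
  ring

/-- The normalized sum of scores. -/
def scoreSum (u : Fin n → Sph p) : EuclideanSpace ℝ (Fin (p - 1)) := (√n)⁻¹ • ∑ i, score (u i)

lemma continuous_scoreSum : Continuous (scoreSum (p := p) (n := n)) := by
  have h : Continuous fun u : Fin n → Sph p => ∑ i, score (u i) :=
    continuous_finsetSum _ fun i _ => (continuous_score (p := p)).comp (continuous_apply i)
  unfold scoreSum
  exact h.const_smul ((√(n : ℝ))⁻¹)

lemma scoreStat_eq_norm_scoreSum (u : Fin n → Sph p) :
    scoreStat (fun i => (u i : EuclideanSpace ℝ (Fin p))) = ‖scoreSum u‖ ^ 2 := by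
  have hp0 : (0 : ℝ) < p := Nat.cast_pos.2 (Nat.pos_of_ne_zero (NeZero.ne p))
  rw [scoreStat, EuclideanSpace.norm_sq_eq, EuclideanSpace.norm_sq_eq]
  have h : ∀ k, ‖signVec (fun i => (u i : EuclideanSpace ℝ (Fin p))) (fun _ => 1) k‖ ^ 2 =
      if k = 0 then 0 else ((√n)⁻¹ * ∑ i, (u i : EuclideanSpace ℝ (Fin p)) 0 *
        (u i : EuclideanSpace ℝ (Fin p)) k) ^ 2 := fun k => by
    rw [Real.norm_eq_abs, sq_abs]
    simp only [signVec, inv_one, mul_one]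
    split_ifs <;> simp
  rw [Finset.sum_congr rfl fun k _ => h k, sum_ite_eq_sum_shift fun k => ((√n)⁻¹ *
    ∑ i, (u i : EuclideanSpace ℝ (Fin p)) 0 * (u i : EuclideanSpace ℝ (Fin p)) k) ^ 2,
    Finset.mul_sum]
  refine Finset.sum_congr rfl fun j _ => ?_
  rw [Real.norm_eq_abs, sq_abs]
  have h2 : scoreSum u j = √(p * (p + 2)) * ((√n)⁻¹ *
      ∑ i, (u i : EuclideanSpace ℝ (Fin p)) 0 * (u i : EuclideanSpace ℝ (Fin p)) (shift j)) := by
    simp only [scoreSum, PiLp.smul_apply, WithLp.ofLp_sum, Finset.sum_apply, score, smul_eq_mul,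
      ← Finset.mul_sum]
    ring
  rw [h2, mul_pow (√((p : ℝ) * (p + 2))), Real.sq_sqrt (by positivity)]

lemma charFun_scoreSum (t : EuclideanSpace ℝ (Fin (p - 1))) :
    charFun ((Measure.pi fun _ : Fin n => unif p).map scoreSum) t =
      charFun ((unif p).map fun u => ⟪score u, t⟫) ((√n)⁻¹) ^ n := by
  have h1 : ∀ u : Fin n → Sph p, Complex.exp (⟪scoreSum u, t⟫ * Complex.I) =
      ∏ i, Complex.exp ((√n : ℂ)⁻¹ * ⟪score (u i), t⟫ * Complex.I) := fun u => by
    rw [← Complex.exp_sum, scoreSum, inner_smul_left, sum_inner, ← Finset.sum_mul, ← Finset.mul_sum]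
    push_cast
    simp
  rw [charFun_apply, integral_map continuous_scoreSum.measurable.aemeasurable (by fun_prop)]
  simp_rw [h1]
  rw [integral_fintype_prod_eq_prod (𝕜 := ℂ) (f := fun (_ : Fin n) (x : Sph p) =>
    Complex.exp ((√n : ℂ)⁻¹ * ⟪score x, t⟫ * Complex.I)), Finset.prod_const, Finset.card_univ,
    Fintype.card_fin, charFun_apply_real, integral_map
    (continuous_score.inner continuous_const).measurable.aemeasurable (by fun_prop)]
  simp

/-- The one-dimensional central limit theorem for the projection on `t / ‖t‖`, which has mean zero
and variance one, evaluated at `‖t‖`. -/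
lemma tendsto_charFun_scoreSum (t : EuclideanSpace ℝ (Fin (p - 1))) :
    Tendsto (fun n : ℕ => charFun ((Measure.pi fun _ : Fin n => unif p).map scoreSum) t) atTop
      (𝓝 (Complex.exp (-‖t‖ ^ 2 / 2))) := by
  simp_rw [charFun_scoreSum]
  by_cases ht : t = 0
  · subst ht
    simp [Measure.map_const]
  have hn : ‖t‖ ≠ 0 := norm_ne_zero_iff.2 ht
  set f : Sph p → ℝ := fun u => ⟪score u, ‖t‖⁻¹ • t⟫
  have hf : Continuous f := continuous_score.inner continuous_const
  have h := tendsto_charFun_inv_sqrt_mul_pow (P := unif p) (X := f) hf.measurable.aemeasurable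
    (integral_inner_score _) (by
      have h2 := integral_inner_score_sq (‖t‖⁻¹ • t)
      rw [norm_smul, norm_inv, norm_norm, inv_mul_cancel₀ hn, one_pow] at h2
      exact h2) ‖t‖
  refine h.congr fun n => ?_
  congr 1
  have h3 : (fun u : Sph p => ⟪score u, t⟫) = fun u => ‖t‖ * f u := by
    ext u
    simp only [f, inner_smul_right]
    rw [mul_inv_cancel_left₀ hn]
  rw [h3, charFun_map_mul_comp hf.measurable.aemeasurable, mul_comm]

lemma map_norm_sq_stdGaussian (k : ℕ) :
    (stdGaussian (EuclideanSpace ℝ (Fin k))).map (fun x => ‖x‖ ^ 2) = chiSquare k := by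
  rw [stdGaussian_eq_map_pi_orthonormalBasis (EuclideanSpace.basisFun (Fin k) ℝ),
    Measure.map_map (by fun_prop) (by fun_prop), chiSquare]
  congr 1
  ext z
  rw [Function.comp_apply, EuclideanSpace.norm_sq_eq]
  refine Finset.sum_congr rfl fun i _ => ?_
  rw [Real.norm_eq_abs, sq_abs]
  congr 1
  simp [EuclideanSpace.basisFun_apply, WithLp.ofLp_sum, Finset.sum_apply, Pi.single_apply]

/-- The score statistic of a uniform sample is asymptotically chi-square. -/
theorem tendstoInDistribution_scoreStat :
    TendstoInDistribution (fun (n : ℕ) (u : Fin n → Sph p) =>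
      scoreStat fun i => (u i : EuclideanSpace ℝ (Fin p))) atTop (id : ℝ → ℝ)
      (fun n => Measure.pi fun _ : Fin n => unif p) (chiSquare (p - 1)) := by
  have h : TendstoInDistribution (fun (n : ℕ) => scoreSum (p := p) (n := n)) atTop
      (id : EuclideanSpace ℝ (Fin (p - 1)) → _) (fun n => Measure.pi fun _ : Fin n => unif p)
      (stdGaussian (EuclideanSpace ℝ (Fin (p - 1)))) :=
    { forall_aemeasurable := fun n => continuous_scoreSum.measurable.aemeasurable
      aemeasurable_limit := aemeasurable_id
      tendsto := by
        refine ProbabilityMeasure.tendsto_iff_tendsto_charFun.2 fun t => ?_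
        simp only [ProbabilityMeasure.coe_mk, Measure.map_id, charFun_stdGaussian]
        exact tendsto_charFun_scoreSum t }
  have h2 := h.continuous_comp (g := fun x => ‖x‖ ^ 2) (by fun_prop)
  have h3 : ∀ n : ℕ, (fun u : Fin n → Sph p => scoreStat fun i => (u i : EuclideanSpace ℝ (Fin p)))
      = (fun x => ‖x‖ ^ 2) ∘ scoreSum := fun n => by
    ext u; exact scoreStat_eq_norm_scoreSum u
  refine ⟨fun n => ?_, aemeasurable_id, ?_⟩
  · rw [h3]; exact h2.forall_aemeasurable n
  · convert! h2.tendsto using 2 with n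
    · simp only [h3]
    · simp only [Measure.map_id, Function.comp_id]
      congr 1
      exact Subtype.ext (map_norm_sq_stdGaussian (p - 1)).symm

/-- The chi-square distribution has no atoms, except for zero degrees of freedom. -/
lemma chiSquare_singleton {k : ℕ} (hk : k ≠ 0) (x : ℝ) : chiSquare k {x} = 0 := by
  obtain ⟨m, rfl⟩ := Nat.exists_eq_succ_of_ne_zero hk
  rw [chiSquare, Measure.map_apply (by fun_prop) (measurableSet_singleton x)]
  have hmp := measurePreserving_piFinSuccAbove (fun _ : Fin (m + 1) => gaussianReal 0 1) 0
  set S : Set (ℝ × (Fin m → ℝ)) := {q | q.1 ^ 2 + ∑ i, q.2 i ^ 2 = x}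
  have hS : MeasurableSet S := measurableSet_eq_fun (by fun_prop) (by fun_prop)
  have hpre : (fun z : Fin (m + 1) → ℝ => ∑ i, z i ^ 2) ⁻¹' {x} =
      MeasurableEquiv.piFinSuccAbove (fun _ => ℝ) 0 ⁻¹' S := by
    ext z
    simp only [S, Set.mem_preimage, Set.mem_singleton_iff, Set.mem_ofPred_eq, Fin.sum_univ_succ]
    rfl
  rw [hpre, hmp.measure_preimage hS.nullMeasurableSet, Measure.prod_apply_symm hS]
  have := nullSingletonClass_gaussianReal (μ := 0) (v := 1) one_ne_zero
  refine (lintegral_congr fun z => ?_).trans lintegral_zero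
  -- With all but one coordinate fixed, at most two values of the remaining Gaussian coordinate are
  -- possible.
  refine Set.Finite.measure_zero (Set.Finite.subset (Set.toFinite
    {√(x - ∑ i, z i ^ 2), -√(x - ∑ i, z i ^ 2)}) fun a ha => ?_) _
  have h : a ^ 2 + ∑ i, z i ^ 2 = x := ha
  have h1 : √(x - ∑ i, z i ^ 2) = |a| := by
    rw [← Real.sqrt_sq_eq_abs]; congr 1; linarith
  rw [h1]
  rcases abs_choice a with h2 | h2 <;> simp [h2]

end

/-! ### Overlap of the leading eigenvectors and the deterministic approximation of the statistic. -/

section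
variable {p n : ℕ} [NeZero p]

/-- Square roots of the eigenvalues, relative to the leading one. -/
def relScale (l : Fin p → ℝ) (k : Fin p) : ℝ := √(l k / l 0)

lemma relScale_zero {l : Fin p → ℝ} (hl : ∀ k, 0 < l k) : relScale l 0 = 1 := by
  rw [relScale, div_self (hl 0).ne', Real.sqrt_one]

lemma relScale_sq {l : Fin p → ℝ} (hl : ∀ k, 0 < l k) (k : Fin p) :
    relScale l k ^ 2 = l k / l 0 :=
  Real.sq_sqrt (div_pos (hl k) (hl 0)).le

lemma abs_relScale_le {l : Fin p → ℝ} (hl : ∀ k, 0 < l k) (hl0 : ∀ k, l k ≤ l 0) (k : Fin p) :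
    |relScale l k| ≤ 1 := by
  rw [relScale, abs_of_nonneg (Real.sqrt_nonneg _), Real.sqrt_le_one]
  exact (div_le_one (hl 0)).2 (hl0 k)

/-- Lower bound for the angle between the leading eigenvectors, in the presence of a large relative
eigenvalue. -/
lemma not_small_angle {l m : Fin p → ℝ}
    {b bh : OrthonormalBasis (Fin p) ℝ (EuclideanSpace ℝ (Fin p))}
    {w : Fin n → EuclideanSpace ℝ (Fin p)} {N : Matrix (Fin p) (Fin p) ℝ} {s t K ε r δ : ℝ}
    (hl : ∀ k, 0 < l k) (hl0 : ∀ k, l k ≤ l 0) (hm : Antitone m)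
    (hmN : ∀ x, ∑ k, m k * ⟪bh k, x⟫ ^ 2 =
      s * qf N (WithLp.toLp 2 fun k => √(l k) * ⟪b k, x⟫))
    (h4 : FourthMomentsClose w ε) (hε : 0 ≤ ε) (hw : ∀ i, ‖w i‖ = 1) (ht : |t| ≤ 1 / 2)
    (hK : 0 ≤ K) (happ : ∀ x, |s * qf N x - (1 - t) * linTyler w x| ≤ K * ε ^ 2 * ‖x‖ ^ 2)
    (hn : n ≠ 0) (hδ0 : 0 < δ) (hδ : δ ≤ 1 / 2)
    (hns : ¬∀ v, IsSliceMax w (relScale l) v →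
      |∑ i, ⟪e0 p, w i⟫ * ⟪scale (relScale l) v, w i⟫| < r * √n)
    (hr : √n * (3 * ((p + 2) * p * ε) * √δ + 4 * K * ε ^ 2 / √δ) < (p + 2) * r) :
    δ ≤ |⟪bh 0, b 0⟫| := by
  by_contra hcon
  push Not at hcon
  have hn0 : (0 : ℝ) < n := Nat.cast_pos.2 (Nat.pos_of_ne_zero hn)
  have hsn : 0 < √(n : ℝ) := Real.sqrt_pos.2 hn0
  have hκ0 := relScale_zero hl
  have hκ := abs_relScale_le hl hl0
  have ht' := abs_le.1 ht
  -- `x` holds the coordinates of the leading empirical eigenvector in the true eigenbasis. Dividing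
  -- the true form by `l 0` gives scales at most one and makes `x` a maximiser of the form of `N`
  -- after scaling.
  set x : EuclideanSpace ℝ (Fin p) := WithLp.toLp 2 fun k => ⟪b k, bh 0⟫
  have hx1 : ‖x‖ = 1 := by
    have h : ‖x‖ ^ 2 = 1 := by
      rw [EuclideanSpace.norm_sq_eq]
      have := sum_inner_sq b (bh 0)
      rw [bh.norm_eq_one, one_pow] at this
      simpa [x] using this
    exact (pow_eq_one_iff_of_nonneg (norm_nonneg x) two_ne_zero).1 h
  -- the quadratic form in the coordinates of `b`
  have hcoord : ∀ y : EuclideanSpace ℝ (Fin p),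
      ∑ k, m k * ⟪bh k, ∑ j, y j • b j⟫ ^ 2 = l 0 * (s * qf N (scale (relScale l) y)) := by
    intro y
    rw [hmN]
    have h1 : (WithLp.toLp 2 fun k => √(l k) * ⟪b k, ∑ j, y j • b j⟫) =
        √(l 0) • scale (relScale l) y := by
      ext k
      have h2 : ⟪b k, ∑ j, y j • b j⟫ = y k := by
        simp only [inner_sum, inner_smul_right, b.inner_eq_ite]; simp
      have h3 : √(l k) = √(l 0) * √(l k / l 0) := by
        rw [← Real.sqrt_mul (hl 0).le, mul_div_cancel₀ _ (hl 0).ne']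
      simp only [PiLp.smul_apply, scale_apply, smul_eq_mul, relScale]
      rw [h2, h3, mul_assoc]
    rw [h1, qf_smul_vec, Real.sq_sqrt (hl 0).le]
    ring
  have hbx : ∑ j, x j • b j = bh 0 := b.sum_repr' (bh 0)
  have hmax : ∀ y : EuclideanSpace ℝ (Fin p), ‖y‖ = 1 →
      s * qf N (scale (relScale l) y) ≤ s * qf N (scale (relScale l) x) := by
    intro y hy
    refine le_of_mul_le_mul_left ?_ (hl 0)
    rw [← hcoord, ← hcoord, hbx]
    have h1 : ‖∑ j, y j • b j‖ ^ 2 = 1 := by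
      rw [← sum_inner_sq b]
      have h2 : ∀ k, ⟪b k, ∑ j, y j • b j⟫ = y k := fun k => by
        simp only [inner_sum, inner_smul_right, b.inner_eq_ite]; simp
      simp_rw [h2]
      have := EuclideanSpace.norm_sq_eq y
      rw [hy, one_pow] at this
      simpa using this.symm
    have h3 : ∑ k, m k * ⟪bh k, bh 0⟫ ^ 2 = m 0 := by
      have := qf_basis m bh 0; rwa [qf_specMat] at this
    rw [h3]
    calc _ ≤ ∑ k, m 0 * ⟪bh k, ∑ j, y j • b j⟫ ^ 2 := Finset.sum_le_sum fun k _ =>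
          mul_le_mul_of_nonneg_right (hm (Fin.zero_le k)) (sq_nonneg _)
      _ = m 0 := by rw [← Finset.mul_sum, sum_inner_sq, h1, mul_one]
  -- Replacing the form of `N` by its linearization costs `K ε²` twice, and dividing by `1 - t ≥
  -- 1/2` doubles this to `4 K ε²`.
  have hnear : ∀ y : EuclideanSpace ℝ (Fin p), ‖y‖ = 1 →
      linTyler w (scale (relScale l) y) ≤ linTyler w (scale (relScale l) x) + 4 * K * ε ^ 2 := by
    intro y hy
    have hb : ∀ z : EuclideanSpace ℝ (Fin p), ‖z‖ = 1 →
        |s * qf N (scale (relScale l) z) - (1 - t) * linTyler w (scale (relScale l) z)| ≤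
          K * ε ^ 2 := fun z hz => by
      refine (happ _).trans (mul_le_of_le_one_right (by positivity) ?_)
      exact pow_le_one₀ (norm_nonneg _) ((norm_scale_le hκ z).trans_eq hz)
    have h1 := (abs_le.1 (hb y hy)).1
    have h2 := (abs_le.1 (hb x hx1)).2
    have h3 := hmax y hy
    set A := linTyler w (scale (relScale l) y)
    set B := linTyler w (scale (relScale l) x)
    have hKε : 0 ≤ K * ε ^ 2 := by positivity
    have h5 : (1 - t) * (A - B) ≤ (1 - t) * (4 * K * ε ^ 2) := by nlinarith
    have := le_of_mul_le_mul_left h5 (by linarith)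
    linarith
  refine hns fun v hv => ?_
  have h1 := abs_crossTyler_le_of_nearly_max h4 hε hw hκ0 hκ hv hx1 hnear (by positivity) hδ0 hδ
    (by
      rw [inner_e0]
      change |⟪b 0, bh 0⟫| ≤ δ
      rw [real_inner_comm]; exact hcon.le)
  rw [crossTyler, abs_mul, abs_mul, abs_of_pos (by positivity : (0 : ℝ) < p + 2),
    abs_of_pos (inv_pos.2 hn0)] at h1
  set X := |∑ i, ⟪e0 p, w i⟫ * ⟪scale (relScale l) v, w i⟫|
  have h2 : √n * ((p + 2) * ((n : ℝ)⁻¹ * X)) < (p + 2) * r :=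
    (mul_le_mul_of_nonneg_left h1 hsn.le).trans_lt hr
  have hnn : (n : ℝ) = √n * √n := (Real.mul_self_sqrt hn0.le).symm
  have h3 : √n * ((p + 2) * ((n : ℝ)⁻¹ * X)) = (p + 2) * (X / √n) := by
    rw [show (n : ℝ)⁻¹ = (√n)⁻¹ * (√n)⁻¹ by rw [← mul_inv, ← hnn]]
    field_simp
  rw [h3] at h2
  have h4 := lt_of_mul_lt_mul_left h2 (by positivity)
  rwa [div_lt_iff₀ hsn] at h4

/-- Lower bound for the angle between the leading eigenvectors, if the other eigenvalues are
small. -/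
lemma le_abs_inner_of_gap {l m : Fin p → ℝ}
    {b bh : OrthonormalBasis (Fin p) ℝ (EuclideanSpace ℝ (Fin p))} {ε : ℝ}
    (hl : ∀ k, 0 < l k) (hm : Antitone m) (hε : ε ≤ 1 / 4)
    (hlow : ∀ x, (1 - ε) * ∑ k, l k * ⟪b k, x⟫ ^ 2 ≤ ∑ k, m k * ⟪bh k, x⟫ ^ 2)
    (hup : ∀ x, ∑ k, m k * ⟪bh k, x⟫ ^ 2 ≤ ∑ k, l k * ⟪b k, x⟫ ^ 2)
    (hgap : ∀ k, k ≠ 0 → l k ≤ l 0 / 2) : 1 / 2 ≤ |⟪bh 0, b 0⟫| := by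
  set c := ⟪bh 0, b 0⟫
  have h1 := hlow (b 0)
  have h2 := hup (bh 0)
  have h3 : ∑ k, m k * ⟪bh k, bh 0⟫ ^ 2 = m 0 := by
    have := qf_basis m bh 0; rwa [qf_specMat] at this
  have h4 : ∑ k, l k * ⟪b k, b 0⟫ ^ 2 = l 0 := by
    have := qf_basis l b 0; rwa [qf_specMat] at this
  have h5 : ∑ k, m k * ⟪bh k, b 0⟫ ^ 2 ≤ m 0 := by
    calc _ ≤ ∑ k, m 0 * ⟪bh k, b 0⟫ ^ 2 := Finset.sum_le_sum fun k _ =>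
          mul_le_mul_of_nonneg_right (hm (Fin.zero_le k)) (sq_nonneg _)
      _ = m 0 := by rw [← Finset.mul_sum, sum_inner_sq, b.norm_eq_one]; ring
  have h6 : ∑ k, l k * ⟪b k, bh 0⟫ ^ 2 ≤ l 0 / 2 + l 0 / 2 * c ^ 2 := by
    calc _ ≤ ∑ k, (l 0 / 2 * ⟪b k, bh 0⟫ ^ 2 + if k = 0 then l 0 / 2 * c ^ 2 else 0) :=
          Finset.sum_le_sum fun k _ => by
            split_ifs with hk
            · subst hk
              rw [real_inner_comm (bh 0) (b 0)]
              change l 0 * c ^ 2 ≤ l 0 / 2 * c ^ 2 + l 0 / 2 * c ^ 2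
              linarith
            · rw [add_zero]; exact mul_le_mul_of_nonneg_right (hgap k hk) (sq_nonneg _)
      _ = _ := by
          rw [Finset.sum_add_distrib, ← Finset.mul_sum, sum_inner_sq, bh.norm_eq_one]
          simp
  rw [h4] at h1
  rw [h3] at h2
  -- The leading empirical eigenvalue is at least `(1 - ε) l 0`, but along `bh 0` the true form is
  -- at most `l 0 (1 + c²) / 2`. So `c² ≥ 1 - 2 ε`.
  have h7 : l 0 * (1 - ε) ≤ l 0 * (1 / 2 + 1 / 2 * c ^ 2) := by linarith
  have h8 := le_of_mul_le_mul_left h7 (hl 0)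
  have h9 : (1 / 2 : ℝ) ^ 2 ≤ |c| ^ 2 := by rw [sq_abs]; linarith
  exact (pow_le_pow_iff_left₀ (by norm_num) (abs_nonneg _) two_ne_zero).1 h9

/-- On regular samples, Tyler's estimator exists, and the sign statistic is close to the score
statistic. -/
theorem eventually_signStatistic_sub_scoreStat_le (p : ℕ) [NeZero p] {C r τ : ℝ} (hC : 0 < C)
    (hr : 0 < r) (hτ : 0 < τ) :
    ∀ᶠ n : ℕ in atTop, ∀ (l : Fin p → ℝ)
      (b : OrthonormalBasis (Fin p) ℝ (EuclideanSpace ℝ (Fin p))) (u : Fin n → Sph p),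
      (∀ k, 0 < l k) → (∀ k, l k ≤ l 0) →
      FourthMomentsClose (fun i => (whiten l b (u i) : EuclideanSpace ℝ (Fin p))) (C / √n) →
      OddSumsSmall (fun i => (whiten l b (u i) : EuclideanSpace ℝ (Fin p))) C →
      ((∃ k, k ≠ 0 ∧ 1 / 2 ≤ relScale l k ^ 2) →
        (fun i => whiten l b (u i)) ∉ smallCross (relScale l) (r * √n)) →
      (∃ V, IsTylerEstimator u V) ∧
      ∀ V lam bh, IsTylerEstimator u V → IsSpectralDecomposition V lam bh →
        |signStatistic (b 0) u (nullShapeEstimator (b 0) lam bh) -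
          scoreStat fun i => (whiten l b (u i) : EuclideanSpace ℝ (Fin p))| ≤ τ := by
  have hp0 : (0 : ℝ) < p := Nat.cast_pos.2 (Nat.pos_of_ne_zero (NeZero.ne p))
  obtain ⟨K, hK1, hK⟩ := tyler_approx p
  obtain ⟨K2, hK20, hK2⟩ := signStatistic_approx p hC.le
  have hK0 : 0 < K := by linarith
  -- The overlap bound will be `δ = d²`. With `ε = C / √n`, the first term of the cross-term bound
  -- is then `3 (p + 2) p C d`, at most half of `(p + 2) r`; the term `4 K C² / (d √n)` fits into
  -- the other half for large `n`.
  set d : ℝ := min (1 / 2) (r / (6 * p * C))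
  have hd0 : 0 < d := lt_min (by norm_num) (by positivity)
  have hd1 : d ≤ 1 / 2 := min_le_left _ _
  have hd2 : d * (6 * p * C) ≤ r := by
    rw [← le_div_iff₀ (by positivity)]; exact min_le_right _ _
  set A : ℝ := 13 * p ^ 2 * √(K * C) / (d ^ 2) ^ 2
  have hA : 0 ≤ A := by positivity
  have hx : Tendsto (fun n : ℕ => (√(n : ℝ))⁻¹) atTop (𝓝 0) :=
    tendsto_inv_atTop_zero.comp (Real.tendsto_sqrt_atTop.comp tendsto_natCast_atTop_atTop)
  have hsx : Tendsto (fun n : ℕ => √((√(n : ℝ))⁻¹)) atTop (𝓝 0) := by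
    have := (Real.continuous_sqrt.tendsto 0).comp hx
    rwa [Real.sqrt_zero] at this
  have hev : ∀ (c : ℝ) {f : ℕ → ℝ} {B : ℝ}, Tendsto f atTop (𝓝 0) → 0 < B →
      ∀ᶠ n in atTop, c * f n < B := fun c f B hf hB => by
    have h := hf.const_mul c
    rw [mul_zero] at h
    exact h.eventually_lt_const hB
  filter_upwards [hev (K * C) hx (by norm_num : (0 : ℝ) < 1 / 4),
    hev (8 * (p + 2) * p ^ 2 * C) hx one_pos,
    hev (4 * K * C ^ 2 / d) hx (by positivity : 0 < (p + 2) * r / 2),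
    hev (4 * p ^ 2 * A) hsx one_pos, hev (A + A ^ 3) hsx one_pos,
    hev (K2 * (A + A ^ 3)) hsx hτ, eventually_ne_atTop 0]
    with n e1 e2 e3 e4 e5 e6 hn l b u hl hl0 h4 hO hgood
  have hn0 : (0 : ℝ) < n := Nat.cast_pos.2 (Nat.pos_of_ne_zero hn)
  have hsn : 0 < √(n : ℝ) := Real.sqrt_pos.2 hn0
  set w : Fin n → EuclideanSpace ℝ (Fin p) := fun i => (whiten l b (u i) : EuclideanSpace ℝ (Fin p))
  have hw : ∀ i, ‖w i‖ = 1 := fun i => norm_eq_of_mem_sphere _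
  obtain ⟨x, hxdef⟩ : ∃ x, x = (√(n : ℝ))⁻¹ := ⟨_, rfl⟩
  rw [← hxdef] at e1 e2 e3 e4 e5 e6
  have hx0 : 0 < x := hxdef ▸ inv_pos.2 hsn
  have hnx : √(n : ℝ) * x = 1 := by rw [hxdef]; exact mul_inv_cancel₀ hsn.ne'
  rw [show C / √(n : ℝ) = C * x by rw [hxdef, div_eq_mul_inv]] at h4
  have hε0 : 0 ≤ C * x := by positivity
  refine ⟨?_, ?_⟩
  · obtain ⟨N, hN⟩ := exists_tylerEq hn h4 hw hε0 (by linarith)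
    exact exists_isTylerEstimator_of_whiten hl b hN
  intro V lam bh hV hspec
  obtain ⟨N, hN, hVN⟩ := exists_tylerEq_of_isTylerEstimator hl b hV
  obtain ⟨s, hs, t, ht, hst⟩ := hK n w (C * x) N hε0 (by linarith) hw h4 hN
  have hq0 : ∀ y, ‖(WithLp.toLp 2 fun k => √(l k) * ⟪b k, y⟫ : EuclideanSpace ℝ (Fin p))‖ ^ 2 =
      ∑ k, l k * ⟪b k, y⟫ ^ 2 := fun y => by
    rw [EuclideanSpace.norm_sq_eq]
    refine Finset.sum_congr rfl fun k _ => ?_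
    rw [Real.norm_eq_abs, sq_abs, mul_pow, Real.sq_sqrt (hl k).le]
  have hmN : ∀ y, ∑ k, s * lam k * ⟪bh k, y⟫ ^ 2 =
      s * qf N (WithLp.toLp 2 fun k => √(l k) * ⟪b k, y⟫) := fun y => by
    rw [← hVN, hspec.eq_sum, show ∑ j, lam j • outer (bh j) = specMat lam bh from rfl, qf_specMat,
      Finset.mul_sum]
    exact Finset.sum_congr rfl fun k _ => by ring
  have hm : Antitone fun k => s * lam k := fun i j hij =>
    mul_le_mul_of_nonneg_left (hspec.antitone hij) hs.le
  have hlow : ∀ y, (1 - K * (C * x)) * ∑ k, l k * ⟪b k, y⟫ ^ 2 ≤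
      ∑ k, s * lam k * ⟪bh k, y⟫ ^ 2 := fun y => by
    rw [hmN, ← hq0]; exact (hst _).1
  have hup : ∀ y, ∑ k, s * lam k * ⟪bh k, y⟫ ^ 2 ≤ ∑ k, l k * ⟪b k, y⟫ ^ 2 := fun y => by
    rw [hmN, ← hq0]; exact (hst _).2.1
  have hd2' : d ^ 2 ≤ 1 / 4 := by nlinarith
  -- Two regimes: some other relative eigenvalue is at least one half, and anticoncentration
  -- applies; or all are below one half, and the gap alone suffices.
  have hangle : d ^ 2 ≤ |⟪bh 0, b 0⟫| := by
    by_cases hk : ∃ k, k ≠ 0 ∧ 1 / 2 ≤ relScale l k ^ 2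
    · refine not_small_angle hl hl0 hm hmN h4 hε0 hw ht hK0.le (fun y => (hst y).2.2) hn
        (by positivity) (by linarith) (hgood hk) ?_
      rw [Real.sqrt_sq hd0.le]
      have h1 : √n * (3 * ((p + 2) * p * (C * x)) * d + 4 * K * (C * x) ^ 2 / d) =
          (√n * x) * (3 * ((p + 2) * p * C) * d) + (√n * x) * (4 * K * C ^ 2 / d * x) := by
        field_simp
      rw [h1, hnx]
      have h2 : (p + 2) * (d * (6 * p * C)) ≤ (p + 2) * r :=
        mul_le_mul_of_nonneg_left hd2 (by positivity)
      linarith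
    · push Not at hk
      refine le_trans (by linarith) (le_abs_inner_of_gap hl hm (ε := K * (C * x)) (by linarith)
        hlow hup fun k hk0 => ?_)
      have h1 := hk k hk0
      rw [relScale_sq hl, div_lt_iff₀ (hl 0)] at h1
      linarith
  obtain ⟨t', ht', ht0, hmpos, hpert⟩ := nullEigenvectors_perturbation hl hl0 hm
    (by positivity) (by linarith) hlow hup (by positivity) hangle
  have hη : 13 * (p : ℝ) ^ 2 * √(K * (C * x)) / (d ^ 2) ^ 2 = A * √x := by
    rw [← mul_assoc, Real.sqrt_mul (by positivity)]; simp only [A]; ring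
  rw [hη] at hpert
  -- With `x = 1 / √n` the relative error is `A √x`, of order `n^(-1/4)`. As `√n x = 1`, the cubic
  -- term is of the same order.
  have hsum : A * √x + √n * (A * √x) ^ 3 = (A + A ^ 3) * √x := by
    have h1 : √x ^ 2 = x := Real.sq_sqrt hx0.le
    have h2 : √(n : ℝ) * (A * √x) ^ 3 = A ^ 3 * √x * (√n * √x ^ 2) := by ring
    rw [h2, h1, hnx]; ring
  have hest : nullShapeEstimator (b 0) lam bh = specMat lam t' := by
    rw [nullShapeEstimator, specMat]
    exact Finset.sum_congr rfl fun j _ => by rw [ht']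
  choose c hc hu using fun i => exists_eq_smul_sqrtMap_whiten hl b (u i)
  have hfin := hK2 (w := w) hn hs hl (fun k => pos_of_mul_pos_right (hmpos k) hs.le) ht0 hc hu hw hO
    (by positivity) (by linarith) (by rw [hsum]; exact e5.le) hpert
  rw [hest]
  rw [hsum] at hfin
  linarith

end

/-! ### From closeness in probability to convergence of distribution functions and quantiles. -/

section

lemma continuous_cdf (ν : Measure ℝ) [IsProbabilityMeasure ν] [NullSingletonClass ν] :
    Continuous (cdf ν) := by
  rw [continuous_iff_continuousAt]
  intro x
  rw [(monotone_cdf ν).continuousAt_iff_leftLim_eq_rightLim, StieltjesFunction.rightLim_eq]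
  have h : (cdf ν).measure {x} = 0 := by rw [measure_cdf]; exact measure_singleton x
  rw [StieltjesFunction.measure_singleton, ENNReal.ofReal_eq_zero] at h
  exact le_antisymm ((monotone_cdf ν).leftLim_le le_rfl) (by linarith)

lemma measure_Ioi_eq_cdf (ν : Measure ℝ) [IsProbabilityMeasure ν] (x : ℝ) :
    ν (Set.Ioi x) = ENNReal.ofReal (1 - cdf ν x) := by
  rw [← Set.compl_Iic, prob_compl_eq_one_sub measurableSet_Iic, ← ofReal_cdf,
    ENNReal.ofReal_sub _ (cdf_nonneg ν x), ENNReal.ofReal_one]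

/-- A sandwich argument with two vanishing perturbations. -/
lemma tendsto_of_sandwich {a : ℕ → ENNReal} {u l : ℝ → ℕ → ENNReal} {G : ℝ → ENNReal}
    (hu : ∀ τ, Tendsto (u τ) atTop (𝓝 (G τ))) (hl : ∀ τ, Tendsto (l τ) atTop (𝓝 (G (-τ))))
    (hG : ContinuousAt G 0)
    (hau : ∀ τ > 0, ∀ θ : ℝ, 0 < θ → ∀ᶠ n in atTop, a n ≤ u τ n + ENNReal.ofReal θ)
    (hla : ∀ τ > 0, ∀ θ : ℝ, 0 < θ → ∀ᶠ n in atTop, l τ n ≤ a n + ENNReal.ofReal θ) :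
    Tendsto a atTop (𝓝 (G 0)) := by
  have h1 : Tendsto G (𝓝[>] 0) (𝓝 (G 0)) := hG.tendsto.mono_left nhdsWithin_le_nhds
  have h2 : Tendsto (fun τ => G (-τ)) (𝓝[>] 0) (𝓝 (G 0)) := by
    have h : Tendsto (fun τ : ℝ => -τ) (𝓝[>] 0) (𝓝 0) := by
      have := (continuous_neg (G := ℝ)).tendsto 0
      rw [neg_zero] at this
      exact this.mono_left nhdsWithin_le_nhds
    exact hG.tendsto.comp h
  have key : ∀ {b c : ENNReal}, (∀ θ : ℝ, 0 < θ → b ≤ c + ENNReal.ofReal θ) → b ≤ c := by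
    intro b c h
    refine ENNReal.le_of_forall_pos_le_add fun ε hε _ => ?_
    have := h ε (by exact_mod_cast hε)
    rwa [ENNReal.ofReal_coe_nnreal] at this
  refine tendsto_of_le_liminf_of_limsup_le ?_ ?_
  · refine le_of_tendsto h2 ?_
    filter_upwards [self_mem_nhdsWithin] with τ hτ
    refine key fun θ hθ => tsub_le_iff_right.1 ?_
    have h3 := ENNReal.Tendsto.sub (hl τ) (tendsto_const_nhds (x := ENNReal.ofReal θ))
      (Or.inr ENNReal.ofReal_ne_top)
    rw [← h3.liminf_eq]
    refine liminf_le_liminf ?_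
    filter_upwards [hla τ hτ θ hθ] with n hn
    exact tsub_le_iff_right.2 hn
  · refine ge_of_tendsto h1 ?_
    filter_upwards [self_mem_nhdsWithin] with τ hτ
    refine key fun θ hθ => ?_
    have h3 := (hu τ).add (tendsto_const_nhds (x := ENNReal.ofReal θ))
    rw [← h3.limsup_eq]
    exact limsup_le_limsup (hau τ hτ θ hθ)

variable {Ω : ℕ → Type*} [∀ n, MeasurableSpace (Ω n)] {P : ∀ n, Measure (Ω n)}
  [∀ n, IsProbabilityMeasure (P n)] {ν : Measure ℝ} [IsProbabilityMeasure ν] [NullSingletonClass ν]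

lemma tendsto_measure_preimage_of_tendstoInDistribution {S : ∀ n, Ω n → ℝ}
    (hS : TendstoInDistribution S atTop (id : ℝ → ℝ) P ν) {E : Set ℝ} (hE : MeasurableSet E)
    (hfr : ν (frontier E) = 0) : Tendsto (fun n => P n (S n ⁻¹' E)) atTop (𝓝 (ν E)) := by
  have h := ProbabilityMeasure.tendsto_measure_of_null_frontier_of_tendsto' hS.tendsto (E := E)
    (by simpa using hfr)
  simp only [ProbabilityMeasure.coe_mk, Measure.map_id] at h
  refine h.congr fun n => ?_
  rw [Measure.map_apply_of_aemeasurable (hS.forall_aemeasurable n) hE]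

/-- Distribution functions converge along a possibly nonmeasurable sequence that is close in
probability to one converging in distribution to an atomless law. -/
lemma tendsto_measure_of_close {S T : ∀ n, Ω n → ℝ}
    (hS : TendstoInDistribution S atTop (id : ℝ → ℝ) P ν)
    (hST : ∀ τ > 0, ∀ θ : ℝ, 0 < θ → ∀ᶠ n in atTop,
      P n {ω | τ < |T n ω - S n ω|} ≤ ENNReal.ofReal θ) (x : ℝ) :
    Tendsto (fun n => P n {ω | T n ω ≤ x}) atTop (𝓝 (ν (Set.Iic x))) ∧
      Tendsto (fun n => P n {ω | x < T n ω}) atTop (𝓝 (ν (Set.Ioi x))) := by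
  have hc := continuous_cdf ν
  have hI : ∀ y, Tendsto (fun n => P n {ω | S n ω ≤ y}) atTop (𝓝 (ν (Set.Iic y))) := fun y =>
    tendsto_measure_preimage_of_tendstoInDistribution hS (E := Set.Iic y)
      measurableSet_Iic (by simp)
  have hJ : ∀ y, Tendsto (fun n => P n {ω | y < S n ω}) atTop (𝓝 (ν (Set.Ioi y))) := fun y =>
    tendsto_measure_preimage_of_tendstoInDistribution hS (E := Set.Ioi y)
      measurableSet_Ioi (by simp)
  have hle : ∀ {n} {A B C : Set (Ω n)} {θ : ENNReal}, A ⊆ B ∪ C → P n C ≤ θ →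
      P n A ≤ P n B + θ := fun h h' =>
    (measure_mono h).trans ((measure_union_le _ _).trans (by gcongr))
  constructor
  -- The event for `T` lies between the events for `S` at `x - τ` and `x + τ`, up to small measure,
  -- and continuity of the limiting distribution function lets `τ` vanish. Only monotonicity and
  -- subadditivity of the measure touch `T`, so it need not be measurable.
  · have h := tendsto_of_sandwich (G := fun τ => ν (Set.Iic (x + τ)))
      (fun τ => hI (x + τ)) (fun τ => hI (x + -τ)) ?_ (a := fun n => P n {ω | T n ω ≤ x})
      (fun τ hτ θ hθ => ?_) (fun τ hτ θ hθ => ?_)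
    · simpa using h
    · simp_rw [← ofReal_cdf]
      exact (ENNReal.continuous_ofReal.comp (hc.comp (continuous_const.add continuous_id))).continuousAt
    · filter_upwards [hST τ hτ θ hθ] with n hn
      refine hle (fun ω hω => ?_) hn
      by_contra hcon
      simp only [Set.mem_union, Set.mem_ofPred_eq, not_or, not_le, not_lt] at hcon hω
      linarith [(abs_le.1 hcon.2).1]
    · filter_upwards [hST τ hτ θ hθ] with n hn
      refine hle (fun ω hω => ?_) hn
      by_contra hcon
      simp only [Set.mem_union, Set.mem_ofPred_eq, not_or, not_le, not_lt] at hcon hω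
      linarith [(abs_le.1 hcon.2).2]
  · have h := tendsto_of_sandwich (G := fun τ => ν (Set.Ioi (x - τ)))
      (fun τ => hJ (x - τ)) (fun τ => hJ (x - -τ)) ?_ (a := fun n => P n {ω | x < T n ω})
      (fun τ hτ θ hθ => ?_) (fun τ hτ θ hθ => ?_)
    · simpa using h
    · simp_rw [measure_Ioi_eq_cdf]
      exact (ENNReal.continuous_ofReal.comp (continuous_const.sub
        (hc.comp (continuous_const.sub continuous_id)))).continuousAt
    · filter_upwards [hST τ hτ θ hθ] with n hn
      refine hle (fun ω hω => ?_) hn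
      by_contra hcon
      simp only [Set.mem_union, Set.mem_ofPred_eq, not_or, not_lt] at hcon hω
      linarith [(abs_le.1 hcon.2).2]
    · filter_upwards [hST τ hτ θ hθ] with n hn
      refine hle (fun ω hω => ?_) hn
      by_contra hcon
      simp only [Set.mem_union, Set.mem_ofPred_eq, not_or, not_lt] at hcon hω
      linarith [(abs_le.1 hcon.2).1]

/-- Weak convergence on the line from convergence of the distribution functions. -/
lemma tendstoInDistribution_of_tendsto_measure_le {T : ∀ n, Ω n → ℝ}
    (hT : ∀ n, AEMeasurable (T n) (P n))
    (h : ∀ x, Tendsto (fun n => P n {ω | T n ω ≤ x}) atTop (𝓝 (ν (Set.Iic x)))) :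
    TendstoInDistribution T atTop (id : ℝ → ℝ) P ν := by
  refine ⟨hT, aemeasurable_id, ?_⟩
  refine (isPiSystem_Ioc (id : ℝ → ℝ) (id : ℝ → ℝ)).tendsto_probabilityMeasure_of_tendsto_of_mem
    ?_ ?_ ?_
  · rintro s ⟨a, b, -, rfl⟩
    exact measurableSet_Ioc
  · intro G hG x hx
    obtain ⟨ε, hε, hb⟩ := Metric.isOpen_iff.1 hG x hx
    refine ⟨Set.Ioc (x - ε / 2) (x + ε / 2),
      ⟨x - ε / 2, x + ε / 2, by simp only [id]; linarith, rfl⟩,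
      Ioc_mem_nhds (by linarith) (by linarith), fun y hy => hb ?_⟩
    rw [Metric.mem_ball, Real.dist_eq, abs_lt]
    constructor <;> linarith [hy.1, hy.2]
  · rintro s ⟨a, b, hab, rfl⟩
    simp only [id] at hab ⊢
    have hd : ∀ (m : Measure ℝ) [IsProbabilityMeasure m],
        m (Set.Ioc a b) = m (Set.Iic b) - m (Set.Iic a) := fun m _ => by
      rw [← Set.Iic_sdiff_Iic, measure_sdiff (Set.Iic_subset_Iic.2 hab.le)
        measurableSet_Iic.nullMeasurableSet (measure_ne_top _ _)]
    have hm : ∀ n x, (P n).map (T n) (Set.Iic x) = P n {ω | T n ω ≤ x} := fun n x =>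
      Measure.map_apply_of_aemeasurable (hT n) measurableSet_Iic
    have := fun n => Measure.isProbabilityMeasure_map (hT n)
    have hlim : Tendsto (fun n => (P n).map (T n) (Set.Ioc a b)) atTop
        (𝓝 (ν.map id (Set.Ioc a b))) := by
      rw [Measure.map_id, hd ν]
      simp_rw [hd, hm]
      exact ENNReal.Tendsto.sub (h b) (h a) (Or.inl (measure_ne_top _ _))
    have hν := Measure.isProbabilityMeasure_map (aemeasurable_id (μ := ν))
    exact (ENNReal.tendsto_toNNReal (measure_ne_top (ν.map id) _)).comp hlim

instance nullSingletonClass_chiSquare (k : ℕ) [NeZero k] : NullSingletonClass (chiSquare k) :=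
  ⟨fun x => chiSquare_singleton (NeZero.ne k) x⟩

/-- Continuity of the distribution function makes the infimum attained, and the intermediate value
theorem supplies a point with value exactly `1 - α`; together they pin down the value at the
quantile. -/
lemma chiSquare_Ioi_upperQuantile (k : ℕ) [NeZero k] {α : ℝ} (h0 : 0 < α) (h1 : α < 1) :
    chiSquare k (Set.Ioi (chiSquareUpperQuantile k α)) = ENNReal.ofReal α := by
  have hc := continuous_cdf (chiSquare k)
  obtain ⟨x, hx⟩ : ∃ x, cdf (chiSquare k) x = 1 - α := by
    obtain ⟨a, ha⟩ := ((tendsto_cdf_atBot (chiSquare k)).eventually_lt_const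
      (show (0 : ℝ) < 1 - α by linarith)).exists
    obtain ⟨b, hb⟩ := ((tendsto_cdf_atTop (chiSquare k)).eventually_const_lt
      (show 1 - α < 1 by linarith)).exists
    exact mem_range_of_exists_le_of_exists_ge hc ⟨a, ha.le⟩ ⟨b, hb.le⟩
  obtain ⟨a, ha⟩ := ((tendsto_cdf_atBot (chiSquare k)).eventually_lt_const
      (show (0 : ℝ) < 1 - α by linarith)).exists
  set s := {x : ℝ | 1 - α ≤ cdf (chiSquare k) x}
  have hs : IsClosed s := isClosed_le continuous_const hc
  have hbd : BddBelow s := ⟨a, fun y hy => le_of_lt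
    ((monotone_cdf (chiSquare k)).reflect_lt (lt_of_lt_of_le ha hy))⟩
  have hxs : x ∈ s := hx.ge
  have h2 : 1 - α ≤ cdf (chiSquare k) (sInf s) := hs.csInf_mem ⟨x, hxs⟩ hbd
  have h3 : cdf (chiSquare k) (sInf s) ≤ 1 - α :=
    hx ▸ monotone_cdf (chiSquare k) (csInf_le hbd hxs)
  rw [measure_Ioi_eq_cdf, chiSquareUpperQuantile, le_antisymm h3 h2, sub_sub_cancel]

end

/-! ### Assembly: probability of irregular samples and comparison with the score statistic. -/

section
variable {p n : ℕ} [NeZero p]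

/-- With high probability a uniform sample is regular and, if the largest eigenvalue is not well
separated, has a large cross term at some slice maximiser. -/
lemma exists_eventually_measure_irregular_le (p : ℕ) [NeZero p] {θ : ℝ} (hθ : 0 < θ) :
    ∃ C r : ℝ, 0 < C ∧ 0 < r ∧ ∀ᶠ n : ℕ in atTop, ∀ κ : Fin p → ℝ, κ 0 = 1 → (∀ k, |κ k| ≤ 1) →
      (Measure.pi fun _ : Fin n => unif p)
        {u | ¬(FourthMomentsClose (fun i => (u i : EuclideanSpace ℝ (Fin p))) (C / √n) ∧
          OddSumsSmall (fun i => (u i : EuclideanSpace ℝ (Fin p))) C ∧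
          ((∃ k, k ≠ 0 ∧ 1 / 2 ≤ κ k ^ 2) → u ∉ smallCross κ (r * √n)))} ≤ ENNReal.ofReal θ := by
  obtain ⟨C, hC, hreg⟩ := exists_measure_not_regular_le p (show 0 < θ / 4 by positivity)
  obtain ⟨s, hs0, hs⟩ : ∃ s : ℝ, 0 ≤ s ∧ s = √(8 * (p * (p + 2))) := ⟨_, Real.sqrt_nonneg _, rfl⟩
  -- The budget `θ` is split into quarters: irregular moments twice (directly, and inside the
  -- anticoncentration bound), the linear small ball term `4 s r`, and the term `2 / (r² n)`.
  obtain ⟨r, hr, hrs⟩ : ∃ r : ℝ, 0 < r ∧ 4 * s * r ≤ θ / 4 := by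
    refine ⟨θ / (16 * (s + 1)), by positivity, ?_⟩
    rw [mul_div_assoc', div_le_div_iff₀ (by positivity) (by norm_num)]
    nlinarith
  refine ⟨C, r, hC, hr, ?_⟩
  have h1 : Tendsto (fun n : ℕ => 2 / (r ^ 2 * (n : ℝ))) atTop (𝓝 0) :=
    tendsto_const_nhds.div_atTop
      (tendsto_natCast_atTop_atTop.const_mul_atTop (by positivity))
  have h2 : Tendsto (fun n : ℕ => 4 * ((p + 2) * p * (C / √(n : ℝ)))) atTop (𝓝 0) := by
    have h : Tendsto (fun n : ℕ => C / √(n : ℝ)) atTop (𝓝 0) :=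
      tendsto_const_nhds.div_atTop (Real.tendsto_sqrt_atTop.comp tendsto_natCast_atTop_atTop)
    simpa using (h.const_mul ((p + 2 : ℝ) * p)).const_mul 4
  -- The threshold on `n` is chosen before `κ`, since the bounds depend on `p`, `C` and `r` only.
  -- This uniformity allows shapes that vary arbitrarily with `n`.
  filter_upwards [h1.eventually_le_const (show (0 : ℝ) < θ / 4 by positivity),
    h2.eventually_le_const one_pos, eventually_ne_atTop 0] with n hn1 hn2 hn κ hκ0 hκ
  have hR := hreg n hn
  have hF : (Measure.pi fun _ : Fin n => unif p)
      {u | ¬FourthMomentsClose (fun i => (u i : EuclideanSpace ℝ (Fin p))) (C / √n)} ≤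
        ENNReal.ofReal (θ / 4) :=
    le_trans (measure_mono fun u (hu : ¬ _) => fun h => hu h.1) hR
  have hS : (Measure.pi fun _ : Fin n => unif p)
      {u | (∃ k, k ≠ 0 ∧ 1 / 2 ≤ κ k ^ 2) ∧ u ∈ smallCross κ (r * √n)} ≤
        ENNReal.ofReal (θ / 2) + ENNReal.ofReal (θ / 4) := by
    by_cases hk : ∃ k, k ≠ 0 ∧ 1 / 2 ≤ κ k ^ 2
    · obtain ⟨k, hk0, hk2⟩ := hk
      refine (measure_mono fun u hu => hu.2).trans
        ((measure_smallCross_le hκ0 hκ hk0 hk2 hn2 hr hn).trans (add_le_add ?_ hF))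
      exact ENNReal.ofReal_le_ofReal (by rw [← hs]; linarith)
    · simp only [hk, false_and, Set.ofPred_false, measure_empty, zero_le]
  calc _ ≤ (Measure.pi fun _ : Fin n => unif p)
        ({u | ¬(FourthMomentsClose (fun i => (u i : EuclideanSpace ℝ (Fin p))) (C / √n) ∧
          OddSumsSmall (fun i => (u i : EuclideanSpace ℝ (Fin p))) C)} ∪
        {u | (∃ k, k ≠ 0 ∧ 1 / 2 ≤ κ k ^ 2) ∧ u ∈ smallCross κ (r * √n)}) := by
        refine measure_mono fun u hu => ?_
        simp only [Set.mem_union, Set.mem_ofPred_eq] at hu ⊢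
        tauto
    _ ≤ ENNReal.ofReal (θ / 4) + (ENNReal.ofReal (θ / 2) + ENNReal.ofReal (θ / 4)) :=
        (measure_union_le _ _).trans (add_le_add hR hS)
    _ = ENNReal.ofReal θ := by
        rw [← ENNReal.ofReal_add (by positivity) (by positivity),
          ← ENNReal.ofReal_add (by positivity) (by positivity)]
        congr 1; ring

lemma measurable_whiten (l : Fin p → ℝ)
    (b : OrthonormalBasis (Fin p) ℝ (EuclideanSpace ℝ (Fin p))) : Measurable (whiten l b) :=
  measurable_nrm.comp
    ((LinearMap.continuous_of_finiteDimensional _).measurable.comp measurable_subtype_coe)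

/-- The whitened sample is an i.i.d. uniform sample. -/
lemma map_whiten_sample {Ω : Type*} [MeasurableSpace Ω] {P : Measure Ω} [IsProbabilityMeasure P]
    {l : Fin p → ℝ} (hl : ∀ k, 0 < l k)
    (b : OrthonormalBasis (Fin p) ℝ (EuclideanSpace ℝ (Fin p))) {U : Fin n → Ω → Sph p}
    (hlaw : ∀ i, HasLaw (U i) (angularGaussian (specMat l b)) P) (hind : iIndepFun U P) :
    AEMeasurable (fun ω i => whiten l b (U i ω)) P ∧
      P.map (fun ω i => whiten l b (U i ω)) = Measure.pi fun _ => unif p := by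
  have hm : ∀ i, AEMeasurable (fun ω => whiten l b (U i ω)) P := fun i =>
    (measurable_whiten l b).comp_aemeasurable (hlaw i).aemeasurable
  refine ⟨aemeasurable_pi_lambda _ hm, ?_⟩
  have h := (iIndepFun_iff_map_fun_eq_pi_map hm).1
    (hind.comp (fun _ => whiten l b) fun _ => measurable_whiten l b)
  rw [h]
  congr 1
  funext i
  have : IsProbabilityMeasure (angularGaussian (specMat l b)) :=
    (hlaw i).map_eq ▸ Measure.isProbabilityMeasure_map (hlaw i).aemeasurable
  rw [← map_angularGaussian hl b, ← (hlaw i).map_eq]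
  change _ = Measure.map (whiten l b) _
  rw [
    AEMeasurable.map_map_of_aemeasurable (measurable_whiten l b).aemeasurable
      (hlaw i).aemeasurable]
  rfl

lemma exists_spectral_of_isNullShape {θ₀ : EuclideanSpace ℝ (Fin p)}
    {V : Matrix (Fin p) (Fin p) ℝ} (h : IsNullShape θ₀ V) :
    ∃ (l : Fin p → ℝ) (b : OrthonormalBasis (Fin p) ℝ (EuclideanSpace ℝ (Fin p))),
      V = specMat l b ∧ b 0 = θ₀ ∧ (∀ k, 0 < l k) ∧ ∀ k, l k ≤ l 0 := by
  obtain ⟨hV, l, b, hs, hb, -⟩ := h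
  refine ⟨l, b, hs.eq_sum, hb, fun k => ?_, fun k => hs.antitone (Fin.zero_le k)⟩
  exact pos_of_specMat_posDef (by rw [← show V = specMat l b from hs.eq_sum]; exact hV.posDef) k

variable {Ω : ℕ → Type*} [∀ n, MeasurableSpace (Ω n)] {P : ∀ n, Measure (Ω n)}
  [∀ n, IsProbabilityMeasure (P n)]

lemma tendstoInDistribution_of_map_eq {Ω' : ℕ → Type*} [∀ n, MeasurableSpace (Ω' n)]
    {Q : ∀ n, Measure (Ω' n)} [∀ n, IsProbabilityMeasure (Q n)] {ν : Measure ℝ}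
    [IsProbabilityMeasure ν] {W : ∀ n, Ω n → Ω' n} {S : ∀ n, Ω' n → ℝ}
    (hW : ∀ n, AEMeasurable (W n) (P n)) (hQ : ∀ n, (P n).map (W n) = Q n)
    (hS : ∀ n, Measurable (S n)) (h : TendstoInDistribution S atTop (id : ℝ → ℝ) Q ν) :
    TendstoInDistribution (fun n ω => S n (W n ω)) atTop (id : ℝ → ℝ) P ν := by
  refine ⟨fun n => (hS n).comp_aemeasurable (hW n), aemeasurable_id, ?_⟩
  refine h.tendsto.congr fun n => Subtype.ext ?_
  change (Q n).map (S n) = (P n).map (S n ∘ W n)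
  rw [← hQ n, AEMeasurable.map_map_of_aemeasurable (hS n).aemeasurable (hW n)]

/-- The sign statistic at the estimated null shape is close, in probability, to a statistic that
is asymptotically chi-square. -/
theorem exists_tendstoInDistribution_and_close
    (θ₀ : EuclideanSpace ℝ (Fin p)) (V₀ : ℕ → Matrix (Fin p) (Fin p) ℝ)
    (hV₀ : ∀ n, IsNullShape θ₀ (V₀ n)) (U : ∀ n, Fin n → Ω n → Sph p)
    (hlaw : ∀ n i, HasLaw (U n i) (angularGaussian (V₀ n)) (P n))
    (hindep : ∀ n, iIndepFun (U n) (P n))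
    (Vhat : ∀ n, (Fin n → Sph p) → Matrix (Fin p) (Fin p) ℝ)
    (lhat : ∀ n, (Fin n → Sph p) → Fin p → ℝ)
    (bhat : ∀ n, (Fin n → Sph p) →
      OrthonormalBasis (Fin p) ℝ (EuclideanSpace ℝ (Fin p)))
    (hhat : ∀ n, ∀ᵐ ω ∂(P n),
      (∃ V, IsTylerEstimator (fun i => U n i ω) V) →
        IsTylerEstimator (fun i => U n i ω) (Vhat n fun i => U n i ω) ∧
        IsSpectralDecomposition (Vhat n fun i => U n i ω) (lhat n fun i => U n i ω)
          (bhat n fun i => U n i ω)) :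
    ∃ S : ∀ n, Ω n → ℝ,
      TendstoInDistribution S atTop (id : ℝ → ℝ) P (chiSquare (p - 1)) ∧
      ∀ τ > 0, ∀ θ : ℝ, 0 < θ → ∀ᶠ n in atTop,
        P n {ω | τ < |signStatistic θ₀ (fun i => U n i ω)
          (nullShapeEstimator θ₀ (lhat n fun i => U n i ω) (bhat n fun i => U n i ω)) - S n ω|} ≤
            ENNReal.ofReal θ := by
  choose l b hV hb hl hl0 using fun n => exists_spectral_of_isNullShape (hV₀ n)
  have hW : ∀ n, AEMeasurable (fun ω i => whiten (l n) (b n) (U n i ω)) (P n) ∧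
      (P n).map (fun ω i => whiten (l n) (b n) (U n i ω)) = Measure.pi fun _ => unif p := fun n =>
    map_whiten_sample (hl n) (b n) (fun i => hV n ▸ hlaw n i) (hindep n)
  have hcont : ∀ n, Measurable fun u : Fin n → Sph p =>
      scoreStat fun i => (u i : EuclideanSpace ℝ (Fin p)) := fun n => by
    simp_rw [scoreStat_eq_norm_scoreSum]
    exact (continuous_scoreSum.norm.pow 2).measurable
  refine ⟨_, tendstoInDistribution_of_map_eq (fun n => (hW n).1) (fun n => (hW n).2) hcont
    tendstoInDistribution_scoreStat, fun τ hτ θ hθ => ?_⟩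
  obtain ⟨C, r, hC, hr, hbad⟩ := exists_eventually_measure_irregular_le p hθ
  filter_upwards [hbad, eventually_signStatistic_sub_scoreStat_le p hC hr hτ] with n hn1 hn2
  refine le_trans ?_ (hn1 _ (relScale_zero (hl n)) (abs_relScale_le (hl n) (hl0 n)))
  rw [← (hW n).2]
  -- The set of irregular samples is not known to be measurable, but the inequality between the
  -- measure of a preimage and the image measure always holds, in the direction required.
  refine le_trans (measure_mono_ae ?_) (Measure.le_map_apply (hW n).1 _)
  filter_upwards [hhat n] with ω hω hτω hreg
  obtain ⟨hex, hall⟩ := hn2 (l n) (b n) (fun i => U n i ω) (hl n) (hl0 n) hreg.1 hreg.2.1 hreg.2.2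
  have h := hall _ _ _ (hω hex).1 (hω hex).2
  rw [hb n] at h
  exact absurd hτω (not_lt.2 h)

end

end SignTest

end

theorem mainTheorem3 (p : ℕ) [NeZero p] (hp : 2 ≤ p)
    (θ₀ : EuclideanSpace ℝ (Fin p)) (hθ₀ : ‖θ₀‖ = 1)
    -- an arbitrary sequence of null shape matrices
    (V₀ : ℕ → Matrix (Fin p) (Fin p) ℝ) (hV₀ : ∀ n, IsNullShape θ₀ (V₀ n))
    -- a triangular array with i.i.d. angular Gaussian rows
    (Ω : ℕ → Type*) [∀ n, MeasurableSpace (Ω n)]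
    (P : ∀ n, Measure (Ω n)) [∀ n, IsProbabilityMeasure (P n)]
    (U : ∀ n, Fin n → Ω n → Sph p)
    (hlaw : ∀ n i, HasLaw (U n i) (angularGaussian (V₀ n)) (P n))
    (hindep : ∀ n, iIndepFun (U n) (P n))
    -- Tyler's M-estimator, whenever it exists, and any choice of its spectral decomposition
    (Vhat : ∀ n, (Fin n → Sph p) → Matrix (Fin p) (Fin p) ℝ)
    (lhat : ∀ n, (Fin n → Sph p) → Fin p → ℝ)
    (bhat : ∀ n, (Fin n → Sph p) →
      OrthonormalBasis (Fin p) ℝ (EuclideanSpace ℝ (Fin p)))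
    (hhat : ∀ n, ∀ᵐ ω ∂(P n),
      (∃ V, IsTylerEstimator (fun i => U n i ω) V) →
        IsTylerEstimator (fun i => U n i ω) (Vhat n fun i => U n i ω) ∧
        IsSpectralDecomposition (Vhat n fun i => U n i ω) (lhat n fun i => U n i ω)
          (bhat n fun i => U n i ω))
    -- the test statistic
    (T : ∀ n, Ω n → ℝ)
    (hT : ∀ n ω, T n ω = signStatistic θ₀ (fun i => U n i ω)
      (nullShapeEstimator θ₀ (lhat n fun i => U n i ω) (bhat n fun i => U n i ω))) :
    -- convergence in distribution, through distribution functions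
    (∀ x : ℝ, Tendsto (fun n => P n {ω | T n ω ≤ x}) atTop
      (𝓝 (chiSquare (p - 1) (Set.Iic x)))) ∧
    -- convergence in distribution, as weak convergence of the laws
    ((∀ n, AEMeasurable (T n) (P n)) →
      TendstoInDistribution T atTop (id : ℝ → ℝ) P (chiSquare (p - 1))) ∧
    -- the test meets the asymptotic level constraint
    (∀ α : ℝ, 0 < α → α < 1 →
      Tendsto (fun n => P n {ω | chiSquareUpperQuantile (p - 1) α < T n ω}) atTop
        (𝓝 (ENNReal.ofReal α))) := by
  -- Since `p ≥ 2` there is at least one degree of freedom, so the limit law has no atoms.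
  have : NeZero (p - 1) := ⟨by omega⟩
  obtain ⟨S, hS, hclose⟩ := exists_tendstoInDistribution_and_close θ₀ V₀ hV₀ U hlaw hindep
    Vhat lhat bhat hhat
  simp_rw [← hT] at hclose
  have h := tendsto_measure_of_close hS hclose
  refine ⟨fun x => (h x).1,
    fun hm => tendstoInDistribution_of_tendsto_measure_le hm fun x => (h x).1, fun α h0 h1 => ?_⟩
  rw [← chiSquare_Ioi_upperQuantile (p - 1) h0 h1]
  exact (h _).2
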